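/- Let $\widehat{\mathbb C}=\mathbb C\cup\{\infty\}$ be the Riemann sphere, $\mathbb D$ the open unit disk, and let $\Omega=\{(z,w)\in\widehat{\mathbb C}^2 : z\cdot w\neq 1\}$, where $z\cdot\infty=\infty\cdot z=\infty$ for $z\ne 0$ and, by convention, $0\cdot\infty=\infty\cdot 0=1$. The set $\Omega$ is an open subset of $\widehat{\mathbb C}^2$, covered by the charts $(u,v)\mapsto(u,v)$ on $\Omega\cap\mathbb C^2$ and $(u,v)\mapsto(1/v,1/u)$ on $\Omega\cap(\widehat{\mathbb C}\setminus\{0\})^2$; in each of them the invariant Laplacian is $\Delta_{zw}=4(1-zw)^2\partial_z\partial_w$. For an open set $D\subseteq\Omega$ and $\lambda\in\mathbb C$ let $X_\lambda(D)$ be the space of all holomorphic functions $F:D\to\mathbb C$ with $\Delta_{zw}F=\lambda F$ on $D$. A subdomain (nonempty, open and connected subset) $D\subseteq\Omega$ with $D\supseteq\mathbb D^2$ is called a maximal domain of existence of a holomorphic function $F$ on $\mathbb D^2$ if $F$ has a holomorphic extension to $D$, but to no strictly larger subdomain of $\Omega$. Let $\Delta_{\mathbb D}=4(1-|z|^2)^2\partial_z\partial_{\overline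 z}$ be the hyperbolic Laplacian on $\mathbb D$, let $\Delta_{\widehat{\mathbb C}}=-4(1+|z|^2)^2\partial_z\partial_{\overline z}$ be the spherical Laplacian on $\widehat{\mathbb C}$ (given by the same formula in the chart $1/z$ near $\infty$), and let $X_\lambda(\mathbb D)=\{f\in C^2(\mathbb D):\Delta_{\mathbb D}f=\lambda f\}$. A subspace of $C^2(\mathbb D)$, closed with respect to locally uniform convergence, is called Möbius invariant if it is invariant under $f\mapsto f\circ\psi$ for every conformal automorphism $\psi$ of $\mathbb D$; a Möbius invariant subspace $Y$ of $X_\lambda(\mathbb D)$ is called non-trivial if $Y\ne\{0\}$ and $Y\neq X_\lambda(\mathbb D)$. Let $\mathcal R_h(F)(z)=F(z,\overline z)$ for $F:\mathbb D^2\to\mathbb C$ and $z\in\mathbb D$, and regard $X_\lambda(\Omega)$ as a subspace of $X_\lambda(\mathbb D^2)$ by restriction. **Theorem.** Let $\lambda\in\mathbb C$. The following conditions are equivalent: (i) there exists a function $F\in X_\lambda(\mathbb D^2)$, $F\not\equiv 0$, with $\Omega$ as a maximal domain of existence; (ii) there exists a function $g\in C^2(\widehat{\mathbb C})$, $g\not\equiv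 0$, such that $\Delta_{\widehat{\mathbb C}}g=\lambda g$ on $\widehat{\mathbb C}$; (iii) $\lambda=4m(m+1)$ for some non-negative integer $m$. If $\lambda=4m(m+1)$ with a non-negative integer $m$, then $\dim X_\lambda(\Omega)=2m+1$ and the following statements hold. (a) There is exactly one non-trivial Möbius invariant subspace $X^0_\lambda(\mathbb D)$ of $X_\lambda(\mathbb D)$ of finite dimension, and $X^0_\lambda(\mathbb D)=\mathcal R_h(X_\lambda(\Omega))$. Moreover, every $F\in X_\lambda(\mathbb D^2)$ with $\mathcal R_h(F)\in X^0_\lambda(\mathbb D)$ has $\Omega$ as its one and only maximal domain of existence. (b) $\{g\in C^2(\widehat{\mathbb C}):\Delta_{\widehat{\mathbb C}}g=\lambda g\text{ on }\widehat{\mathbb C}\}=\{\,\widehat{\mathbb C}\ni z\mapsto F(z,-\overline z) : F\in X_\lambda(\Omega)\,\}$, where $-\overline{\infty}=\infty$. -/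

import Mathlib

open scoped Topology

noncomputable section

namespace InvLaplace

/-- The Riemann sphere, as the one-point compactification of the complex plane. -/
abbrev Sphere : Type := OnePoint ℂ

/-- The inversion `z ↦ 1 / z` of the Riemann sphere, with `1 / 0 = ∞` and `1 / ∞ = 0`. -/
def sphereInv : Sphere → Sphere
  | none => ((0 : ℂ) : Sphere)
  | some z => if z = 0 then OnePoint.infty else ((z⁻¹ : ℂ) : Sphere)

/-- Multiplication on the Riemann sphere, with `z * ∞ = ∞ * z = ∞` for `z ≠ 0` and the convention
`0 * ∞ = ∞ * 0 = 1`. -/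
def sphereMul : Sphere → Sphere → Sphere
  | none, none => OnePoint.infty
  | none, some w => if w = 0 then ((1 : ℂ) : Sphere) else OnePoint.infty
  | some z, none => if z = 0 then ((1 : ℂ) : Sphere) else OnePoint.infty
  | some z, some w => ((z * w : ℂ) : Sphere)

/-- The involution `z ↦ -conj z` of the Riemann sphere, fixing `∞`. -/
def sphereNegConj : Sphere → Sphere
  | none => OnePoint.infty
  | some z => ((-(starRingEnd ℂ) z : ℂ) : Sphere)

/-- `Ω`, the set of all `(z, w)` in the product of two Riemann spheres with `z * w ≠ 1`. -/
def Omega : Set (Sphere × Sphere) :=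
  {p | sphereMul p.1 p.2 ≠ ((1 : ℂ) : Sphere)}

/-- The open unit disk in `ℂ`. -/
def disk : Set ℂ := Metric.ball 0 1

/-- The inverse of the standard chart `(u, v) ↦ (u, v)`. -/
def stdMap (p : ℂ × ℂ) : Sphere × Sphere := ((p.1 : Sphere), (p.2 : Sphere))

/-- The inverse of the flip chart `(u, v) ↦ (1 / v, 1 / u)`. -/
def flipMap (p : ℂ × ℂ) : Sphere × Sphere :=
  (sphereInv (p.2 : Sphere), sphereInv (p.1 : Sphere))

/-- The bidisk, as a subset of the product of two Riemann spheres. -/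
def bidisk : Set (Sphere × Sphere) := stdMap '' (disk ×ˢ disk)

/-- Extension by zero of a function on a subset; on an open subset, local notions (analyticity,
differentiability, derivatives) do not depend on the values outside. -/
def extendZero {α : Type} {D : Set α} (F : D → ℂ) : α → ℂ :=
  Function.extend Subtype.val F 0

/-! ### Functions on subsets of `Ω` -/

/-- The partial derivative `∂_z` of a function of two complex variables. -/
def partialZ (f : ℂ × ℂ → ℂ) (p : ℂ × ℂ) : ℂ := fderiv ℂ f p (1, 0)

/-- The partial derivative `∂_w` of a function of two complex variables. -/
def partialW (f : ℂ × ℂ → ℂ) (p : ℂ × ℂ) : ℂ := fderiv ℂ f p (0, 1)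

/-- The operator `4 (1 - z w)² ∂_z ∂_w`. It is the expression of the invariant Laplacian in the
standard chart and in the flip chart. -/
def lapZW (f : ℂ × ℂ → ℂ) (p : ℂ × ℂ) : ℂ :=
  4 * (1 - p.1 * p.2) ^ 2 * partialZ (partialW f) p

/-- `F` is holomorphic on the open set `D ⊆ Ω`: it is analytic as a function of two complex
variables in the standard chart and in the flip chart (these two charts cover `Ω`). -/
def IsHolo {D : Set (Sphere × Sphere)} (F : D → ℂ) : Prop :=
  (∀ p : ℂ × ℂ, stdMap p ∈ D → AnalyticAt ℂ (extendZero F ∘ stdMap) p) ∧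
  (∀ p : ℂ × ℂ, flipMap p ∈ D → AnalyticAt ℂ (extendZero F ∘ flipMap) p)

/-- `Δ_{zw} F = lam F` on the open set `D ⊆ Ω`, expressed in both charts. -/
def IsLapEigen (lam : ℂ) {D : Set (Sphere × Sphere)} (F : D → ℂ) : Prop :=
  (∀ p : ℂ × ℂ, stdMap p ∈ D →
    lapZW (extendZero F ∘ stdMap) p = lam * extendZero F (stdMap p)) ∧
  (∀ p : ℂ × ℂ, flipMap p ∈ D →
    lapZW (extendZero F ∘ flipMap) p = lam * extendZero F (flipMap p))

/-- A subdomain: a nonempty, open and connected set. -/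
def IsSubdomain (D : Set (Sphere × Sphere)) : Prop := IsOpen D ∧ IsConnected D

/-- `F`, a function on the bidisk, has a holomorphic extension to `D ⊇ 𝔻²`. -/
def HasHoloExtension (F : bidisk → ℂ) (D : Set (Sphere × Sphere)) : Prop :=
  ∃ (h : bidisk ⊆ D) (G : D → ℂ), IsHolo G ∧ F = G ∘ Set.inclusion h

/-- `D` is a maximal domain of existence of the function `F` on the bidisk: `D` is a subdomain
of `Ω` that contains the bidisk, and `F` has a holomorphic extension to `D`, but to no strictly
larger subdomain of `Ω`. -/
def IsMaximalDomainOfExistence (F : bidisk → ℂ) (D : Set (Sphere × Sphere)) : Prop :=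
  IsSubdomain D ∧ bidisk ⊆ D ∧ D ⊆ Omega ∧ HasHoloExtension F D ∧
    ∀ D' : Set (Sphere × Sphere), IsSubdomain D' → D' ⊆ Omega → D ⊂ D' → ¬ HasHoloExtension F D'

/-! ### Smooth functions on the disk and on the sphere -/

/-- The Wirtinger derivative `∂_z`. -/
def wirtZ (f : ℂ → ℂ) (z : ℂ) : ℂ := (fderiv ℝ f z 1 - Complex.I * fderiv ℝ f z Complex.I) / 2

/-- The Wirtinger derivative `∂_{conj z}`. -/
def wirtZbar (f : ℂ → ℂ) (z : ℂ) : ℂ := (fderiv ℝ f z 1 + Complex.I * fderiv ℝ f z Complex.I) / 2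

/-- The hyperbolic Laplacian `4 (1 - |z|²)² ∂_z ∂_{conj z}`. -/
def lapDisk (f : ℂ → ℂ) (z : ℂ) : ℂ :=
  4 * (1 - (‖z‖ : ℂ) ^ 2) ^ 2 * wirtZ (wirtZbar f) z

/-- The operator `-4 (1 + |z|²)² ∂_z ∂_{conj z}`. It is the expression of the spherical Laplacian
in the chart `z` and in the chart `1 / z`. -/
def lapSphere (f : ℂ → ℂ) (z : ℂ) : ℂ :=
  -4 * (1 + (‖z‖ : ℂ) ^ 2) ^ 2 * wirtZ (wirtZbar f) z

/-- Twice continuously (real) differentiable functions on the unit disk. -/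
def IsC2Disk (f : disk → ℂ) : Prop := ∀ z ∈ disk, ContDiffAt ℝ 2 (extendZero f) z

/-- The inverse of the chart `u ↦ 1 / u` of the Riemann sphere at infinity. -/
def inftyMap (z : ℂ) : Sphere := sphereInv (z : Sphere)

/-- Twice continuously (real) differentiable functions on the Riemann sphere. -/
def IsC2Sphere (g : Sphere → ℂ) : Prop :=
  ContDiff ℝ 2 (fun z : ℂ => g (z : Sphere)) ∧ ContDiff ℝ 2 (fun z : ℂ => g (inftyMap z))

/-! ### Linearity of the eigenvalue equations -/

theorem extendZero_apply {α : Type} {D : Set α} (F : D → ℂ) (x : D) :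
    extendZero F (x : α) = F x := Subtype.val_injective.extend_apply F 0 x

theorem extendZero_add {α : Type} {D : Set α} (F G : D → ℂ) :
    extendZero (F + G) = extendZero F + extendZero G := by
  classical
  funext x
  by_cases hx : x ∈ D
  · have h (H : D → ℂ) : extendZero H x = H ⟨x, hx⟩ := extendZero_apply H ⟨x, hx⟩
    simp only [Pi.add_apply, h]
  · have h (H : D → ℂ) : extendZero H x = 0 := by
      unfold extendZero
      rw [Function.extend_apply' _ _ _ (by rintro ⟨a, rfl⟩; exact hx a.2)]
      rfl
    simp only [Pi.add_apply, h, add_zero]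

theorem extendZero_smul {α : Type} {D : Set α} (c : ℂ) (F : D → ℂ) :
    extendZero (c • F) = c • extendZero F := by
  classical
  funext x
  by_cases hx : x ∈ D
  · have h (H : D → ℂ) : extendZero H x = H ⟨x, hx⟩ := extendZero_apply H ⟨x, hx⟩
    simp only [Pi.smul_apply, h]
  · have h (H : D → ℂ) : extendZero H x = 0 := by
      unfold extendZero
      rw [Function.extend_apply' _ _ _ (by rintro ⟨a, rfl⟩; exact hx a.2)]
      rfl
    simp only [Pi.smul_apply, h, smul_zero]

theorem extendZero_zero {α : Type} {D : Set α} : extendZero (0 : D → ℂ) = 0 := by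
  have h := extendZero_smul (D := D) 0 (0 : D → ℂ)
  simpa using h

theorem lapZW_add {f g : ℂ × ℂ → ℂ} {p : ℂ × ℂ} (hf : AnalyticAt ℂ f p) (hg : AnalyticAt ℂ g p) :
    lapZW (f + g) p = lapZW f p + lapZW g p := by
  have h1 : partialW (f + g) =ᶠ[𝓝 p] partialW f + partialW g := by
    filter_upwards [hf.eventually_analyticAt, hg.eventually_analyticAt] with q hq hq'
    simp [partialW, fderiv_add hq.differentiableAt hq'.differentiableAt]
  have d (k : ℂ × ℂ → ℂ) (hk : AnalyticAt ℂ k p) : DifferentiableAt ℂ (partialW k) p :=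
    hk.fderiv.differentiableAt.clm_apply (differentiableAt_const _)
  simp only [lapZW, partialZ]
  rw [h1.fderiv_eq, fderiv_add (d f hf) (d g hg)]
  simp only [_root_.add_apply]
  ring

theorem lapZW_smul {f : ℂ × ℂ → ℂ} {p : ℂ × ℂ} (c : ℂ) (hf : AnalyticAt ℂ f p) :
    lapZW (c • f) p = c * lapZW f p := by
  have h1 : partialW (c • f) =ᶠ[𝓝 p] c • partialW f := by
    filter_upwards [hf.eventually_analyticAt] with q hq
    simp [partialW, fderiv_const_smul hq.differentiableAt]
  have d : DifferentiableAt ℂ (partialW f) p :=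
    hf.fderiv.differentiableAt.clm_apply (differentiableAt_const _)
  simp only [lapZW, partialZ]
  rw [h1.fderiv_eq, fderiv_const_smul d]
  simp only [_root_.smul_apply, smul_eq_mul]
  ring

theorem differentiableAt_wirtZbar {f : ℂ → ℂ} {z : ℂ} (hf : ContDiffAt ℝ 2 f z) :
    DifferentiableAt ℝ (wirtZbar f) z := by
  have h : DifferentiableAt ℝ (fderiv ℝ f) z :=
    (hf.fderiv_right (m := 1) (by norm_num)).differentiableAt (by norm_num)
  have h1 (v : ℂ) : DifferentiableAt ℝ (fun y => fderiv ℝ f y v) z :=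
    h.clm_apply (differentiableAt_const _)
  have h2 := ((h1 1).add ((h1 Complex.I).const_mul Complex.I)).const_mul (2⁻¹ : ℂ)
  refine h2.congr_of_eventuallyEq (Filter.Eventually.of_forall fun y => ?_)
  simp only [wirtZbar, Pi.add_apply]
  ring

theorem wirt_add {f g : ℂ → ℂ} {z : ℂ} (hf : ContDiffAt ℝ 2 f z) (hg : ContDiffAt ℝ 2 g z) :
    wirtZ (wirtZbar (f + g)) z = wirtZ (wirtZbar f) z + wirtZ (wirtZbar g) z := by
  have h1 : wirtZbar (f + g) =ᶠ[𝓝 z] wirtZbar f + wirtZbar g := by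
    filter_upwards [hf.eventually (by simp), hg.eventually (by simp)] with q hq hq'
    simp only [wirtZbar, Pi.add_apply, fderiv_add (hq.differentiableAt (by norm_num))
      (hq'.differentiableAt (by norm_num)), _root_.add_apply]
    ring
  simp only [wirtZ]
  rw [h1.fderiv_eq, fderiv_add (differentiableAt_wirtZbar hf) (differentiableAt_wirtZbar hg)]
  simp only [_root_.add_apply]
  ring

theorem wirt_smul {f : ℂ → ℂ} {z : ℂ} (c : ℂ) (hf : ContDiffAt ℝ 2 f z) :
    wirtZ (wirtZbar (c • f)) z = c * wirtZ (wirtZbar f) z := by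
  have h1 : wirtZbar (c • f) =ᶠ[𝓝 z] c • wirtZbar f := by
    filter_upwards [hf.eventually (by simp)] with q hq
    simp only [wirtZbar, Pi.smul_apply, fderiv_const_smul (hq.differentiableAt (by norm_num)),
      _root_.smul_apply, smul_eq_mul]
    ring
  simp only [wirtZ]
  rw [h1.fderiv_eq, fderiv_const_smul (differentiableAt_wirtZbar hf)]
  simp only [_root_.smul_apply, smul_eq_mul]
  ring

/-! ### The eigenspaces -/

/-- `X_lam(D)`: the space of all holomorphic functions `F` on the open set `D ⊆ Ω` such that
`Δ_{zw} F = lam F` on `D`. -/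
def eigenspace (lam : ℂ) (D : Set (Sphere × Sphere)) : Submodule ℂ (D → ℂ) where
  carrier := {F | IsHolo F ∧ IsLapEigen lam F}
  add_mem' := by
    rintro F G ⟨⟨a1, a2⟩, b1, b2⟩ ⟨⟨c1, c2⟩, d1, d2⟩
    refine ⟨⟨fun p hp => ?_, fun p hp => ?_⟩, fun p hp => ?_, fun p hp => ?_⟩ <;>
      rw [extendZero_add]
    · exact (a1 p hp).add (c1 p hp)
    · exact (a2 p hp).add (c2 p hp)
    · have := lapZW_add (a1 p hp) (c1 p hp)
      rw [b1 p hp, d1 p hp] at this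
      rw [Pi.add_apply, mul_add]
      exact this
    · have := lapZW_add (a2 p hp) (c2 p hp)
      rw [b2 p hp, d2 p hp] at this
      rw [Pi.add_apply, mul_add]
      exact this
  zero_mem' := by
    have h (s : ℂ × ℂ → Sphere × Sphere) : (0 : Sphere × Sphere → ℂ) ∘ s = fun _ => (0 : ℂ) := rfl
    have h0 (p : ℂ × ℂ) : lapZW (fun _ => (0 : ℂ)) p = 0 := by
      have h1 := lapZW_smul (f := fun _ : ℂ × ℂ => (0 : ℂ)) (p := p) 0 analyticAt_const
      rw [zero_smul, zero_mul] at h1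
      exact h1
    refine ⟨⟨fun p _ => ?_, fun p _ => ?_⟩, fun p _ => ?_, fun p _ => ?_⟩ <;>
      rw [extendZero_zero, h]
    · exact analyticAt_const
    · exact analyticAt_const
    · rw [Pi.zero_apply, mul_zero]
      exact h0 p
    · rw [Pi.zero_apply, mul_zero]
      exact h0 p
  smul_mem' := by
    rintro c F ⟨⟨a1, a2⟩, b1, b2⟩
    refine ⟨⟨fun p hp => ?_, fun p hp => ?_⟩, fun p hp => ?_, fun p hp => ?_⟩ <;>
      rw [extendZero_smul]
    · exact (a1 p hp).const_smul
    · exact (a2 p hp).const_smul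
    · have := lapZW_smul c (a1 p hp)
      rw [b1 p hp] at this
      rw [Pi.smul_apply, smul_eq_mul, mul_left_comm]
      exact this
    · have := lapZW_smul c (a2 p hp)
      rw [b2 p hp] at this
      rw [Pi.smul_apply, smul_eq_mul, mul_left_comm]
      exact this

/-- `X_lam(𝔻)`: the space of all `C²` functions `f` on the disk with `Δ_𝔻 f = lam f`. -/
def diskEigenspace (lam : ℂ) : Submodule ℂ (disk → ℂ) where
  carrier := {f | IsC2Disk f ∧ ∀ z ∈ disk, lapDisk (extendZero f) z = lam * extendZero f z}
  add_mem' := by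
    rintro f g ⟨a, b⟩ ⟨c, d⟩
    refine ⟨fun z hz => ?_, fun z hz => ?_⟩ <;> rw [extendZero_add]
    · exact (a z hz).add (c z hz)
    · have h1 := b z hz
      have h2 := d z hz
      simp only [lapDisk, Pi.add_apply, wirt_add (a z hz) (c z hz)] at h1 h2 ⊢
      rw [mul_add, h1, h2, mul_add]
  zero_mem' := by
    refine ⟨fun z _ => ?_, fun z _ => ?_⟩ <;> rw [extendZero_zero]
    · exact contDiffAt_const
    · have h := wirt_smul (f := (0 : ℂ → ℂ)) (z := z) 0 contDiffAt_const
      rw [zero_smul] at h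
      rw [Pi.zero_apply, mul_zero]
      exact mul_eq_zero_of_right _ (by rw [h, zero_mul])
  smul_mem' := by
    rintro c f ⟨a, b⟩
    refine ⟨fun z hz => ?_, fun z hz => ?_⟩ <;> rw [extendZero_smul]
    · exact (a z hz).const_smul c
    · have h1 := b z hz
      simp only [lapDisk, Pi.smul_apply, smul_eq_mul, wirt_smul c (a z hz)] at h1 ⊢
      rw [mul_left_comm, h1, mul_left_comm]

/-- The space of all `C²` functions `g` on the Riemann sphere such that `Δ g = lam g` for the
spherical Laplacian `Δ`, expressed in both charts. -/
def sphereEigenspace (lam : ℂ) : Submodule ℂ (Sphere → ℂ) where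
  carrier := {g | IsC2Sphere g ∧
    (∀ z : ℂ, lapSphere (fun u : ℂ => g (u : Sphere)) z = lam * g (z : Sphere)) ∧
    (∀ z : ℂ, lapSphere (fun u : ℂ => g (inftyMap u)) z = lam * g (inftyMap z))}
  add_mem' := by
    rintro f g ⟨⟨a, a'⟩, b, b'⟩ ⟨⟨c, c'⟩, d, d'⟩
    refine ⟨⟨a.add c, a'.add c'⟩, fun z => ?_, fun z => ?_⟩
    · have h := wirt_add (z := z) a.contDiffAt c.contDiffAt
      have h1 := b z
      have h2 := d z
      simp only [lapSphere] at h1 h2 ⊢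
      rw [Pi.add_apply, mul_add, ← h1, ← h2, ← mul_add, ← h]
      rfl
    · have h := wirt_add (z := z) a'.contDiffAt c'.contDiffAt
      have h1 := b' z
      have h2 := d' z
      simp only [lapSphere] at h1 h2 ⊢
      rw [Pi.add_apply, mul_add, ← h1, ← h2, ← mul_add, ← h]
      rfl
  zero_mem' := by
    have h (z : ℂ) := wirt_smul (f := (0 : ℂ → ℂ)) (z := z) 0 contDiffAt_const
    simp only [zero_smul, zero_mul] at h
    refine ⟨⟨contDiff_const, contDiff_const⟩, fun z => ?_, fun z => ?_⟩
    · rw [Pi.zero_apply, mul_zero]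
      exact mul_eq_zero_of_right _ (h z)
    · rw [Pi.zero_apply, mul_zero]
      exact mul_eq_zero_of_right _ (h z)
  smul_mem' := by
    rintro c g ⟨⟨a, a'⟩, b, b'⟩
    refine ⟨⟨contDiff_const.smul a, contDiff_const.smul a'⟩, fun z => ?_, fun z => ?_⟩
    · have h := wirt_smul (z := z) c a.contDiffAt
      have h1 := b z
      simp only [lapSphere] at h1 ⊢
      rw [Pi.smul_apply, smul_eq_mul, mul_left_comm, ← h1, mul_left_comm, ← h]
      rfl
    · have h := wirt_smul (z := z) c a'.contDiffAt
      have h1 := b' z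
      simp only [lapSphere] at h1 ⊢
      rw [Pi.smul_apply, smul_eq_mul, mul_left_comm, ← h1, mul_left_comm, ← h]
      rfl

/-! ### Restriction maps -/

theorem bidisk_subset_Omega : bidisk ⊆ Omega := by
  rintro _ ⟨⟨z, w⟩, ⟨hz, hw⟩, rfl⟩
  simp only [disk, Metric.mem_ball, dist_zero_right] at hz hw
  intro h
  have h1 : z * w = 1 := OnePoint.coe_injective h
  have h2 : ‖z‖ * ‖w‖ = 1 := by rw [← norm_mul, h1, norm_one]
  nlinarith [norm_nonneg z, norm_nonneg w]

/-- Restriction of functions from `Ω` to the bidisk. -/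
def restrictBidisk : (Omega → ℂ) →ₗ[ℂ] (bidisk → ℂ) :=
  LinearMap.funLeft ℂ ℂ (Set.inclusion bidisk_subset_Omega)

/-- The diagonal map `z ↦ (z, conj z)` from the disk to the bidisk. -/
def diag (z : disk) : bidisk :=
  ⟨stdMap ((z : ℂ), (starRingEnd ℂ) (z : ℂ)), ((z : ℂ), (starRingEnd ℂ) (z : ℂ)),
    ⟨z.2, by simpa [disk] using z.2⟩, rfl⟩

/-- The hyperbolic restriction map `R_h`, with `R_h(F)(z) = F(z, conj z)`. -/
def restrictHyp : (bidisk → ℂ) →ₗ[ℂ] (disk → ℂ) := LinearMap.funLeft ℂ ℂ diag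

theorem antidiag_mem (z : Sphere) : (z, sphereNegConj z) ∈ Omega := by
  induction z using OnePoint.rec with
  | infty => exact OnePoint.infty_ne_coe 1
  | coe z =>
    intro h
    have h1 : z * (-(starRingEnd ℂ) z) = 1 := OnePoint.coe_injective h
    have h2 := congrArg Complex.re h1
    simp at h2
    nlinarith [sq_nonneg z.re, sq_nonneg z.im]

/-- The rotated diagonal map `z ↦ (z, -conj z)` from the Riemann sphere to `Ω`. -/
def antidiag (z : Sphere) : Omega := ⟨(z, sphereNegConj z), antidiag_mem z⟩

/-- The spherical restriction map `F ↦ (z ↦ F(z, -conj z))`. -/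
def restrictSph : (Omega → ℂ) →ₗ[ℂ] (Sphere → ℂ) := LinearMap.funLeft ℂ ℂ antidiag

/-! ### Möbius invariant subspaces -/

/-- `φ` is a conformal automorphism (a holomorphic bijection) of the unit disk. -/
def IsDiskAut (φ : disk → disk) : Prop :=
  Function.Bijective φ ∧ DifferentiableOn ℂ (extendZero fun z => (φ z : ℂ)) disk

/-- `Y` is a Möbius invariant subspace of `C²(𝔻)`: it consists of `C²` functions, it is closed in
`C²(𝔻)` for locally uniform convergence (a metrizable topology, so that sequences suffice), and
`f ∘ φ ∈ Y` for all `f ∈ Y` and all conformal automorphisms `φ` of the disk. -/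
def IsMoebiusInvariant (Y : Submodule ℂ (disk → ℂ)) : Prop :=
  (∀ f ∈ Y, IsC2Disk f) ∧
  (∀ (u : ℕ → disk → ℂ) (f : disk → ℂ), (∀ n, u n ∈ Y) → IsC2Disk f →
    TendstoLocallyUniformly u f Filter.atTop → f ∈ Y) ∧
  (∀ f ∈ Y, ∀ φ : disk → disk, IsDiskAut φ → f ∘ φ ∈ Y)

/-- `Y` is a finite dimensional non-trivial Möbius invariant subspace of `X_lam(𝔻)`. -/
def IsFiniteMoebiusSubspace (lam : ℂ) (Y : Submodule ℂ (disk → ℂ)) : Prop :=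
  Y ≤ diskEigenspace lam ∧ IsMoebiusInvariant Y ∧ Y ≠ ⊥ ∧ Y ≠ diskEigenspace lam ∧
    FiniteDimensional ℂ Y

end InvLaplace

end

/-!
The theorem compares the functions on `Ω` with their restrictions to the two totally real surfaces
`w = conj z` (the disk) and `w = -conj z` (the sphere). A holomorphic function is determined by its
values on either surface, and `Δ_{zw}` restricts to the hyperbolic and to the spherical Laplacian.

**Existence.** The function `q(z, w) = (s - t z) (t - s w) / (1 - z w)` is holomorphic on `Ω`, and
its powers `q ^ m` satisfy `Δ_{zw} (q ^ m) = 4 m (m + 1) q ^ m` (`kernel_mem`). Already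
`2 m + 1` of these kernels, with different parameters, are linearly independent
(`linearIndependent_kernel`).

**Spherical upper bound.** Green's formula on the sphere makes the spherical Laplacian symmetric for
the integral of `g h (1 + |z|²)⁻²` over `ℂ` (`spherePairing_lapSphere`). It acts on the test
functions `z ^ a (conj z) ^ b / (1 + |z|²) ^ n` in a triangular way, which gives a recursion for the
pairings of an eigenfunction `g` with the test functions. By Stone–Weierstrass `g = 0` as soon as all these
pairings vanish. So `g ≠ 0` forces `lam = 4 m (m + 1)`, and in that case the `2 m + 1` pairings with
the extremal test functions of degree `m` determine `g` (`IsSphereEigen.eq_zero_of_extremalTest`).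
Consequently the kernels span `X_lam(Ω)`, and restriction identifies `X_lam(Ω)` with the spherical
eigenspace. As `Ω` is connected, a function with a holomorphic extension to `Ω` has `Ω` as its only
maximal domain of existence (`isMaximalDomain_iff`).

**Invariance on the disk.** Conformal automorphisms of the disk are Möbius transformations by the
Schwarz lemma, and these permute the kernels up to constants (`diskKernel_comp_moebius`). So the
restriction of `X_lam(Ω)` to the disk is a finite dimensional invariant subspace. It is not all of
`X_lam(𝔻)`, because `q ^ (-(m + 1))` with `s = t = 1` satisfies the same equation and grows too
fast at `z = 1` (`hypSpace_ne`).

**Uniqueness on the disk.** A finite dimensional invariant subspace `Y` is closed under the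
infinitesimal automorphisms. The generator of the rotations is diagonalizable on `Y` with integer
eigenvalues, the weights, because the rotation group is a circle. The operators
`∂_{conj z} - z² ∂_z` and `∂_z - (conj z)² ∂_{conj z}` raise and lower the weight by one. A first
order radial equation shows that the weight functions annihilated by the former are the multiples of
`(z / (1 - |z|²)) ^ m`, of weight `m`, and that those annihilated by the latter have weight `-m`.
Hence all weights lie in `[-m, m]` and have multiplicity at most one, so that `dim Y ≤ 2 m + 1`, and
`Y` contains the highest weight function if `Y ≠ 0`. The Möbius images of that function are kernels that span the restriction of `X_lam(Ω)`,
which has dimension `2 m + 1` (`eq_hypSpace_of_isFiniteMoebiusSubspace`).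
-/

namespace InvLaplace

/-! ### The geometry of `Ω` -/

@[simp] theorem sphereInv_infty : sphereInv OnePoint.infty = ((0 : ℂ) : Sphere) := rfl

theorem sphereInv_coe (z : ℂ) :
    sphereInv (z : Sphere) = if z = 0 then OnePoint.infty else ((z⁻¹ : ℂ) : Sphere) := rfl

theorem sphereInv_zero : sphereInv ((0 : ℂ) : Sphere) = OnePoint.infty := by
  simp [sphereInv_coe]

theorem sphereInv_coe_of_ne {z : ℂ} (hz : z ≠ 0) :
    sphereInv (z : Sphere) = ((z⁻¹ : ℂ) : Sphere) := by simp [sphereInv_coe, hz]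

theorem sphereInv_involutive : Function.Involutive sphereInv := by
  intro z
  induction z using OnePoint.rec with
  | infty => simp [sphereInv_zero]
  | coe z =>
    by_cases hz : z = 0
    · simp [hz, sphereInv_zero]
    · rw [sphereInv_coe_of_ne hz, sphereInv_coe_of_ne (inv_ne_zero hz), inv_inv]

theorem tendsto_coe_infty : Filter.Tendsto (fun z : ℂ => (z : Sphere)) (Bornology.cobounded ℂ)
    (𝓝 OnePoint.infty) := by
  rw [Metric.cobounded_eq_cocompact]
  have := OnePoint.tendsto_coe_infty (X := ℂ)
  rwa [Filter.coclosedCompact_eq_cocompact] at this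

theorem continuousAt_infty_iff {X : Type*} [TopologicalSpace X] {f : Sphere → X} :
    ContinuousAt f OnePoint.infty ↔
      Filter.Tendsto (fun z : ℂ => f z) (Bornology.cobounded ℂ) (𝓝 (f OnePoint.infty)) := by
  rw [OnePoint.continuousAt_infty', Filter.coclosedCompact_eq_cocompact,
    Metric.cobounded_eq_cocompact]
  rfl

theorem continuous_sphereInv : Continuous sphereInv := by
  rw [continuous_iff_continuousAt]
  intro z
  induction z using OnePoint.rec with
  | infty =>
    rw [continuousAt_infty_iff]
    have h1 : Filter.Tendsto (fun z : ℂ => ((z⁻¹ : ℂ) : Sphere)) (Bornology.cobounded ℂ)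
        (𝓝 ((0 : ℂ) : Sphere)) :=
      (OnePoint.continuous_coe.tendsto 0).comp Filter.tendsto_inv₀_cobounded
    refine h1.congr' ?_
    have : ∀ᶠ z : ℂ in Bornology.cobounded ℂ, z ≠ 0 := Bornology.eventually_ne_cobounded 0
    filter_upwards [this] with z hz using (sphereInv_coe_of_ne hz).symm
  | coe z =>
    rw [OnePoint.continuousAt_coe]
    by_cases hz : z = 0
    · subst hz
      rw [continuousAt_iff_punctured_nhds]
      have h1 : Filter.Tendsto (fun z : ℂ => ((z⁻¹ : ℂ) : Sphere)) (𝓝[≠] 0)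
          (𝓝 OnePoint.infty) :=
        tendsto_coe_infty.comp Filter.tendsto_inv₀_nhdsNE_zero
      simp only [Function.comp_apply, sphereInv_zero]
      refine h1.congr' ?_
      filter_upwards [self_mem_nhdsWithin] with z hz using (sphereInv_coe_of_ne hz).symm
    · have h1 : ContinuousAt (fun z : ℂ => ((z⁻¹ : ℂ) : Sphere)) z :=
        OnePoint.continuous_coe.continuousAt.comp (continuousAt_inv₀ hz)
      refine h1.congr ?_
      filter_upwards [isOpen_ne.mem_nhds hz] with z hz using (sphereInv_coe_of_ne hz).symm

/-- The inversion as a homeomorphism of the Riemann sphere. -/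
noncomputable def sphereInvHomeo : Sphere ≃ₜ Sphere where
  toEquiv := sphereInv_involutive.toPerm
  continuous_toFun := continuous_sphereInv
  continuous_invFun := continuous_sphereInv

theorem isOpenEmbedding_stdMap : Topology.IsOpenEmbedding stdMap :=
  OnePoint.isOpenEmbedding_coe.prodMap OnePoint.isOpenEmbedding_coe

theorem isOpenEmbedding_flipMap : Topology.IsOpenEmbedding flipMap :=
  ((Homeomorph.prodComm Sphere Sphere).trans
    (sphereInvHomeo.prodCongr sphereInvHomeo)).isOpenEmbedding.comp isOpenEmbedding_stdMap

/-- The trace of `Ω` in either of the two charts. -/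
def chartDomain : Set (ℂ × ℂ) := {p | p.1 * p.2 ≠ 1}

theorem mem_chartDomain {p : ℂ × ℂ} : p ∈ chartDomain ↔ p.1 * p.2 ≠ 1 := Iff.rfl

theorem stdMap_mem_Omega {p : ℂ × ℂ} : stdMap p ∈ Omega ↔ p ∈ chartDomain := by
  change (((p.1 * p.2 : ℂ) : Sphere) ≠ ((1 : ℂ) : Sphere)) ↔ _
  rw [Ne, OnePoint.coe_eq_coe]
  rfl

theorem flipMap_of_ne {p : ℂ × ℂ} (h1 : p.1 ≠ 0) (h2 : p.2 ≠ 0) :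
    flipMap p = stdMap (p.2⁻¹, p.1⁻¹) := by
  simp [flipMap, stdMap, sphereInv_coe_of_ne, h1, h2]

theorem flipMap_mem_Omega {p : ℂ × ℂ} : flipMap p ∈ Omega ↔ p ∈ chartDomain := by
  obtain ⟨u, v⟩ := p
  by_cases hu : u = 0
  · subst hu
    by_cases hv : v = 0
    · subst hv
      simp only [flipMap, sphereInv_zero, mem_chartDomain, mul_zero, ne_eq, zero_ne_one,
        not_false_eq_true, iff_true]
      exact OnePoint.infty_ne_coe 1
    · simp only [flipMap, sphereInv_zero, mem_chartDomain, zero_mul, ne_eq, zero_ne_one,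
        not_false_eq_true, iff_true, sphereInv_coe_of_ne hv]
      change (if v⁻¹ = 0 then ((1 : ℂ) : Sphere) else OnePoint.infty) ≠ _
      rw [if_neg (inv_ne_zero hv)]
      exact OnePoint.infty_ne_coe 1
  · by_cases hv : v = 0
    · subst hv
      simp only [flipMap, sphereInv_zero, mem_chartDomain, mul_zero, ne_eq, zero_ne_one,
        not_false_eq_true, iff_true, sphereInv_coe_of_ne hu]
      change (if u⁻¹ = 0 then ((1 : ℂ) : Sphere) else OnePoint.infty) ≠ _
      rw [if_neg (inv_ne_zero hu)]
      exact OnePoint.infty_ne_coe 1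
    · rw [flipMap_of_ne hu hv, stdMap_mem_Omega, mem_chartDomain, mem_chartDomain]
      simp only
      rw [← mul_inv, Ne, inv_eq_one, mul_comm]

theorem Omega_eq : Omega = stdMap '' chartDomain ∪ flipMap '' chartDomain := by
  ext ⟨z, w⟩
  constructor
  · intro h
    induction z using OnePoint.rec with
    | infty =>
      right
      induction w using OnePoint.rec with
      | infty => exact ⟨(0, 0), by simp [mem_chartDomain], by simp [flipMap, sphereInv_zero]⟩
      | coe w =>
        have hw : w ≠ 0 := by
          rintro rfl
          apply h
          change (if (0 : ℂ) = 0 then ((1 : ℂ) : Sphere) else OnePoint.infty) = _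
          rw [if_pos rfl]
        exact ⟨(w⁻¹, 0), by simp [mem_chartDomain],
          by simp [flipMap, sphereInv_zero, sphereInv_coe_of_ne, hw]⟩
    | coe z =>
      induction w using OnePoint.rec with
      | infty =>
        right
        have hz : z ≠ 0 := by
          rintro rfl
          apply h
          change (if (0 : ℂ) = 0 then ((1 : ℂ) : Sphere) else OnePoint.infty) = _
          rw [if_pos rfl]
        exact ⟨(0, z⁻¹), by simp [mem_chartDomain],
          by simp [flipMap, sphereInv_zero, sphereInv_coe_of_ne, hz]⟩
      | coe w => exact Or.inl ⟨(z, w), stdMap_mem_Omega.1 h, rfl⟩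
  · rintro (⟨p, hp, h⟩ | ⟨p, hp, h⟩) <;> rw [← h]
    · exact stdMap_mem_Omega.2 hp
    · exact flipMap_mem_Omega.2 hp

theorem isOpen_chartDomain : IsOpen chartDomain :=
  isOpen_ne_fun (continuous_fst.mul continuous_snd) continuous_const

theorem isConnected_mul_ne_one (w : ℂ) : IsConnected {z : ℂ | z * w ≠ 1} := by
  by_cases hw : w = 0
  · simp [hw, isConnected_univ]
  · have : {z : ℂ | z * w ≠ 1} = {w⁻¹}ᶜ := by
      ext z
      simp [mul_eq_one_iff_eq_inv₀ hw]
    rw [this]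
    exact isConnected_compl_singleton_of_one_lt_rank (by simp) _

theorem isConnected_chartDomain : IsConnected chartDomain := by
  refine ⟨⟨(0, 0), by simp [mem_chartDomain]⟩, ?_⟩
  refine isPreconnected_of_forall (0, 0) fun p hp => ?_
  refine ⟨(fun z => (z, p.2)) '' {z : ℂ | z * p.2 ≠ 1} ∪ (fun w => ((0 : ℂ), w)) '' Set.univ,
    ?_, ?_, ?_, ?_⟩
  · rintro _ (⟨z, hz, rfl⟩ | ⟨w, -, rfl⟩)
    · exact hz
    · simp [mem_chartDomain]
  · exact Or.inr ⟨0, trivial, rfl⟩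
  · exact Or.inl ⟨p.1, hp, rfl⟩
  · refine IsPreconnected.union ((0 : ℂ), p.2) ⟨0, by simp, rfl⟩ ⟨p.2, trivial, rfl⟩ ?_ ?_
    · exact (isConnected_mul_ne_one p.2).isPreconnected.image _ (by fun_prop)
    · exact isPreconnected_univ.image _ (by fun_prop)

theorem isSubdomain_Omega : IsSubdomain Omega := by
  rw [Omega_eq]
  refine ⟨(isOpenEmbedding_stdMap.isOpenMap _ isOpen_chartDomain).union
    (isOpenEmbedding_flipMap.isOpenMap _ isOpen_chartDomain), ?_⟩
  refine IsConnected.union ⟨stdMap (2, 2), ⟨(2, 2), by norm_num [mem_chartDomain], rfl⟩,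
    ⟨(2⁻¹, 2⁻¹), by norm_num [mem_chartDomain], ?_⟩⟩
    (isConnected_chartDomain.image _ isOpenEmbedding_stdMap.continuous.continuousOn)
    (isConnected_chartDomain.image _ isOpenEmbedding_flipMap.continuous.continuousOn)
  rw [flipMap_of_ne (by norm_num) (by norm_num)]
  simp

/-- The bidisk in the standard chart. -/
theorem stdMap_mem_bidisk {p : ℂ × ℂ} : stdMap p ∈ bidisk ↔ p ∈ disk ×ˢ disk :=
  isOpenEmbedding_stdMap.injective.mem_set_image

theorem isOpen_disk : IsOpen disk := Metric.isOpen_ball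

theorem mem_disk {z : ℂ} : z ∈ disk ↔ ‖z‖ < 1 := by simp [disk]

theorem zero_mem_disk : (0 : ℂ) ∈ disk := by simp [disk]

theorem conj_mem_disk {z : ℂ} (hz : z ∈ disk) : (starRingEnd ℂ) z ∈ disk := by
  simpa [disk] using hz

theorem extendZero_of_mem {α : Type} {D : Set α} (F : D → ℂ) {x : α} (hx : x ∈ D) :
    extendZero F x = F ⟨x, hx⟩ := extendZero_apply F ⟨x, hx⟩

theorem isPreconnected_bidisk_chart : IsPreconnected (disk ×ˢ disk) :=
  (convex_ball (0 : ℂ) 1).isPreconnected.prod (convex_ball (0 : ℂ) 1).isPreconnected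

/-- Since all domains lie in `Ω`, which is itself a domain, `Ω` is a maximal domain of existence
as soon as the function extends to `Ω`, and then it is the only one. -/
theorem isMaximalDomain_iff {F : bidisk → ℂ} (hF : HasHoloExtension F Omega)
    (D : Set (Sphere × Sphere)) : IsMaximalDomainOfExistence F D ↔ D = Omega := by
  constructor
  · rintro ⟨-, -, hD, -, hmax⟩
    by_contra hne
    exact hmax Omega isSubdomain_Omega subset_rfl (hD.ssubset_of_ne hne) hF
  · rintro rfl
    exact ⟨isSubdomain_Omega, bidisk_subset_Omega, subset_rfl, hF,
      fun D' _ h h' => absurd (h'.trans_subset h) (ssubset_irrefl _)⟩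

/-! ### Totally real slices -/

/-- The real linear parametrization `z ↦ (z, ε conj z)` of a slice of `ℂ²`. -/
noncomputable def slice (ε : ℂ) : ℂ →L[ℝ] ℂ × ℂ :=
  (ContinuousLinearMap.id ℝ ℂ).prod (ε • (Complex.conjCLE : ℂ →L[ℝ] ℂ))

@[simp] theorem slice_apply (ε z : ℂ) : slice ε z = (z, ε * (starRingEnd ℂ) z) := rfl

theorem hasFDerivAt_comp_slice {k : ℂ × ℂ → ℂ} {ε z : ℂ} (hk : DifferentiableAt ℂ k (slice ε z)) :
    HasFDerivAt (fun u => k (slice ε u))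
      (((fderiv ℂ k (slice ε z)).restrictScalars ℝ).comp (slice ε)) z :=
  (hk.hasFDerivAt.restrictScalars ℝ).comp z (slice ε).hasFDerivAt

theorem fderiv_comp_slice {k : ℂ × ℂ → ℂ} {ε z : ℂ} (hk : DifferentiableAt ℂ k (slice ε z))
    (v : ℂ) : fderiv ℝ (fun u => k (slice ε u)) z v =
      v * partialZ k (slice ε z) + ε * (starRingEnd ℂ) v * partialW k (slice ε z) := by
  rw [(hasFDerivAt_comp_slice hk).fderiv]
  have h : slice ε v = v • ((1 : ℂ), (0 : ℂ)) + (ε * (starRingEnd ℂ) v) • ((0 : ℂ), (1 : ℂ)) := by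
    simp
  simp only [ContinuousLinearMap.comp_apply, ContinuousLinearMap.coe_restrictScalars']
  rw [h, map_add, map_smul, map_smul]
  rfl

theorem wirtZ_comp_slice {k : ℂ × ℂ → ℂ} {ε z : ℂ} (hk : DifferentiableAt ℂ k (slice ε z)) :
    wirtZ (fun u => k (slice ε u)) z = partialZ k (slice ε z) := by
  simp only [wirtZ, fderiv_comp_slice hk, map_one, Complex.conj_I]
  linear_combination (-(partialZ k (slice ε z)) / 2 + ε * partialW k (slice ε z) / 2) *
    Complex.I_mul_I

theorem wirtZbar_comp_slice {k : ℂ × ℂ → ℂ} {ε z : ℂ} (hk : DifferentiableAt ℂ k (slice ε z)) :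
    wirtZbar (fun u => k (slice ε u)) z = ε * partialW k (slice ε z) := by
  simp only [wirtZbar, fderiv_comp_slice hk, map_one, Complex.conj_I]
  linear_combination ((partialZ k (slice ε z)) / 2 - ε * partialW k (slice ε z) / 2) *
    Complex.I_mul_I

theorem differentiableAt_partialW {f : ℂ × ℂ → ℂ} {p : ℂ × ℂ} (hf : AnalyticAt ℂ f p) :
    DifferentiableAt ℂ (partialW f) p :=
  hf.fderiv.differentiableAt.clm_apply (differentiableAt_const _)

theorem wirtZ_congr {f g : ℂ → ℂ} {z : ℂ} (h : f =ᶠ[𝓝 z] g) : wirtZ f z = wirtZ g z := by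
  simp only [wirtZ, h.fderiv_eq]

theorem wirtZbar_congr {f g : ℂ → ℂ} {z : ℂ} (h : f =ᶠ[𝓝 z] g) :
    wirtZbar f z = wirtZbar g z := by
  simp only [wirtZbar, h.fderiv_eq]

theorem wirt_congr {f g : ℂ → ℂ} {z : ℂ} (h : f =ᶠ[𝓝 z] g) :
    wirtZ (wirtZbar f) z = wirtZ (wirtZbar g) z :=
  wirtZ_congr (h.eventuallyEq_nhds.mono fun _ hu => wirtZbar_congr hu)

theorem lapDisk_congr {f g : ℂ → ℂ} {z : ℂ} (h : f =ᶠ[𝓝 z] g) : lapDisk f z = lapDisk g z := by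
  simp only [lapDisk, wirt_congr h]

theorem partialW_congr {f g : ℂ × ℂ → ℂ} {p : ℂ × ℂ} (h : f =ᶠ[𝓝 p] g) :
    partialW f p = partialW g p := by
  simp only [partialW, h.fderiv_eq]

theorem partialZ_congr {f g : ℂ × ℂ → ℂ} {p : ℂ × ℂ} (h : f =ᶠ[𝓝 p] g) :
    partialZ f p = partialZ g p := by
  simp only [partialZ, h.fderiv_eq]

theorem lapZW_congr {f g : ℂ × ℂ → ℂ} {p : ℂ × ℂ} (h : f =ᶠ[𝓝 p] g) : lapZW f p = lapZW g p := by
  simp only [lapZW]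
  rw [partialZ_congr (h.eventuallyEq_nhds.mono fun _ hu => partialW_congr hu)]

theorem wirt_comp_slice {f : ℂ × ℂ → ℂ} {ε z : ℂ} (hf : AnalyticAt ℂ f (slice ε z)) :
    wirtZ (wirtZbar fun u => f (slice ε u)) z = ε * partialZ (partialW f) (slice ε z) := by
  have h1 : wirtZbar (fun u => f (slice ε u)) =ᶠ[𝓝 z]
      fun u => (fun p => ε * partialW f p) (slice ε u) := by
    have := (slice ε).continuous.continuousAt.eventually hf.eventually_analyticAt
    filter_upwards [this] with u hu
    exact wirtZbar_comp_slice hu.differentiableAt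
  rw [wirtZ_congr h1, wirtZ_comp_slice ((differentiableAt_partialW hf).const_mul ε)]
  simp only [partialZ]
  rw [fderiv_const_mul (differentiableAt_partialW hf)]
  rfl

theorem ofReal_norm_sq (z : ℂ) : (‖z‖ : ℂ) ^ 2 = z * (starRingEnd ℂ) z :=
  (Complex.mul_conj' z).symm

theorem lapDisk_comp_slice {f : ℂ × ℂ → ℂ} {z : ℂ} (hf : AnalyticAt ℂ f (slice 1 z)) :
    lapDisk (fun u => f (slice 1 u)) z = lapZW f (slice 1 z) := by
  simp only [lapDisk, lapZW]
  rw [wirt_comp_slice hf, ofReal_norm_sq, slice_apply, one_mul, one_mul]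

theorem lapSphere_comp_slice {f : ℂ × ℂ → ℂ} {z : ℂ} (hf : AnalyticAt ℂ f (slice (-1) z)) :
    lapSphere (fun u => f (slice (-1) u)) z = lapZW f (slice (-1) z) := by
  simp only [lapSphere, lapZW]
  rw [wirt_comp_slice hf, ofReal_norm_sq, slice_apply]
  ring

theorem contDiffAt_comp_slice {f : ℂ × ℂ → ℂ} {ε z : ℂ} (hf : AnalyticAt ℂ f (slice ε z)) :
    ContDiffAt ℝ 2 (fun u => f (slice ε u)) z :=
  (hf.contDiffAt.restrict_scalars ℝ).comp z (slice ε).contDiff.contDiffAt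

theorem analyticOnNhd_eq_zero_of_real {g : ℂ → ℂ} {r : ℝ} (hr : 0 < r)
    (hg : AnalyticOnNhd ℂ g (Metric.ball 0 r)) (h : ∀ x : ℝ, |x| < r → g x = 0) :
    ∀ z ∈ Metric.ball (0 : ℂ) r, g z = 0 := by
  refine hg.eqOn_zero_of_preconnected_of_frequently_eq_zero (convex_ball _ _).isPreconnected
    (Metric.mem_ball_self hr) ?_
  have h1 : Filter.Tendsto (fun x : ℝ => (x : ℂ)) (𝓝[≠] 0) (𝓝[≠] 0) := by
    refine tendsto_nhdsWithin_iff.2 ⟨?_, ?_⟩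
    · exact (Complex.continuous_ofReal.tendsto' 0 0 (by simp)).mono_left nhdsWithin_le_nhds
    · filter_upwards [self_mem_nhdsWithin] with x hx
      simpa using hx
  refine h1.frequently (Filter.Eventually.frequently ?_)
  filter_upwards [mem_nhdsWithin_of_mem_nhds (Metric.ball_mem_nhds (0 : ℝ) hr)] with x hx
  exact h x (by simpa using hx)

/-- A slice `{(z, ε conj z)}` with `ε ≠ 0` is maximally totally real, so that holomorphic functions
are determined by their values on it: in the coordinates `x`, `y` with `z = x + i y` and
`w = ε (x - i y)`, the slice is `ℝ²`. -/
theorem eventually_eq_zero_of_slice {f : ℂ × ℂ → ℂ} {ε : ℂ} (hε : ε ≠ 0)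
    (hf : AnalyticAt ℂ f 0) (h : ∀ᶠ z : ℂ in 𝓝 0, f (slice ε z) = 0) : ∀ᶠ p in 𝓝 0, f p = 0 := by
  let L : ℂ × ℂ →L[ℂ] ℂ × ℂ :=
    (ContinuousLinearMap.fst ℂ ℂ ℂ + Complex.I • ContinuousLinearMap.snd ℂ ℂ ℂ).prod
      (ε • (ContinuousLinearMap.fst ℂ ℂ ℂ - Complex.I • ContinuousLinearMap.snd ℂ ℂ ℂ))
  have hL (p : ℂ × ℂ) : L p = (p.1 + Complex.I * p.2, ε * (p.1 - Complex.I * p.2)) := rfl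
  have hL0 : L 0 = 0 := map_zero L
  have hg : ∀ᶠ p in 𝓝 0, AnalyticAt ℂ (fun p => f (L p)) p := by
    have : AnalyticAt ℂ (fun p => f (L p)) 0 :=
      AnalyticAt.comp (by rwa [hL0]) (L.analyticAt 0)
    exact this.eventually_analyticAt
  have hz : ∀ᶠ p : ℝ × ℝ in 𝓝 0, f (L (p.1, p.2)) = 0 := by
    have hc : Filter.Tendsto (fun p : ℝ × ℝ => (p.1 + Complex.I * p.2 : ℂ)) (𝓝 0) (𝓝 0) :=
      Continuous.tendsto' (by fun_prop) _ _ (by simp)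
    filter_upwards [hc.eventually h] with p hp
    rw [hL]
    rw [slice_apply] at hp
    simp only [map_add, Complex.conj_ofReal, map_mul, Complex.conj_I] at hp
    rw [← hp]
    ring_nf
  obtain ⟨r1, hr1, h1⟩ := Metric.eventually_nhds_iff_ball.1 hg
  obtain ⟨r2, hr2, h2⟩ := Metric.eventually_nhds_iff_ball.1 hz
  obtain ⟨r, hr, hrr1, hrr2⟩ : ∃ r > 0, r ≤ r1 ∧ r ≤ r2 := ⟨min r1 r2, by positivity, by simp⟩
  have hmem {x y : ℂ} (hx : ‖x‖ < r) (hy : ‖y‖ < r) : (x, y) ∈ Metric.ball (0 : ℂ × ℂ) r1 := by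
    rw [mem_ball_zero_iff, Prod.norm_def]
    exact (max_lt hx hy).trans_le hrr1
  have step1 (x : ℝ) (hx : |x| < r) : ∀ y ∈ Metric.ball (0 : ℂ) r, f (L (x, y)) = 0 := by
    refine analyticOnNhd_eq_zero_of_real (g := fun y => f (L (x, y))) hr (fun y hy => ?_)
      fun y hy => ?_
    · exact (h1 (x, y) (hmem (by simpa using hx) (by simpa using hy))).comp
        (f := fun y : ℂ => ((x : ℂ), y)) (by fun_prop)
    · refine h2 (x, y) ?_
      rw [mem_ball_zero_iff, Prod.norm_def]
      exact (max_lt hx hy).trans_le hrr2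
  have step2 (y : ℂ) (hy : ‖y‖ < r) : ∀ x ∈ Metric.ball (0 : ℂ) r, f (L (x, y)) = 0 := by
    refine analyticOnNhd_eq_zero_of_real (g := fun x => f (L (x, y))) hr (fun x hx => ?_)
      fun x hx => step1 x hx y (by simpa using hy)
    exact (h1 (x, y) (hmem (by simpa using hx) hy)).comp
        (f := fun x : ℂ => (x, y)) (by fun_prop)
  -- the inverse of the linear substitution `L`
  have hinv : Filter.Tendsto (fun p : ℂ × ℂ =>
      ((p.1 + p.2 / ε) / 2, (p.1 - p.2 / ε) / (2 * Complex.I))) (𝓝 0) (𝓝 0) :=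
    Continuous.tendsto' (by fun_prop) _ _ (by simp)
  filter_upwards [hinv.eventually (Metric.ball_mem_nhds 0 hr)] with p hp
  rw [dist_zero_right, Prod.norm_def, max_lt_iff] at hp
  have := step2 _ hp.2 _ (mem_ball_zero_iff.2 hp.1)
  rw [hL] at this
  convert this using 2
  refine Prod.ext ?_ ?_ <;> field_simp [Complex.I_ne_zero] <;> ring

/-- Identity theorem on the slice, for functions on a connected open neighbourhood of `0`. -/
theorem eqOn_of_slice {f g : ℂ × ℂ → ℂ} {U : Set (ℂ × ℂ)} {ε : ℂ} (hε : ε ≠ 0)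
    (hU : IsPreconnected U) (h0 : 0 ∈ U)
    (hf : AnalyticOnNhd ℂ f U) (hg : AnalyticOnNhd ℂ g U)
    (h : ∀ᶠ z : ℂ in 𝓝 0, f (slice ε z) = g (slice ε z)) : Set.EqOn f g U := by
  refine hf.eqOn_of_preconnected_of_eventuallyEq hg hU h0 ?_
  have := eventually_eq_zero_of_slice hε ((hf 0 h0).sub (hg 0 h0))
    (h.mono fun z hz => by simpa [sub_eq_zero] using hz)
  exact this.mono fun p hp => sub_eq_zero.1 hp

/-! ### Restriction of eigenfunctions -/

theorem eventuallyEq_extendZero_stdMap {D : Set (Sphere × Sphere)} (hD : IsOpen D) {F : D → ℂ}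
    {f : Sphere × Sphere → ℂ} (h : ∀ x : D, F x = f x) {p : ℂ × ℂ} (hp : stdMap p ∈ D) :
    extendZero F ∘ stdMap =ᶠ[𝓝 p] f ∘ stdMap := by
  filter_upwards [isOpenEmbedding_stdMap.continuous.continuousAt.preimage_mem_nhds
    (hD.mem_nhds hp)] with q hq
  rw [Function.comp_apply, extendZero_of_mem F hq, h, Function.comp_apply]

theorem eventuallyEq_extendZero_flipMap {D : Set (Sphere × Sphere)} (hD : IsOpen D) {F : D → ℂ}
    {f : Sphere × Sphere → ℂ} (h : ∀ x : D, F x = f x) {p : ℂ × ℂ} (hp : flipMap p ∈ D) :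
    extendZero F ∘ flipMap =ᶠ[𝓝 p] f ∘ flipMap := by
  filter_upwards [isOpenEmbedding_flipMap.continuous.continuousAt.preimage_mem_nhds
    (hD.mem_nhds hp)] with q hq
  rw [Function.comp_apply, extendZero_of_mem F hq, h, Function.comp_apply]

theorem isOpen_bidisk : IsOpen bidisk :=
  isOpenEmbedding_stdMap.isOpenMap _ (isOpen_disk.prod isOpen_disk)

theorem restrictBidisk_mem {lam : ℂ} {F : Omega → ℂ} (hF : F ∈ eigenspace lam Omega) :
    restrictBidisk F ∈ eigenspace lam bidisk := by
  obtain ⟨⟨a1, a2⟩, b1, b2⟩ := hF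
  have h (x : bidisk) : restrictBidisk F x = extendZero F x :=
    (extendZero_of_mem F (bidisk_subset_Omega x.2)).symm
  refine ⟨⟨fun p hp => ?_, fun p hp => ?_⟩, fun p hp => ?_, fun p hp => ?_⟩
  · exact (a1 p (bidisk_subset_Omega hp)).congr
      (eventuallyEq_extendZero_stdMap isOpen_bidisk h hp).symm
  · exact (a2 p (bidisk_subset_Omega hp)).congr
      (eventuallyEq_extendZero_flipMap isOpen_bidisk h hp).symm
  · rw [lapZW_congr (eventuallyEq_extendZero_stdMap isOpen_bidisk h hp),
      b1 p (bidisk_subset_Omega hp), extendZero_of_mem (restrictBidisk F) hp, h]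
  · rw [lapZW_congr (eventuallyEq_extendZero_flipMap isOpen_bidisk h hp),
      b2 p (bidisk_subset_Omega hp), extendZero_of_mem (restrictBidisk F) hp, h]

theorem slice_one_mem {z : ℂ} (hz : z ∈ disk) : slice 1 z ∈ disk ×ˢ disk :=
  ⟨hz, by simpa using conj_mem_disk hz⟩

theorem extendZero_restrictHyp (F : bidisk → ℂ) {z : ℂ} (hz : z ∈ disk) :
    extendZero (restrictHyp F) z = extendZero F (stdMap (slice 1 z)) := by
  rw [extendZero_of_mem _ hz, extendZero_of_mem F (stdMap_mem_bidisk.2 (slice_one_mem hz))]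
  simp only [slice_apply, one_mul]
  rfl

theorem extendZero_restrictHyp_eventuallyEq (F : bidisk → ℂ) {z : ℂ} (hz : z ∈ disk) :
    extendZero (restrictHyp F) =ᶠ[𝓝 z] fun u => (extendZero F ∘ stdMap) (slice 1 u) := by
  filter_upwards [isOpen_disk.mem_nhds hz] with u hu using extendZero_restrictHyp F hu

theorem restrictHyp_mem {lam : ℂ} {F : bidisk → ℂ} (hF : F ∈ eigenspace lam bidisk) :
    restrictHyp F ∈ diskEigenspace lam := by
  obtain ⟨⟨a1, -⟩, b1, -⟩ := hF
  refine ⟨fun z hz => ?_, fun z hz => ?_⟩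
  · exact (contDiffAt_comp_slice (a1 _ (stdMap_mem_bidisk.2
      (slice_one_mem hz)))).congr_of_eventuallyEq
      (extendZero_restrictHyp_eventuallyEq F hz)
  · rw [lapDisk_congr (extendZero_restrictHyp_eventuallyEq F hz),
      lapDisk_comp_slice (a1 _ (stdMap_mem_bidisk.2 (slice_one_mem hz))),
      b1 _ (stdMap_mem_bidisk.2 (slice_one_mem hz)), extendZero_restrictHyp F hz]

theorem slice_neg_one_mem (z : ℂ) : slice (-1) z ∈ chartDomain :=
  stdMap_mem_Omega.1 (by
    simp only [slice_apply, neg_one_mul]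
    exact antidiag_mem (z : Sphere))

theorem sphereNegConj_sphereInv (z : ℂ) :
    sphereNegConj (sphereInv (z : Sphere)) = sphereInv ((-(starRingEnd ℂ) z : ℂ) : Sphere) := by
  by_cases hz : z = 0
  · simp only [hz, sphereInv_zero, map_zero, neg_zero]
    rfl
  · rw [sphereInv_coe_of_ne hz, sphereInv_coe_of_ne (by simpa using hz)]
    change (((-(starRingEnd ℂ) z⁻¹ : ℂ)) : Sphere) = _
    rw [map_inv₀, inv_neg]

theorem restrictSph_coe (F : Omega → ℂ) (z : ℂ) :
    restrictSph F (z : Sphere) = extendZero F (stdMap (slice (-1) z)) := by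
  rw [extendZero_of_mem F (stdMap_mem_Omega.2 (slice_neg_one_mem z))]
  simp only [slice_apply, neg_one_mul]
  rfl

theorem restrictSph_inftyMap (F : Omega → ℂ) (z : ℂ) :
    restrictSph F (inftyMap z) = extendZero F (flipMap (slice (-1) z).swap) := by
  have h : (flipMap (slice (-1) z).swap) = (antidiag (inftyMap z) : Sphere × Sphere) := by
    simp only [slice_apply, neg_one_mul, antidiag, inftyMap, sphereNegConj_sphereInv]
    rfl
  rw [h, extendZero_apply]
  rfl

theorem swap_mem_chartDomain {p : ℂ × ℂ} (hp : p ∈ chartDomain) : p.swap ∈ chartDomain := by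
  rw [mem_chartDomain] at *
  rwa [Prod.fst_swap, Prod.snd_swap, mul_comm]

theorem analyticAt_swap (p : ℂ × ℂ) : AnalyticAt ℂ Prod.swap p :=
  analyticAt_snd.prod analyticAt_fst

theorem isC2Sphere_restrictSph {F : Omega → ℂ} (hF : IsHolo F) : IsC2Sphere (restrictSph F) := by
  obtain ⟨a1, a2⟩ := hF
  refine ⟨?_, ?_⟩
  · simp only [restrictSph_coe]
    refine contDiff_iff_contDiffAt.2 fun z => ?_
    exact contDiffAt_comp_slice (f := extendZero F ∘ stdMap)
      (a1 _ (stdMap_mem_Omega.2 (slice_neg_one_mem z)))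
  · simp only [restrictSph_inftyMap]
    refine contDiff_iff_contDiffAt.2 fun z => ?_
    refine contDiffAt_comp_slice (f := fun p => extendZero F (flipMap p.swap)) ?_
    exact AnalyticAt.comp (f := Prod.swap)
      (a2 _ (flipMap_mem_Omega.2 (swap_mem_chartDomain (slice_neg_one_mem z)))) (analyticAt_swap _)

theorem lapSphere_restrictSph {F : Omega → ℂ} (hF : IsHolo F) (z : ℂ) :
    lapSphere (fun u : ℂ => restrictSph F (u : Sphere)) z =
      lapZW (extendZero F ∘ stdMap) (slice (-1) z) := by
  simp only [restrictSph_coe]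
  exact lapSphere_comp_slice (f := extendZero F ∘ stdMap)
    (hF.1 _ (stdMap_mem_Omega.2 (slice_neg_one_mem z)))

/-! ### Uniqueness of holomorphic extensions -/

theorem zero_mem_chartDomain : (0 : ℂ × ℂ) ∈ chartDomain := by simp [mem_chartDomain]

theorem analyticOnNhd_stdMap {F : Omega → ℂ} (hF : IsHolo F) :
    AnalyticOnNhd ℂ (extendZero F ∘ stdMap) chartDomain :=
  fun p hp => hF.1 p (stdMap_mem_Omega.2 hp)

theorem analyticOnNhd_flipMap {F : Omega → ℂ} (hF : IsHolo F) :
    AnalyticOnNhd ℂ (extendZero F ∘ flipMap) chartDomain :=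
  fun p hp => hF.2 p (flipMap_mem_Omega.2 hp)

theorem bidisk_chart_subset : disk ×ˢ disk ⊆ chartDomain := fun _ hp =>
  stdMap_mem_Omega.1 (bidisk_subset_Omega (stdMap_mem_bidisk.2 hp))

theorem eq_of_eqOn_stdMap {F G : Omega → ℂ} (hF : IsHolo F) (hG : IsHolo G)
    (h : Set.EqOn (extendZero F ∘ stdMap) (extendZero G ∘ stdMap) chartDomain) : F = G := by
  have hflip : Set.EqOn (extendZero F ∘ flipMap) (extendZero G ∘ flipMap) chartDomain := by
    refine (analyticOnNhd_flipMap hF).eqOn_of_preconnected_of_eventuallyEq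
      (analyticOnNhd_flipMap hG) isConnected_chartDomain.isPreconnected
      (z₀ := (2, 2)) (by norm_num [mem_chartDomain]) ?_
    have h1 : ∀ᶠ p : ℂ × ℂ in 𝓝 (2, 2), p.1 ≠ 0 :=
      continuousAt_fst.eventually_ne (by norm_num)
    have h2 : ∀ᶠ p : ℂ × ℂ in 𝓝 (2, 2), p.2 ≠ 0 :=
      continuousAt_snd.eventually_ne (by norm_num)
    filter_upwards [h1, h2, isOpen_chartDomain.mem_nhds
      (show ((2 : ℂ), (2 : ℂ)) ∈ chartDomain by norm_num [mem_chartDomain])] with p h1 h2 hp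
    rw [← flipMap_mem_Omega, flipMap_of_ne h1 h2, stdMap_mem_Omega] at hp
    simpa [flipMap_of_ne h1 h2] using h hp
  funext ⟨x, hx⟩
  rw [← extendZero_of_mem F hx, ← extendZero_of_mem G hx]
  rw [Omega_eq] at hx
  rcases hx with ⟨p, hp, rfl⟩ | ⟨p, hp, rfl⟩
  · exact h hp
  · exact hflip hp

theorem eq_of_restrictSph_eq {F G : Omega → ℂ} (hF : IsHolo F) (hG : IsHolo G)
    (h : restrictSph F = restrictSph G) : F = G := by
  refine eq_of_eqOn_stdMap hF hG (eqOn_of_slice (ε := -1) (by norm_num)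
    isConnected_chartDomain.isPreconnected zero_mem_chartDomain (analyticOnNhd_stdMap hF)
    (analyticOnNhd_stdMap hG) (Filter.Eventually.of_forall fun z => ?_))
  rw [Function.comp_apply, Function.comp_apply, ← restrictSph_coe, ← restrictSph_coe, h]

theorem eq_of_restrictHyp_eq {F G : bidisk → ℂ} (hF : IsHolo F) (hG : IsHolo G)
    (h : restrictHyp F = restrictHyp G) : F = G := by
  have key : Set.EqOn (extendZero F ∘ stdMap) (extendZero G ∘ stdMap) (disk ×ˢ disk) := by
    refine eqOn_of_slice (ε := 1) one_ne_zero isPreconnected_bidisk_chart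
      ⟨zero_mem_disk, zero_mem_disk⟩ (fun p hp => hF.1 p (stdMap_mem_bidisk.2 hp))
      (fun p hp => hG.1 p (stdMap_mem_bidisk.2 hp)) ?_
    filter_upwards [isOpen_disk.mem_nhds zero_mem_disk] with z hz
    rw [Function.comp_apply, Function.comp_apply, ← extendZero_restrictHyp F hz,
      ← extendZero_restrictHyp G hz, h]
  funext ⟨x, hx⟩
  rw [← extendZero_of_mem F hx, ← extendZero_of_mem G hx]
  obtain ⟨p, hp, rfl⟩ := hx
  exact key hp

theorem eq_of_restrictBidisk_eq {F G : Omega → ℂ} (hF : IsHolo F) (hG : IsHolo G)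
    (h : restrictBidisk F = restrictBidisk G) : F = G := by
  refine eq_of_eqOn_stdMap hF hG ((analyticOnNhd_stdMap hF).eqOn_of_preconnected_of_eventuallyEq
    (analyticOnNhd_stdMap hG) isConnected_chartDomain.isPreconnected zero_mem_chartDomain ?_)
  filter_upwards [(isOpen_disk.prod isOpen_disk).mem_nhds
    (show (0 : ℂ × ℂ) ∈ disk ×ˢ disk from ⟨zero_mem_disk, zero_mem_disk⟩)] with p hp
  have h1 := congrFun h ⟨stdMap p, stdMap_mem_bidisk.2 hp⟩
  rw [Function.comp_apply, Function.comp_apply,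
    extendZero_of_mem F (bidisk_subset_Omega (stdMap_mem_bidisk.2 hp)),
    extendZero_of_mem G (bidisk_subset_Omega (stdMap_mem_bidisk.2 hp))]
  exact h1

/-- The eigenvalue equation propagates from the bidisk to the standard chart of `Ω`. -/
theorem lapZW_stdMap_of_restrictBidisk {lam : ℂ} {G : Omega → ℂ} (hG : IsHolo G)
    (h : restrictBidisk G ∈ eigenspace lam bidisk) {p : ℂ × ℂ} (hp : p ∈ chartDomain) :
    lapZW (extendZero G ∘ stdMap) p = lam * extendZero G (stdMap p) := by
  have hf := analyticOnNhd_stdMap hG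
  have hW : AnalyticOnNhd ℂ (partialW (extendZero G ∘ stdMap)) chartDomain := fun p hp =>
    ((ContinuousLinearMap.apply ℂ ℂ ((0 : ℂ), (1 : ℂ))).analyticAt _).comp (hf.fderiv p hp)
  have hZ : AnalyticOnNhd ℂ (partialZ (partialW (extendZero G ∘ stdMap))) chartDomain :=
    fun p hp => ((ContinuousLinearMap.apply ℂ ℂ ((1 : ℂ), (0 : ℂ))).analyticAt _).comp
      (hW.fderiv p hp)
  have hlap : AnalyticOnNhd ℂ (lapZW (extendZero G ∘ stdMap)) chartDomain := fun p hp =>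
    (analyticAt_const.mul ((analyticAt_const.sub (analyticAt_fst.mul analyticAt_snd)).pow 2)).mul
      (hZ p hp)
  refine hlap.eqOn_of_preconnected_of_eventuallyEq
    (g := fun p => lam * extendZero G (stdMap p)) (fun p hp => analyticAt_const.mul (hf p hp))
    isConnected_chartDomain.isPreconnected zero_mem_chartDomain ?_ hp
  have hx (x : bidisk) : restrictBidisk G x = extendZero G x :=
    (extendZero_of_mem G (bidisk_subset_Omega x.2)).symm
  filter_upwards [(isOpen_disk.prod isOpen_disk).mem_nhds
    (show (0 : ℂ × ℂ) ∈ disk ×ˢ disk from ⟨zero_mem_disk, zero_mem_disk⟩)] with p hp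
  have hp' := stdMap_mem_bidisk.2 hp
  rw [← lapZW_congr (eventuallyEq_extendZero_stdMap isOpen_bidisk hx hp'), h.2.1 p hp',
    extendZero_of_mem (restrictBidisk G) hp', hx]

/-! ### The Poisson type kernels -/

/-- The function `(s - t z) (t - s w) / (1 - z w)` on the chart domain. Its powers are
eigenfunctions of the invariant Laplacian; up to normalization, `(s : t)` with `|s| = |t|` gives
the Poisson kernel of the disk. -/
noncomputable def poisson (s t : ℂ) (p : ℂ × ℂ) : ℂ :=
  (s - t * p.1) * (t - s * p.2) / (1 - p.1 * p.2)

theorem one_sub_ne_zero {p : ℂ × ℂ} (hp : p ∈ chartDomain) : 1 - p.1 * p.2 ≠ 0 :=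
  sub_ne_zero.2 (Ne.symm hp)

theorem analyticAt_poisson (s t : ℂ) {p : ℂ × ℂ} (hp : p ∈ chartDomain) :
    AnalyticAt ℂ (poisson s t) p :=
  ((analyticAt_const.sub (analyticAt_const.mul analyticAt_fst)).mul
    (analyticAt_const.sub (analyticAt_const.mul analyticAt_snd))).div
    (analyticAt_const.sub (analyticAt_fst.mul analyticAt_snd)) (one_sub_ne_zero hp)

theorem partialW_eq {k : ℂ × ℂ → ℂ} {p : ℂ × ℂ} {c : ℂ} (hk : DifferentiableAt ℂ k p)
    (h : HasDerivAt (fun w => k (p.1, w)) c p.2) : partialW k p = c := by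
  have h1 : HasDerivAt (fun w : ℂ => (p.1, w)) ((0 : ℂ), (1 : ℂ)) p.2 :=
    (hasDerivAt_const _ _).prodMk (hasDerivAt_id _)
  exact (hk.hasFDerivAt.comp_hasDerivAt p.2 h1).unique h

theorem partialZ_eq {k : ℂ × ℂ → ℂ} {p : ℂ × ℂ} {c : ℂ} (hk : DifferentiableAt ℂ k p)
    (h : HasDerivAt (fun z => k (z, p.2)) c p.1) : partialZ k p = c := by
  have h1 : HasDerivAt (fun z : ℂ => (z, p.2)) ((1 : ℂ), (0 : ℂ)) p.1 :=
    (hasDerivAt_id _).prodMk (hasDerivAt_const _ _)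
  exact (hk.hasFDerivAt.comp_hasDerivAt p.1 h1).unique h

theorem hasDerivAt_poisson_snd (s t : ℂ) {p : ℂ × ℂ} (hp : p ∈ chartDomain) :
    HasDerivAt (fun w => poisson s t (p.1, w))
      (-((s - t * p.1) ^ 2 / (1 - p.1 * p.2) ^ 2)) p.2 := by
  have h0 := one_sub_ne_zero hp
  have h1 := ((((hasDerivAt_id' p.2).const_mul s).const_sub t).const_mul (s - t * p.1)).div
    (((hasDerivAt_id' p.2).const_mul p.1).const_sub 1) h0
  refine h1.congr_deriv ?_
  field_simp
  ring

theorem hasDerivAt_poisson_fst (s t : ℂ) {p : ℂ × ℂ} (hp : p ∈ chartDomain) :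
    HasDerivAt (fun z => poisson s t (z, p.2))
      (-((t - s * p.2) ^ 2 / (1 - p.1 * p.2) ^ 2)) p.1 := by
  have h0 := one_sub_ne_zero hp
  have h1 := ((((hasDerivAt_id' p.1).const_mul t).const_sub s).mul_const (t - s * p.2)).div
    (((hasDerivAt_id' p.1).mul_const p.2).const_sub 1) h0
  refine h1.congr_deriv ?_
  field_simp
  ring

/-- The invariant Laplacian acts on functions of `q = poisson s t` through the ordinary
differential operator `4 (q² ∂² + 2 q ∂)`, because `q_z q_w = q² / (1 - z w)²` and
`q_{zw} = 2 q / (1 - z w)²`. -/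
theorem lapZW_comp_poisson {φ φ' : ℂ → ℂ} {c s t : ℂ} {p : ℂ × ℂ} (hp : p ∈ chartDomain)
    (hφ : AnalyticAt ℂ φ (poisson s t p))
    (h1 : ∀ᶠ x in 𝓝 (poisson s t p), HasDerivAt φ (φ' x) x)
    (h2 : HasDerivAt φ' c (poisson s t p)) :
    lapZW (fun u => φ (poisson s t u)) p =
      4 * (c * poisson s t p ^ 2 + 2 * poisson s t p * φ' (poisson s t p)) := by
  have hq := analyticAt_poisson s t hp
  have h0 := one_sub_ne_zero hp
  have hW : partialW (fun u => φ (poisson s t u)) =ᶠ[𝓝 p]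
      fun u => φ' (poisson s t u) * -((s - t * u.1) ^ 2 / (1 - u.1 * u.2) ^ 2) := by
    filter_upwards [isOpen_chartDomain.mem_nhds hp, hq.continuousAt.eventually h1,
      hq.continuousAt.eventually hφ.eventually_analyticAt] with u hu hu' hu''
    refine partialW_eq ?_ ?_
    · exact hu''.differentiableAt.comp u (analyticAt_poisson s t hu).differentiableAt
    · exact HasDerivAt.comp u.2 (h₂ := φ) hu' (hasDerivAt_poisson_snd s t hu)
  have hd : HasDerivAt (fun z => φ' (poisson s t (z, p.2)) *
      -((s - t * z) ^ 2 / (1 - z * p.2) ^ 2))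
      (c * -((t - s * p.2) ^ 2 / (1 - p.1 * p.2) ^ 2) *
        -((s - t * p.1) ^ 2 / (1 - p.1 * p.2) ^ 2) + φ' (poisson s t p) *
        (2 * (s - t * p.1) * (t - s * p.2) / (1 - p.1 * p.2) ^ 3)) p.1 := by
    have e1 : HasDerivAt (fun z => φ' (poisson s t (z, p.2)))
        (c * -((t - s * p.2) ^ 2 / (1 - p.1 * p.2) ^ 2)) p.1 :=
      HasDerivAt.comp p.1 (h₂ := φ') h2 (hasDerivAt_poisson_fst s t hp)
    have e2 : HasDerivAt (fun z => -((s - t * z) ^ 2 / (1 - z * p.2) ^ 2))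
        (2 * (s - t * p.1) * (t - s * p.2) / (1 - p.1 * p.2) ^ 3) p.1 := by
      refine (((((hasDerivAt_id' p.1).const_mul t).const_sub s).fun_pow 2).fun_div
        ((((hasDerivAt_id' p.1).mul_const p.2).const_sub 1).fun_pow 2)
        (pow_ne_zero 2 h0)).fun_neg.congr_deriv ?_
      simp only [Nat.cast_ofNat, Nat.add_one_sub_one, pow_one]
      field_simp
      ring
    exact e1.mul e2
  have hdiff : DifferentiableAt ℂ
      (fun u : ℂ × ℂ => φ' (poisson s t u) * -((s - t * u.1) ^ 2 / (1 - u.1 * u.2) ^ 2)) p := by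
    have e1 : DifferentiableAt ℂ
        (fun u : ℂ × ℂ => (s - t * u.1) ^ 2 / (1 - u.1 * u.2) ^ 2) p := by
      fun_prop (disch := exact pow_ne_zero 2 h0)
    exact (h2.differentiableAt.comp p hq.differentiableAt).mul e1.neg
  simp only [lapZW]
  rw [partialZ_congr hW, partialZ_eq hdiff hd]
  simp only [poisson]
  field_simp

theorem lapZW_poisson_pow (s t : ℂ) (m : ℕ) {p : ℂ × ℂ} (hp : p ∈ chartDomain) :
    lapZW (fun u => poisson s t u ^ m) p = 4 * m * (m + 1) * poisson s t p ^ m := by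
  rw [lapZW_comp_poisson (φ := fun x => x ^ m) (φ' := fun x => m * x ^ (m - 1))
    (c := m * ((m - 1 : ℕ) * poisson s t p ^ (m - 1 - 1))) hp (by fun_prop)
    (Filter.Eventually.of_forall fun x => hasDerivAt_pow m x)
    ((hasDerivAt_pow (m - 1) _).const_mul _)]
  rcases m with _ | _ | m
  · simp
  · simp
    ring
  · simp
    ring

theorem lapZW_poisson_inv_pow (s t : ℂ) (m : ℕ) {p : ℂ × ℂ} (hp : p ∈ chartDomain)
    (h0 : poisson s t p ≠ 0) :
    lapZW (fun u => (poisson s t u)⁻¹ ^ (m + 1)) p =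
      4 * m * (m + 1) * (poisson s t p)⁻¹ ^ (m + 1) := by
  have hd (k : ℕ) {x : ℂ} (hx : x ≠ 0) :
      HasDerivAt (fun x : ℂ => x⁻¹ ^ (k + 1)) (-(k + 1) * x⁻¹ ^ (k + 2)) x := by
    refine ((hasDerivAt_inv hx).pow (k + 1)).congr_deriv ?_
    simp only [Nat.add_one_sub_one]
    push_cast
    ring
  rw [lapZW_comp_poisson (φ := fun x => x⁻¹ ^ (m + 1)) (φ' := fun x => -(m + 1) * x⁻¹ ^ (m + 2))
    (c := -(m + 1) * (-((m + 1 : ℕ) + 1) * (poisson s t p)⁻¹ ^ (m + 1 + 2))) hp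
    ((analyticAt_inv h0).pow _)
    (Filter.Eventually.mono (isOpen_ne.mem_nhds h0) fun x hx => hd m hx)
    ((hd (m + 1) h0).const_mul _)]
  generalize poisson s t p = q at h0
  have h1 : q * q⁻¹ = 1 := mul_inv_cancel₀ h0
  push_cast
  linear_combination 4 * (m + 1) * q⁻¹ ^ (m + 1) * ((m + 2) * (q * q⁻¹ + 1) - 2) * h1

/-- The holomorphic function on `Ω` which is `poisson s t` in the standard chart. -/
noncomputable def poissonSph (s t : ℂ) (p : Sphere × Sphere) : ℂ :=
  match p.1, p.2 with
  | none, none => -(s * t)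
  | none, some w => t * (t * w⁻¹ - s)
  | some z, none => s * (s * z⁻¹ - t)
  | some z, some w => poisson s t (z, w)

theorem poissonSph_stdMap (s t : ℂ) (p : ℂ × ℂ) : poissonSph s t (stdMap p) = poisson s t p := rfl

theorem poissonSph_flipMap (s t : ℂ) {p : ℂ × ℂ} (hp : p ∈ chartDomain) :
    poissonSph s t (flipMap p) = -poisson s t p := by
  obtain ⟨u, v⟩ := p
  have h0 := one_sub_ne_zero hp
  by_cases hu : u = 0
  · subst hu
    by_cases hv : v = 0
    · subst hv
      simp only [flipMap, sphereInv_zero, poisson]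
      change -(s * t) = _
      ring
    · simp only [flipMap, sphereInv_zero, sphereInv_coe_of_ne hv, poisson]
      change s * (s * v⁻¹⁻¹ - t) = _
      rw [inv_inv]
      ring
  · by_cases hv : v = 0
    · subst hv
      simp only [flipMap, sphereInv_zero, sphereInv_coe_of_ne hu, poisson]
      change t * (t * u⁻¹⁻¹ - s) = _
      rw [inv_inv]
      ring
    · rw [flipMap_of_ne hu hv, poissonSph_stdMap]
      simp only [poisson] at h0 ⊢
      have h1 : 1 - v⁻¹ * u⁻¹ ≠ 0 := by
        intro h
        apply h0
        field_simp at h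
        linear_combination -h
      have h2 : u * v - 1 ≠ 0 := fun h => h0 (by linear_combination -h)
      rw [show 1 - v⁻¹ * u⁻¹ = (u * v - 1) * (v⁻¹ * u⁻¹) by field_simp, ← neg_sub (u * v) 1,
        div_neg, neg_neg]
      field_simp
      congr 1
      ring

/-- The `m`-th power of `poissonSph s t`, as a function on `Ω`. -/
noncomputable def kernel (m : ℕ) (s t : ℂ) : Omega → ℂ := fun p => poissonSph s t p ^ m

theorem kernel_stdMap (m : ℕ) (s t : ℂ) {p : ℂ × ℂ} (hp : p ∈ chartDomain) :
    extendZero (kernel m s t) (stdMap p) = poisson s t p ^ m :=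
  extendZero_of_mem _ (stdMap_mem_Omega.2 hp)

theorem kernel_flipMap (m : ℕ) (s t : ℂ) {p : ℂ × ℂ} (hp : p ∈ chartDomain) :
    extendZero (kernel m s t) (flipMap p) = (-1) ^ m * poisson s t p ^ m := by
  rw [extendZero_of_mem _ (flipMap_mem_Omega.2 hp)]
  simp only [kernel, poissonSph_flipMap s t hp, neg_pow (poisson s t p)]

theorem kernel_mem (m : ℕ) (s t : ℂ) : kernel m s t ∈ eigenspace (4 * m * (m + 1)) Omega := by
  have hstd {p : ℂ × ℂ} (hp : p ∈ chartDomain) :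
      extendZero (kernel m s t) ∘ stdMap =ᶠ[𝓝 p] fun u => poisson s t u ^ m := by
    filter_upwards [isOpen_chartDomain.mem_nhds hp] with u hu using kernel_stdMap m s t hu
  have hflip {p : ℂ × ℂ} (hp : p ∈ chartDomain) :
      extendZero (kernel m s t) ∘ flipMap =ᶠ[𝓝 p]
        ((-1) ^ m : ℂ) • fun u => poisson s t u ^ m := by
    filter_upwards [isOpen_chartDomain.mem_nhds hp] with u hu using kernel_flipMap m s t hu
  have han {p : ℂ × ℂ} (hp : p ∈ chartDomain) : AnalyticAt ℂ (fun u => poisson s t u ^ m) p :=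
    (analyticAt_poisson s t hp).pow m
  refine ⟨⟨fun p hp => ?_, fun p hp => ?_⟩, fun p hp => ?_, fun p hp => ?_⟩
  · rw [stdMap_mem_Omega] at hp
    exact (han hp).congr (hstd hp).symm
  · rw [flipMap_mem_Omega] at hp
    exact ((han hp).const_smul).congr (hflip hp).symm
  · rw [stdMap_mem_Omega] at hp
    rw [lapZW_congr (hstd hp), lapZW_poisson_pow s t m hp, kernel_stdMap m s t hp]
  · rw [flipMap_mem_Omega] at hp
    rw [lapZW_congr (hflip hp), lapZW_smul _ (han hp), lapZW_poisson_pow s t m hp,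
      kernel_flipMap m s t hp]
    ring

theorem poisson_swap (s t : ℂ) (p : ℂ × ℂ) : poisson s t p.swap = poisson t s p := by
  simp only [poisson, Prod.fst_swap, Prod.snd_swap]
  rw [mul_comm p.2 p.1, mul_comm (s - _)]

theorem restrictSph_kernel_mem (m : ℕ) (s t : ℂ) :
    restrictSph (kernel m s t) ∈ sphereEigenspace (4 * m * (m + 1)) := by
  have hK := (kernel_mem m s t).1
  refine ⟨isC2Sphere_restrictSph hK, fun z => ?_, fun z => ?_⟩
  · rw [lapSphere_restrictSph hK, restrictSph_coe]
    exact (kernel_mem m s t).2.1 _ (stdMap_mem_Omega.2 (slice_neg_one_mem z))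
  · have h (u : ℂ) : restrictSph (kernel m s t) (inftyMap u) =
        (((-1) ^ m : ℂ) • fun p => poisson t s p ^ m) (slice (-1) u) := by
      rw [restrictSph_inftyMap, kernel_flipMap m s t (swap_mem_chartDomain (slice_neg_one_mem u)),
        poisson_swap]
      rfl
    have han : AnalyticAt ℂ (fun p => poisson t s p ^ m) (slice (-1) z) :=
      (analyticAt_poisson t s (slice_neg_one_mem z)).pow m
    simp only [h]
    rw [lapSphere_comp_slice (han.const_smul), lapZW_smul _ han,
      lapZW_poisson_pow t s m (slice_neg_one_mem z)]
    simp only [Pi.smul_apply, smul_eq_mul]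
    ring

/-! ### Linear independence of the kernels -/

theorem coeff_pos_of_le (m k : ℕ) (hk : k ≤ 2 * m) :
    0 < ((Polynomial.X ^ 2 + 3 * Polynomial.X + 2 : Polynomial ℝ) ^ m).coeff k := by
  induction m generalizing k with
  | zero =>
    obtain rfl : k = 0 := by omega
    simp
  | succ m ih =>
    have hnn (k : ℕ) :
        0 ≤ ((Polynomial.X ^ 2 + 3 * Polynomial.X + 2 : Polynomial ℝ) ^ m).coeff k := by
      by_cases hk : k ≤ 2 * m
      · exact (ih k hk).le
      · have hd : ((Polynomial.X ^ 2 + 3 * Polynomial.X + 2 : Polynomial ℝ) ^ m).natDegree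
            ≤ 2 * m := by
          rw [mul_comm 2 m]
          refine Polynomial.natDegree_pow_le_of_le m ?_
          compute_degree
        exact le_of_eq (Polynomial.coeff_eq_zero_of_natDegree_lt (hd.trans_lt (by omega))).symm
    set P := ((Polynomial.X ^ 2 + 3 * Polynomial.X + 2 : Polynomial ℝ)) ^ m
    have e : ((Polynomial.X ^ 2 + 3 * Polynomial.X + 2 : Polynomial ℝ)) ^ (m + 1) =
        P * Polynomial.X * Polynomial.X + Polynomial.C 3 * (P * Polynomial.X) +
          Polynomial.C 2 * P := by
      rw [pow_succ]
      simp only [map_ofNat]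
      ring
    rw [e]
    rcases k with _ | _ | k
    · have := ih 0 (by omega)
      simpa using this
    · simp only [zero_add, Polynomial.coeff_add, Polynomial.coeff_C_mul, Polynomial.coeff_mul_X,
        Polynomial.coeff_mul_X_zero]
      have h1 := ih 0 (by omega)
      have h2 := hnn 1
      have h3 : (P * Polynomial.X * Polynomial.X).coeff 1 = 0 := by
        rw [show (1 : ℕ) = 0 + 1 from rfl, Polynomial.coeff_mul_X]
        simp
      have h4 : (P * Polynomial.X).coeff 1 = P.coeff 0 := by
        rw [show (1 : ℕ) = 0 + 1 from rfl, Polynomial.coeff_mul_X]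
      linarith
    · simp only [Polynomial.coeff_add, Polynomial.coeff_C_mul, Polynomial.coeff_mul_X]
      have h1 := ih k (by omega)
      have h2 := hnn (k + 1)
      have h3 := hnn (k + 1 + 1)
      linarith

/-- Along the curve `w = 2 / z`, the kernel with parameters `(1, -t)` is `z^(-m)` times a polynomial
in `t z` of degree `2 m` with positive coefficients. -/
theorem poisson_curve (m : ℕ) {x : ℂ} (hx : x ≠ 0) (t : ℂ) :
    poisson 1 (-t) (x, 2 * x⁻¹) ^ m = ∑ k : Fin (2 * m + 1), t ^ (k : ℕ) *
      ((((Polynomial.X ^ 2 + 3 * Polynomial.X + 2 : Polynomial ℝ) ^ m).coeff k : ℝ) : ℂ) *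
      (x ^ (k : ℕ) * x⁻¹ ^ m) := by
  set P := ((Polynomial.X ^ 2 + 3 * Polynomial.X + 2 : Polynomial ℝ)) ^ m with hP
  have hd : P.natDegree < 2 * m + 1 := by
    have : P.natDegree ≤ m * 2 := by
      refine Polynomial.natDegree_pow_le_of_le m ?_
      compute_degree
    omega
  have h1 : Polynomial.eval₂ (algebraMap ℝ ℂ) (t * x) P =
      ∑ k : Fin (2 * m + 1), (P.coeff k : ℂ) * (t * x) ^ (k : ℕ) := by
    rw [Polynomial.eval₂_eq_sum_range' _ hd, Finset.sum_range]
    rfl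
  have h2 : Polynomial.eval₂ (algebraMap ℝ ℂ) (t * x) P = ((t * x) ^ 2 + 3 * (t * x) + 2) ^ m := by
    simp only [hP, Polynomial.eval₂_pow, Polynomial.eval₂_add, Polynomial.eval₂_mul,
      Polynomial.eval₂_X, Polynomial.eval₂_ofNat]
  have h3 : poisson 1 (-t) (x, 2 * x⁻¹) = ((t * x) ^ 2 + 3 * (t * x) + 2) * x⁻¹ := by
    simp only [poisson]
    have h4 : 1 - x * (2 * x⁻¹) = -1 := by
      field_simp
      ring
    rw [h4]
    field_simp
    ring
  rw [h3, mul_pow, ← h2, h1, Finset.sum_mul]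
  refine Finset.sum_congr rfl fun k _ => ?_
  rw [mul_pow]
  ring

theorem curve_mem {x : ℂ} (hx : x ≠ 0) : (x, 2 * x⁻¹) ∈ chartDomain := by
  rw [mem_chartDomain]
  simp only
  rw [mul_left_comm, mul_inv_cancel₀ hx]
  norm_num

theorem linearIndependent_kernel (m : ℕ) {t : Fin (2 * m + 1) → ℂ} (ht : Function.Injective t) :
    LinearIndependent ℂ fun i => kernel m 1 (-t i) := by
  -- evaluation at points of the curve factors through two Vandermonde matrices
  let x : Fin (2 * m + 1) → ℂ := fun j => ((j : ℕ) : ℂ) + 1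
  have hx0 (j) : x j ≠ 0 := by
    simp only [x]
    exact_mod_cast Nat.succ_ne_zero j
  have hx : Function.Injective x := fun i j h => by
    simp only [x, add_left_inj, Nat.cast_inj] at h
    exact Fin.ext h
  let a : Fin (2 * m + 1) → ℂ := fun k =>
    ((((Polynomial.X ^ 2 + 3 * Polynomial.X + 2 : Polynomial ℝ) ^ m).coeff k : ℝ) : ℂ)
  have ha (k) : a k ≠ 0 := by
    simpa [a] using (coeff_pos_of_le m k (by omega)).ne'
  let M : Matrix (Fin (2 * m + 1)) (Fin (2 * m + 1)) ℂ :=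
    Matrix.vandermonde t * Matrix.diagonal a * (Matrix.vandermonde x).transpose *
      Matrix.diagonal fun j => (x j)⁻¹ ^ m
  have hM : IsUnit M := by
    rw [Matrix.isUnit_iff_isUnit_det, isUnit_iff_ne_zero]
    simp only [M, Matrix.det_mul, Matrix.det_diagonal, Matrix.det_transpose]
    refine mul_ne_zero (mul_ne_zero (mul_ne_zero ?_ ?_) ?_) ?_
    · exact Matrix.det_vandermonde_ne_zero_iff.2 ht
    · exact Finset.prod_ne_zero_iff.2 fun k _ => ha k
    · exact Matrix.det_vandermonde_ne_zero_iff.2 hx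
    · exact Finset.prod_ne_zero_iff.2 fun k _ => pow_ne_zero _ (inv_ne_zero (hx0 k))
  let ev : (Omega → ℂ) →ₗ[ℂ] (Fin (2 * m + 1) → ℂ) :=
    LinearMap.funLeft ℂ ℂ fun j =>
      ⟨stdMap (x j, 2 * (x j)⁻¹), stdMap_mem_Omega.2 (curve_mem (hx0 j))⟩
  refine LinearIndependent.of_comp ev ?_
  have h1 : (ev ∘ fun i => kernel m 1 (-t i)) = M.row := by
    funext i j
    have h2 : M.row i j =
        ∑ k : Fin (2 * m + 1), t i ^ (k : ℕ) * a k * x j ^ (k : ℕ) * (x j)⁻¹ ^ m := by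
      simp only [M, Matrix.row]
      rw [Matrix.mul_diagonal, Matrix.mul_apply, Finset.sum_mul]
      exact Finset.sum_congr rfl fun k _ => by
        rw [Matrix.mul_diagonal, Matrix.transpose_apply, Matrix.vandermonde_apply,
          Matrix.vandermonde_apply]
    refine Eq.trans ?_ h2.symm
    change poisson 1 (-t i) (x j, 2 * (x j)⁻¹) ^ m = _
    rw [poisson_curve m (hx0 j)]
    exact Finset.sum_congr rfl fun k _ => by ring
  rw [h1]
  exact Matrix.linearIndependent_rows_of_isUnit hM

section

open MeasureTheory

/-! ### Green's formula on the sphere -/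

theorem fderiv_fderiv_apply {a : ℂ → ℂ} (ha : ContDiff ℝ 2 a) (z u v : ℂ) :
    fderiv ℝ (fun y => fderiv ℝ a y v) z u = fderiv ℝ (fderiv ℝ a) z u v := by
  have h : DifferentiableAt ℝ (fderiv ℝ a) z :=
    (ha.fderiv_right (m := 1) (by norm_num)).differentiable (by norm_num) z
  rw [fderiv_clm_apply h (differentiableAt_const v)]
  simp

theorem wirt_eq_fderiv {a : ℂ → ℂ} (ha : ContDiff ℝ 2 a) (z : ℂ) :
    wirtZ (wirtZbar a) z =
      (fderiv ℝ (fderiv ℝ a) z 1 1 + fderiv ℝ (fderiv ℝ a) z Complex.I Complex.I) / 4 := by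
  have h (v : ℂ) : DifferentiableAt ℝ (fun y => fderiv ℝ a y v) z :=
    ((ha.fderiv_right (m := 1) (by norm_num)).differentiable (by norm_num) z).clm_apply
      (differentiableAt_const _)
  have hs : fderiv ℝ (fderiv ℝ a) z 1 Complex.I = fderiv ℝ (fderiv ℝ a) z Complex.I 1 :=
    ha.contDiffAt.isSymmSndFDerivAt (by simp) 1 Complex.I
  have e (u : ℂ) : fderiv ℝ (wirtZbar a) z u = (fderiv ℝ (fderiv ℝ a) z u 1 +
      Complex.I * fderiv ℝ (fderiv ℝ a) z u Complex.I) / 2 := by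
    have e1 : wirtZbar a = fun y => (2⁻¹ : ℂ) *
        (fderiv ℝ a y 1 + Complex.I * fderiv ℝ a y Complex.I) := by
      funext y
      simp only [wirtZbar]
      ring
    rw [e1, fderiv_const_mul ((h 1).fun_add ((h Complex.I).const_mul _)),
      fderiv_fun_add (h 1) ((h Complex.I).const_mul _), fderiv_const_mul (h Complex.I)]
    simp only [_root_.smul_apply, _root_.add_apply, fderiv_fderiv_apply ha, smul_eq_mul]
    ring
  simp only [wirtZ, e, hs]
  linear_combination (-(fderiv ℝ (fderiv ℝ a) z Complex.I Complex.I) / 4) * Complex.I_mul_I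

theorem integrable_decay : Integrable (fun z : ℂ => (1 + ‖z‖) ^ (-3 : ℝ)) :=
  integrable_one_add_norm (by simp; norm_num)

theorem decay_eq (z : ℂ) : (1 + ‖z‖) ^ (-3 : ℝ) = ((1 + ‖z‖) ^ 3)⁻¹ := by
  rw [Real.rpow_neg (by positivity)]
  norm_cast

/-- The divergence theorem on the sphere: a vector field on the plane with components decaying
like `|z|⁻²` has no flux through infinity. -/
theorem integral_divergence_eq_zero {ω₁ ω₂ : ℂ → ℂ} (h₁ : ContDiff ℝ 1 ω₁) (h₂ : ContDiff ℝ 1 ω₂)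
    {C : ℝ} (b₁ : ∀ z, ‖ω₁ z‖ ≤ C / (1 + ‖z‖ ^ 2)) (b₂ : ∀ z, ‖ω₂ z‖ ≤ C / (1 + ‖z‖ ^ 2))
    (hd : Integrable fun z => fderiv ℝ ω₁ z 1 + fderiv ℝ ω₂ z Complex.I) :
    ∫ z, (fderiv ℝ ω₁ z 1 + fderiv ℝ ω₂ z Complex.I) = 0 := by
  let f : ContDiffBump (0 : ℂ) := ⟨1, 2, one_pos, one_lt_two⟩
  let F : ℂ → ℂ := fun z => (f z : ℂ)
  have hF : ContDiff ℝ 1 F := Complex.ofRealCLM.contDiff.comp f.contDiff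
  have hFs : HasCompactSupport F := f.hasCompactSupport.comp_left (g := fun x : ℝ => (x : ℂ)) rfl
  have hF' : Continuous (fderiv ℝ F) := hF.continuous_fderiv (by norm_num)
  obtain ⟨M, hM⟩ := (hFs.fderiv ℝ).exists_bound_of_continuous hF'
  have hM0 : 0 ≤ M := (norm_nonneg _).trans (hM 0)
  have hC0 : 0 ≤ C := by simpa using (norm_nonneg _).trans (b₁ 0)
  have hF1 (z : ℂ) (hz : ‖z‖ ≤ 1) : F z = 1 := by
    have : f z = 1 := f.one_of_mem_closedBall (by simpa using hz)
    simp [F, this]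
  have hFle (z : ℂ) : ‖F z‖ ≤ 1 := by
    simp only [F, Complex.norm_real, Real.norm_eq_abs, abs_of_nonneg f.nonneg, f.le_one]
  have hF0 (z : ℂ) (hz : 2 < ‖z‖) : fderiv ℝ F z = 0 := by
    have hsub : tsupport (fderiv ℝ F) ⊆ Metric.closedBall 0 2 := by
      refine (tsupport_fderiv_subset ℝ).trans ?_
      refine closure_minimal ?_ Metric.isClosed_closedBall
      refine Set.Subset.trans ?_ (f.tsupport_eq.le)
      refine Set.Subset.trans ?_ subset_closure
      intro y hy hy'
      exact hy (by simp [F, hy'])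
    exact image_eq_zero_of_notMem_tsupport fun h => by simpa using (hsub h).trans_lt hz
  -- the rescaled cutoff functions
  let c : ℕ → ℝ := fun n => ((n : ℝ) + 1)⁻¹
  have hc (n : ℕ) : 0 < c n := by positivity
  let χ : ℕ → ℂ → ℂ := fun n z => F (c n • z)
  have hχ (n : ℕ) : ContDiff ℝ 1 (χ n) := hF.comp (contDiff_const_smul (c n))
  have hχs (n : ℕ) : HasCompactSupport (χ n) := hFs.comp_smul (hc n).ne'
  have hχ' (n : ℕ) (z v : ℂ) : fderiv ℝ (χ n) z v = (c n : ℂ) * fderiv ℝ F (c n • z) v := by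
    simp only [χ, fderiv_comp_smul]
    simp
  have hnz (n : ℕ) (z : ℂ) : ‖c n • z‖ = c n * ‖z‖ := by
    rw [norm_smul, Real.norm_of_nonneg (hc n).le]
  have hDle (n : ℕ) (z v : ℂ) (hv : ‖v‖ = 1) : ‖fderiv ℝ (χ n) z v‖ ≤ c n * M := by
    rw [hχ', norm_mul, Complex.norm_real, Real.norm_of_nonneg (hc n).le]
    gcongr
    refine (ContinuousLinearMap.le_opNorm _ _).trans ?_
    rw [hv, mul_one]
    exact hM _
  have hDle' (n : ℕ) (z v : ℂ) (hv : ‖v‖ = 1) :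
      ‖fderiv ℝ (χ n) z v‖ ≤ 3 * M / (1 + ‖z‖) := by
    by_cases hz : 2 < c n * ‖z‖
    · rw [hχ', hF0 _ (by rwa [hnz])]
      simp only [_root_.zero_apply, mul_zero, norm_zero]
      positivity
    · refine (hDle n z v hv).trans ?_
      rw [le_div_iff₀ (by positivity)]
      have : c n ≤ 1 := inv_le_one_of_one_le₀ (by simp)
      nlinarith
  have hdecay (z : ℂ) : C / (1 + ‖z‖ ^ 2) * (3 * M / (1 + ‖z‖)) ≤
      6 * C * M * (1 + ‖z‖) ^ (-3 : ℝ) := by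
    rw [decay_eq, div_mul_div_comm, ← div_eq_mul_inv, div_le_div_iff₀ (by positivity)
      (by positivity)]
    have h1 : (1 + ‖z‖) ^ 2 ≤ 2 * (1 + ‖z‖ ^ 2) := by nlinarith [sq_nonneg (1 - ‖z‖)]
    have h2 : 0 ≤ 3 * (C * M) * (1 + ‖z‖) := by positivity
    nlinarith [mul_le_mul_of_nonneg_left h1 h2]
  have hcz : Filter.Tendsto c Filter.atTop (𝓝 0) := tendsto_inv_atTop_zero.comp
    (Filter.tendsto_atTop_add_const_right _ _ tendsto_natCast_atTop_atTop)
  -- integration by parts against the cutoff functions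
  have key (n : ℕ) {ω : ℂ → ℂ} (hω : ContDiff ℝ 1 ω) (v : ℂ) :
      Integrable (fun z => fderiv ℝ ω z v * χ n z) ∧
      Integrable (fun z => ω z * fderiv ℝ (χ n) z v) ∧
      ∫ z, ω z * fderiv ℝ (χ n) z v = - ∫ z, fderiv ℝ ω z v * χ n z := by
    have c1 : Continuous fun z => fderiv ℝ ω z v :=
      (hω.continuous_fderiv (by norm_num)).clm_apply continuous_const
    have c2 : Continuous fun z => fderiv ℝ (χ n) z v :=
      ((hχ n).continuous_fderiv (by norm_num)).clm_apply continuous_const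
    have s2 : HasCompactSupport fun z => fderiv ℝ (χ n) z v :=
      ((hχs n).fderiv ℝ).comp_left (g := fun L : ℂ →L[ℝ] ℂ => L v) rfl
    have i1 : Integrable (fun z => fderiv ℝ ω z v * χ n z) :=
      (c1.mul (hχ n).continuous).integrable_of_hasCompactSupport (hχs n).mul_left
    have i2 : Integrable (fun z => ω z * fderiv ℝ (χ n) z v) :=
      (hω.continuous.mul c2).integrable_of_hasCompactSupport s2.mul_left
    have i3 : Integrable (fun z => ω z * χ n z) :=
      (hω.continuous.mul (hχ n).continuous).integrable_of_hasCompactSupport (hχs n).mul_left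
    exact ⟨i1, i2, integral_mul_fderiv_eq_neg_fderiv_mul_of_integrable i1 i2 i3
      (fun x _ => hω.differentiable (by norm_num) x)
      (fun x _ => (hχ n).differentiable (by norm_num) x)⟩
  have keylim {ω : ℂ → ℂ} (hω : ContDiff ℝ 1 ω) (b : ∀ z, ‖ω z‖ ≤ C / (1 + ‖z‖ ^ 2)) (v : ℂ)
      (hv : ‖v‖ = 1) :
      Filter.Tendsto (fun n => ∫ z, ω z * fderiv ℝ (χ n) z v) Filter.atTop (𝓝 0) := by
    have : (0 : ℂ) = ∫ z : ℂ, (0 : ℂ) := by simp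
    rw [this]
    refine tendsto_integral_of_dominated_convergence
      (fun z : ℂ => 6 * C * M * (1 + ‖z‖) ^ (-3 : ℝ))
      (fun n => (key n hω v).2.1.aestronglyMeasurable) (integrable_decay.const_mul _)
      (fun n => Filter.Eventually.of_forall fun z => ?_) (Filter.Eventually.of_forall fun z => ?_)
    · rw [norm_mul]
      exact (mul_le_mul (b z) (hDle' n z v hv) (norm_nonneg _) (by positivity)).trans (hdecay z)
    · rw [show (0 : ℂ) = ω z * 0 by simp]
      refine Filter.Tendsto.const_mul _ (squeeze_zero_norm (fun n => hDle n z v hv) ?_)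
      simpa using hcz.mul_const M
  have hsum (n : ℕ) : ∫ z, (fderiv ℝ ω₁ z 1 + fderiv ℝ ω₂ z Complex.I) * χ n z =
      -((∫ z, ω₁ z * fderiv ℝ (χ n) z 1) + ∫ z, ω₂ z * fderiv ℝ (χ n) z Complex.I) := by
    rw [(key n h₁ 1).2.2, (key n h₂ Complex.I).2.2, ← neg_add, neg_neg,
      ← integral_add (key n h₁ 1).1 (key n h₂ Complex.I).1]
    simp only [add_mul]
  have lim1 : Filter.Tendsto
      (fun n => ∫ z, (fderiv ℝ ω₁ z 1 + fderiv ℝ ω₂ z Complex.I) * χ n z) Filter.atTop (𝓝 0) := by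
    simp only [hsum]
    simpa using ((keylim h₁ b₁ 1 (by simp)).add (keylim h₂ b₂ Complex.I (by simp))).neg
  have lim2 : Filter.Tendsto
      (fun n => ∫ z, (fderiv ℝ ω₁ z 1 + fderiv ℝ ω₂ z Complex.I) * χ n z) Filter.atTop
      (𝓝 (∫ z, (fderiv ℝ ω₁ z 1 + fderiv ℝ ω₂ z Complex.I))) := by
    refine tendsto_integral_of_dominated_convergence
      (fun z => ‖fderiv ℝ ω₁ z 1 + fderiv ℝ ω₂ z Complex.I‖)
      (fun n => hd.aestronglyMeasurable.mul (hχ n).continuous.aestronglyMeasurable) hd.norm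
      (fun n => Filter.Eventually.of_forall fun z => ?_) (Filter.Eventually.of_forall fun z => ?_)
    · rw [norm_mul]
      exact mul_le_of_le_one_right (norm_nonneg _) (hFle _)
    · refine tendsto_const_nhds.congr' ?_
      have h1 : Filter.Tendsto (fun n => c n * ‖z‖) Filter.atTop (𝓝 0) := by
        simpa using hcz.mul_const ‖z‖
      filter_upwards [h1.eventually_lt_const one_pos] with n hn
      rw [show χ n z = 1 from hF1 _ (by rw [hnz]; exact hn.le), mul_one]
  exact tendsto_nhds_unique lim2 lim1

/-- The density of the spherical measure with respect to Lebesgue measure. -/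
noncomputable def sphereDensity (z : ℂ) : ℂ := ((1 + (‖z‖ : ℂ) ^ 2) ^ 2)⁻¹

theorem one_add_norm_sq_ne_zero (z : ℂ) : 1 + (‖z‖ : ℂ) ^ 2 ≠ 0 := by
  have : (0 : ℝ) < 1 + ‖z‖ ^ 2 := by positivity
  exact_mod_cast this.ne'

theorem norm_sphereDensity (z : ℂ) : ‖sphereDensity z‖ = ((1 + ‖z‖ ^ 2) ^ 2)⁻¹ := by
  have : sphereDensity z = (((1 + ‖z‖ ^ 2) ^ 2)⁻¹ : ℝ) := by
    simp [sphereDensity]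
  rw [this, Complex.norm_real, Real.norm_of_nonneg (by positivity)]

theorem continuous_sphereDensity : Continuous sphereDensity := by
  unfold sphereDensity
  refine Continuous.inv₀ (by fun_prop) fun z => pow_ne_zero 2 (one_add_norm_sq_ne_zero z)

theorem integrable_sphereDensity : Integrable sphereDensity := by
  refine (integrable_decay.const_mul 4).mono' continuous_sphereDensity.aestronglyMeasurable
    (Filter.Eventually.of_forall fun z => ?_)
  rw [norm_sphereDensity, decay_eq, ← div_eq_mul_inv, inv_eq_one_div,
    div_le_div_iff₀ (by positivity) (by positivity), one_mul]
  have h1 : (1 + ‖z‖) ^ 2 ≤ 2 * (1 + ‖z‖ ^ 2) := by nlinarith [sq_nonneg (1 - ‖z‖)]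
  have h2 : (1 + ‖z‖) ^ 4 ≤ (2 * (1 + ‖z‖ ^ 2)) ^ 2 := by
    rw [show (1 + ‖z‖) ^ 4 = ((1 + ‖z‖) ^ 2) ^ 2 by ring]
    gcongr
  have h3 : (1 + ‖z‖) ^ 3 ≤ (1 + ‖z‖) ^ 4 := pow_le_pow_right₀ (by simp) (by norm_num)
  nlinarith

theorem integrable_mul_sphereDensity {a : ℂ → ℂ} (ha : Continuous a) {C : ℝ}
    (hC : ∀ z, ‖a z‖ ≤ C) : Integrable fun z => a z * sphereDensity z :=
  integrable_sphereDensity.bdd_mul ha.aestronglyMeasurable (Filter.Eventually.of_forall hC)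

theorem lapSphere_mul_sphereDensity (a : ℂ → ℂ) (z : ℂ) :
    lapSphere a z * sphereDensity z = -4 * wirtZ (wirtZbar a) z := by
  have := one_add_norm_sq_ne_zero z
  simp only [lapSphere, sphereDensity]
  field_simp

theorem continuous_lapSphere {a : ℂ → ℂ} (ha : ContDiff ℝ 2 a) : Continuous (lapSphere a) := by
  have h : Continuous (fderiv ℝ (fderiv ℝ a)) :=
    (ha.fderiv_right (m := 1) (by norm_num)).continuous_fderiv (by norm_num)
  unfold lapSphere
  simp only [wirt_eq_fderiv ha]
  have h1 (v : ℂ) : Continuous fun z => fderiv ℝ (fderiv ℝ a) z v v :=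
    (h.clm_apply continuous_const).clm_apply continuous_const
  have h2 := h1 1
  have h3 := h1 Complex.I
  fun_prop

/-- Green's formula: the spherical Laplacian is symmetric. -/
theorem integral_lapSphere_mul {a h : ℂ → ℂ} (ha : ContDiff ℝ 2 a) (hh : ContDiff ℝ 2 h) {C : ℝ}
    (a0 : ∀ z, ‖a z‖ ≤ C) (a1 : ∀ z, ‖fderiv ℝ a z‖ ≤ C / (1 + ‖z‖ ^ 2))
    (h0 : ∀ z, ‖h z‖ ≤ C) (h1 : ∀ z, ‖fderiv ℝ h z‖ ≤ C / (1 + ‖z‖ ^ 2))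
    (a2 : ∀ z, ‖lapSphere a z‖ ≤ C) (h2 : ∀ z, ‖lapSphere h z‖ ≤ C) :
    ∫ z, lapSphere a z * h z * sphereDensity z = ∫ z, a z * lapSphere h z * sphereDensity z := by
  have hC : 0 ≤ C := (norm_nonneg _).trans (a0 0)
  let ω : ℂ → ℂ → ℂ := fun v z => h z * fderiv ℝ a z v - a z * fderiv ℝ h z v
  have D {g : ℂ → ℂ} (hg : ContDiff ℝ 2 g) (v : ℂ) : ContDiff ℝ 1 fun z => fderiv ℝ g z v :=
    (hg.fderiv_right (m := 1) (by norm_num)).clm_apply contDiff_const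
  have hω (v : ℂ) : ContDiff ℝ 1 (ω v) :=
    ((hh.of_le (by norm_num)).mul (D ha v)).sub ((ha.of_le (by norm_num)).mul (D hh v))
  have bω (v : ℂ) (hv : ‖v‖ = 1) (z : ℂ) : ‖ω v z‖ ≤ (2 * C * C) / (1 + ‖z‖ ^ 2) := by
    have e1 : ‖fderiv ℝ a z v‖ ≤ C / (1 + ‖z‖ ^ 2) := by
      simpa [hv] using (ContinuousLinearMap.le_opNorm _ v).trans
        (mul_le_mul_of_nonneg_right (a1 z) (norm_nonneg v))
    have e2 : ‖fderiv ℝ h z v‖ ≤ C / (1 + ‖z‖ ^ 2) := by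
      simpa [hv] using (ContinuousLinearMap.le_opNorm _ v).trans
        (mul_le_mul_of_nonneg_right (h1 z) (norm_nonneg v))
    refine (norm_sub_le _ _).trans ?_
    rw [norm_mul, norm_mul]
    have e3 := mul_le_mul (h0 z) e1 (norm_nonneg _) hC
    have e4 := mul_le_mul (a0 z) e2 (norm_nonneg _) hC
    refine (add_le_add e3 e4).trans (le_of_eq ?_)
    ring
  have hdω (v z : ℂ) : fderiv ℝ (ω v) z v =
      h z * fderiv ℝ (fderiv ℝ a) z v v - a z * fderiv ℝ (fderiv ℝ h) z v v := by
    have da := (ha.differentiable (by norm_num)) z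
    have dh := (hh.differentiable (by norm_num)) z
    have da' := ((D ha v).differentiable (by norm_num)) z
    have dh' := ((D hh v).differentiable (by norm_num)) z
    simp only [ω]
    rw [fderiv_fun_sub (dh.fun_mul da') (da.fun_mul dh'), fderiv_fun_mul dh da',
      fderiv_fun_mul da dh']
    simp only [_root_.sub_apply, _root_.add_apply, _root_.smul_apply, fderiv_fderiv_apply ha,
      fderiv_fderiv_apply hh, smul_eq_mul]
    ring
  have hdiv (z : ℂ) : fderiv ℝ (ω 1) z 1 + fderiv ℝ (ω Complex.I) z Complex.I =
      a z * lapSphere h z * sphereDensity z - lapSphere a z * h z * sphereDensity z := by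
    rw [hdω, hdω, mul_assoc (a z), lapSphere_mul_sphereDensity, mul_right_comm,
      lapSphere_mul_sphereDensity, wirt_eq_fderiv ha, wirt_eq_fderiv hh]
    ring
  have i1 : Integrable fun z => a z * lapSphere h z * sphereDensity z :=
    integrable_mul_sphereDensity (a := fun z => a z * lapSphere h z) (C := C * C)
      (ha.continuous.mul (continuous_lapSphere hh)) fun z => by
        rw [norm_mul]
        exact mul_le_mul (a0 z) (h2 z) (norm_nonneg _) hC
  have i2 : Integrable fun z => lapSphere a z * h z * sphereDensity z :=
    integrable_mul_sphereDensity (a := fun z => lapSphere a z * h z) (C := C * C)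
      ((continuous_lapSphere ha).mul hh.continuous) fun z => by
        rw [norm_mul]
        exact mul_le_mul (a2 z) (h0 z) (norm_nonneg _) hC
  have := integral_divergence_eq_zero (hω 1) (hω Complex.I) (bω 1 (by simp))
    (bω Complex.I (by simp)) (by simp only [hdiv]; exact i1.sub i2)
  simp only [hdiv] at this
  rw [integral_sub i1 i2, sub_eq_zero] at this
  exact this.symm

theorem inftyMap_inv {z : ℂ} (hz : z ≠ 0) : inftyMap z⁻¹ = (z : Sphere) := by
  rw [inftyMap, sphereInv_coe_of_ne (inv_ne_zero hz), inv_inv]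

/-- The first order bounds at infinity that smoothness in the chart `1 / z` provides. -/
theorem exists_bound_of_isC2Sphere {g : Sphere → ℂ} (hg : IsC2Sphere g) :
    ∃ C, ∀ z : ℂ, ‖g z‖ ≤ C ∧ ‖fderiv ℝ (fun u : ℂ => g u) z‖ ≤ C / (1 + ‖z‖ ^ 2) := by
  obtain ⟨ha, hb⟩ := hg
  have hK := isCompact_closedBall (0 : ℂ) 1
  obtain ⟨C1, h1⟩ := hK.exists_bound_of_continuousOn ha.continuous.continuousOn
  obtain ⟨C2, h2⟩ := hK.exists_bound_of_continuousOn hb.continuous.continuousOn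
  obtain ⟨C3, h3⟩ := hK.exists_bound_of_continuousOn
    (ha.continuous_fderiv (by norm_num)).continuousOn
  obtain ⟨C4, h4⟩ := hK.exists_bound_of_continuousOn
    (hb.continuous_fderiv (by norm_num)).continuousOn
  have p1 := (norm_nonneg _).trans (h1 0 (by simp))
  have p2 := (norm_nonneg _).trans (h2 0 (by simp))
  have p3 := (norm_nonneg _).trans (h3 0 (by simp))
  have p4 := (norm_nonneg _).trans (h4 0 (by simp))
  refine ⟨C1 + C2 + 2 * C3 + 2 * C4, fun z => ?_⟩
  by_cases hz : ‖z‖ ≤ 1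
  · have hz' : z ∈ Metric.closedBall (0 : ℂ) 1 := by simpa using hz
    refine ⟨(h1 z hz').trans (by linarith), (h3 z hz').trans ?_⟩
    rw [le_div_iff₀ (by positivity)]
    have := pow_le_one₀ (n := 2) (norm_nonneg z) hz
    nlinarith
  · push Not at hz
    have hz0 : z ≠ 0 := by
      rintro rfl
      simp at hz
      linarith
    have hz' : z⁻¹ ∈ Metric.closedBall (0 : ℂ) 1 := by
      simpa using inv_le_one_of_one_le₀ hz.le
    refine ⟨?_, ?_⟩
    · rw [← inftyMap_inv hz0]
      exact (h2 _ hz').trans (by linarith)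
    · have e : (fun u : ℂ => g u) =ᶠ[𝓝 z] fun u => (fun v => g (inftyMap v)) u⁻¹ := by
        filter_upwards [isOpen_ne.mem_nhds hz0] with u hu
        simp only [inftyMap_inv hu]
      have hinv := (hasDerivAt_inv hz0).hasFDerivAt.restrictScalars ℝ
      have hcomp := ((hb.differentiable (by norm_num)) z⁻¹).hasFDerivAt.comp z hinv
      rw [e.fderiv_eq]
      have hcomp' := hcomp.fderiv
      simp only [Function.comp_def] at hcomp'
      rw [hcomp']
      have hn : ‖(ContinuousLinearMap.toSpanSingleton ℂ (-(z ^ 2)⁻¹)).restrictScalars ℝ‖ ≤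
          (‖z‖ ^ 2)⁻¹ := by
        refine ContinuousLinearMap.opNorm_le_bound _ (by positivity) fun v => ?_
        simp
        rw [mul_comm]
      refine (ContinuousLinearMap.opNorm_comp_le _ _).trans
        ((mul_le_mul (h4 _ hz') hn (norm_nonneg _) p4).trans ?_)
      rw [← div_eq_mul_inv, div_le_div_iff₀ (by positivity) (by positivity)]
      have : 1 ≤ ‖z‖ ^ 2 := by nlinarith
      nlinarith

theorem continuous_of_isC2Sphere {g : Sphere → ℂ} (hg : IsC2Sphere g) : Continuous g := by
  rw [continuous_iff_continuousAt]
  intro z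
  induction z using OnePoint.rec with
  | infty =>
    rw [continuousAt_infty_iff]
    have h1 : Filter.Tendsto (fun z : ℂ => g (inftyMap z⁻¹)) (Bornology.cobounded ℂ)
        (𝓝 (g (inftyMap 0))) :=
      (hg.2.continuous.tendsto 0).comp Filter.tendsto_inv₀_cobounded
    have h2 : inftyMap 0 = OnePoint.infty := sphereInv_zero
    rw [h2] at h1
    refine h1.congr' ?_
    have : ∀ᶠ z : ℂ in Bornology.cobounded ℂ, z ≠ 0 := Bornology.eventually_ne_cobounded 0
    filter_upwards [this] with z hz
    rw [inftyMap_inv hz]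
  | coe z =>
    rw [OnePoint.continuousAt_coe]
    exact hg.1.continuous.continuousAt

/-! ### Test functions on the sphere -/

/-- The function `z^a conj(z)^b / (1 + |z|²)^n` on the Riemann sphere, for `a, b ≤ n`. -/
noncomputable def testFun (a b n : ℕ) : Sphere → ℂ
  | none => 0 ^ (n - a) * 0 ^ (n - b)
  | some z => z ^ a * (starRingEnd ℂ) z ^ b / (1 + z * (starRingEnd ℂ) z) ^ n

theorem testFun_coe (a b n : ℕ) (z : ℂ) : testFun a b n (z : Sphere) =
    z ^ a * (starRingEnd ℂ) z ^ b / (1 + z * (starRingEnd ℂ) z) ^ n := rfl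

theorem one_add_mul_conj_ne_zero (z : ℂ) : 1 + z * (starRingEnd ℂ) z ≠ 0 := by
  rw [← ofReal_norm_sq]
  exact one_add_norm_sq_ne_zero z

theorem testFun_inftyMap {a b n : ℕ} (ha : a ≤ n) (hb : b ≤ n) (z : ℂ) :
    testFun a b n (inftyMap z) = testFun (n - a) (n - b) n (z : Sphere) := by
  by_cases hz : z = 0
  · subst hz
    rw [testFun_coe, inftyMap, sphereInv_zero]
    change 0 ^ (n - a) * 0 ^ (n - b) = _
    simp
  · have hz' : (starRingEnd ℂ) z ≠ 0 := by simpa using hz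
    rw [inftyMap, sphereInv_coe_of_ne hz, testFun_coe, testFun_coe, map_inv₀]
    have h1 : 1 + z⁻¹ * ((starRingEnd ℂ) z)⁻¹ =
        (1 + z * (starRingEnd ℂ) z) * (z⁻¹ * ((starRingEnd ℂ) z)⁻¹) := by
      field_simp
      ring
    have h2 := one_add_mul_conj_ne_zero z
    rw [h1, pow_sub₀ _ hz ha, pow_sub₀ _ hz' hb, mul_pow, mul_pow]
    simp only [inv_pow]
    field_simp

theorem contDiff_testFun_coe (a b n : ℕ) : ContDiff ℝ 2 fun z : ℂ => testFun a b n z := by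
  simp only [testFun_coe, div_eq_mul_inv]
  have hc : ContDiff ℝ 2 fun z : ℂ => (starRingEnd ℂ) z :=
    (Complex.conjCLE : ℂ →L[ℝ] ℂ).contDiff
  exact ((contDiff_id.pow a).mul (hc.pow b)).mul
    (((contDiff_const.add (contDiff_id.mul hc)).pow n).inv
      fun z => pow_ne_zero n (one_add_mul_conj_ne_zero z))

theorem isC2Sphere_testFun {a b n : ℕ} (ha : a ≤ n) (hb : b ≤ n) : IsC2Sphere (testFun a b n) := by
  refine ⟨contDiff_testFun_coe a b n, ?_⟩
  simp only [testFun_inftyMap ha hb]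
  exact contDiff_testFun_coe _ _ _

/-- The reduction of the mixed test functions to the pure ones, from `|z|² = (1 + |z|²) - 1`. -/
theorem testFun_succ_succ (a b n : ℕ) (z : ℂ) :
    testFun (a + 1) (b + 1) (n + 1) z = testFun a b n z - testFun a b (n + 1) z := by
  have := one_add_mul_conj_ne_zero z
  simp only [testFun_coe]
  field_simp
  ring

/-- The invariant Laplacian is triangular on the functions `z^k (1 - z w)^(-n)`. -/
theorem lapZW_fst_pow_div (k n : ℕ) {p : ℂ × ℂ} (hp : p ∈ chartDomain) :
    lapZW (fun u => u.1 ^ k / (1 - u.1 * u.2) ^ n) p =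
      4 * n * (n + 1) * (p.1 ^ k / (1 - p.1 * p.2) ^ n) -
        4 * n * (n - k) * (p.1 ^ k / (1 - p.1 * p.2) ^ (n - 1)) := by
  have h0 := one_sub_ne_zero hp
  have hW : partialW (fun u => u.1 ^ k / (1 - u.1 * u.2) ^ n) =ᶠ[𝓝 p]
      fun u => n * u.1 ^ (k + 1) / (1 - u.1 * u.2) ^ (n + 1) := by
    filter_upwards [isOpen_chartDomain.mem_nhds hp] with u hu
    have hu0 := one_sub_ne_zero hu
    refine partialW_eq (by fun_prop (disch := exact pow_ne_zero n hu0)) ?_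
    refine ((hasDerivAt_const u.2 (u.1 ^ k)).fun_div
      ((((hasDerivAt_id' u.2).const_mul u.1).const_sub 1).fun_pow n)
      (pow_ne_zero n hu0)).congr_deriv ?_
    rcases n with _ | n
    · simp
    · simp only [Nat.add_one_sub_one]
      push_cast
      field_simp
      ring
  have hd : HasDerivAt (fun z => n * z ^ (k + 1) / (1 - z * p.2) ^ (n + 1))
      (n * (k + 1) * p.1 ^ k / (1 - p.1 * p.2) ^ (n + 1) +
        n * (n + 1) * p.1 ^ (k + 1) * p.2 / (1 - p.1 * p.2) ^ (n + 2)) p.1 := by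
    refine ((((hasDerivAt_id' p.1).fun_pow (k + 1)).const_mul (n : ℂ)).fun_div
      ((((hasDerivAt_id' p.1).mul_const p.2).const_sub 1).fun_pow (n + 1))
      (pow_ne_zero (n + 1) h0)).congr_deriv ?_
    simp only [Nat.add_one_sub_one]
    push_cast
    field_simp
    ring
  simp only [lapZW]
  rw [partialZ_congr hW,
    partialZ_eq (by fun_prop (disch := exact pow_ne_zero (n + 1) h0)) hd]
  rcases n with _ | n
  · simp
  · simp only [Nat.add_one_sub_one]
    push_cast
    field_simp
    ring

theorem lapZW_snd_pow_div (k n : ℕ) {p : ℂ × ℂ} (hp : p ∈ chartDomain) :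
    lapZW (fun u => u.2 ^ k / (1 - u.1 * u.2) ^ n) p =
      4 * n * (n + 1) * (p.2 ^ k / (1 - p.1 * p.2) ^ n) -
        4 * n * (n - k) * (p.2 ^ k / (1 - p.1 * p.2) ^ (n - 1)) := by
  have h0 := one_sub_ne_zero hp
  have hW : partialW (fun u => u.2 ^ k / (1 - u.1 * u.2) ^ n) =ᶠ[𝓝 p]
      fun u => k * u.2 ^ (k - 1) / (1 - u.1 * u.2) ^ n +
        n * u.1 * u.2 ^ k / (1 - u.1 * u.2) ^ (n + 1) := by
    filter_upwards [isOpen_chartDomain.mem_nhds hp] with u hu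
    have hu0 := one_sub_ne_zero hu
    refine partialW_eq (by fun_prop (disch := exact pow_ne_zero n hu0)) ?_
    refine (((hasDerivAt_id' u.2).fun_pow k).fun_div
      ((((hasDerivAt_id' u.2).const_mul u.1).const_sub 1).fun_pow n)
      (pow_ne_zero n hu0)).congr_deriv ?_
    rcases n with _ | n
    · simp
    · simp only [Nat.add_one_sub_one]
      push_cast
      field_simp
      ring
  have hd : HasDerivAt (fun z => k * p.2 ^ (k - 1) / (1 - z * p.2) ^ n +
        n * z * p.2 ^ k / (1 - z * p.2) ^ (n + 1))
      (k * n * p.2 ^ k / (1 - p.1 * p.2) ^ (n + 1) + n * p.2 ^ k / (1 - p.1 * p.2) ^ (n + 1) +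
        n * (n + 1) * p.1 * p.2 ^ (k + 1) / (1 - p.1 * p.2) ^ (n + 2)) p.1 := by
    have e1 := (hasDerivAt_const p.1 ((k : ℂ) * p.2 ^ (k - 1))).fun_div
      ((((hasDerivAt_id' p.1).mul_const p.2).const_sub 1).fun_pow n) (pow_ne_zero n h0)
    have e2 := (((hasDerivAt_id' p.1).const_mul (n : ℂ)).mul_const (p.2 ^ k)).fun_div
      ((((hasDerivAt_id' p.1).mul_const p.2).const_sub 1).fun_pow (n + 1))
      (pow_ne_zero (n + 1) h0)
    refine (e1.fun_add e2).congr_deriv ?_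
    rcases n with _ | n
    · simp
    · rcases k with _ | k
      · simp only [Nat.add_one_sub_one]
        push_cast
        field_simp
        ring
      · simp only [Nat.add_one_sub_one]
        push_cast
        field_simp
        ring
  simp only [lapZW]
  rw [partialZ_congr hW, partialZ_eq (DifferentiableAt.fun_add
    (by fun_prop (disch := exact pow_ne_zero n h0))
    (by fun_prop (disch := exact pow_ne_zero (n + 1) h0))) hd]
  rcases n with _ | n
  · simp
  · simp only [Nat.add_one_sub_one]
    push_cast
    field_simp
    ring

theorem lapSphere_testFun_fst (k n : ℕ) (z : ℂ) :
    lapSphere (fun u : ℂ => testFun k 0 n u) z =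
      4 * n * (n + 1) * testFun k 0 n z - 4 * n * (n - k) * testFun k 0 (n - 1) z := by
  have e (n : ℕ) (u : ℂ) : testFun k 0 n u =
      (fun p : ℂ × ℂ => p.1 ^ k / (1 - p.1 * p.2) ^ n) (slice (-1) u) := by
    simp [testFun_coe]
  have hp := slice_neg_one_mem z
  have han : AnalyticAt ℂ (fun p : ℂ × ℂ => p.1 ^ k / (1 - p.1 * p.2) ^ n) (slice (-1) z) :=
    (analyticAt_fst.pow k).div ((analyticAt_const.sub (analyticAt_fst.mul analyticAt_snd)).pow n)
      (pow_ne_zero n (one_sub_ne_zero hp))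
  simp only [e]
  exact (lapSphere_comp_slice han).trans (lapZW_fst_pow_div k n hp)

theorem lapSphere_testFun_snd (k n : ℕ) (z : ℂ) :
    lapSphere (fun u : ℂ => testFun 0 k n u) z =
      4 * n * (n + 1) * testFun 0 k n z - 4 * n * (n - k) * testFun 0 k (n - 1) z := by
  have e (n : ℕ) (u : ℂ) : testFun 0 k n u =
      (((-1) ^ k : ℂ) • fun p : ℂ × ℂ => p.2 ^ k / (1 - p.1 * p.2) ^ n) (slice (-1) u) := by
    simp only [testFun_coe, Pi.smul_apply, slice_apply, smul_eq_mul]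
    rw [← mul_div_assoc, ← mul_pow]
    simp
  have hp := slice_neg_one_mem z
  have han : AnalyticAt ℂ (fun p : ℂ × ℂ => p.2 ^ k / (1 - p.1 * p.2) ^ n) (slice (-1) z) :=
    (analyticAt_snd.pow k).div ((analyticAt_const.sub (analyticAt_fst.mul analyticAt_snd)).pow n)
      (pow_ne_zero n (one_sub_ne_zero hp))
  simp only [e]
  rw [lapSphere_comp_slice han.const_smul, lapZW_smul _ han, lapZW_snd_pow_div k n hp]
  simp only [Pi.smul_apply, smul_eq_mul]
  ring

/-! ### The pairing with test functions -/

/-- The bilinear pairing of functions on the sphere given by integration. -/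
noncomputable def spherePairing (g h : Sphere → ℂ) : ℂ :=
  ∫ z : ℂ, g z * h z * sphereDensity z

theorem exists_norm_le_of_continuous {g : Sphere → ℂ} (hg : Continuous g) :
    ∃ C, ∀ x, ‖g x‖ ≤ C := by
  obtain ⟨C, hC⟩ := isCompact_univ.exists_bound_of_continuousOn hg.continuousOn
  exact ⟨C, fun x => hC x trivial⟩

theorem integrable_pairing {g h : Sphere → ℂ} (hg : Continuous g) (hh : Continuous h) :
    Integrable fun z : ℂ => g z * h z * sphereDensity z := by
  obtain ⟨C, hC⟩ := exists_norm_le_of_continuous (hg.mul hh)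
  exact integrable_mul_sphereDensity (a := fun z : ℂ => g z * h z)
    ((hg.comp OnePoint.continuous_coe).mul (hh.comp OnePoint.continuous_coe)) fun z => hC z

theorem spherePairing_add_left {f g h : Sphere → ℂ} (hf : Continuous f) (hg : Continuous g)
    (hh : Continuous h) : spherePairing (f + g) h = spherePairing f h + spherePairing g h := by
  rw [spherePairing, spherePairing, spherePairing,
    ← integral_add (integrable_pairing hf hh) (integrable_pairing hg hh)]
  simp only [Pi.add_apply, add_mul]

theorem spherePairing_smul_left (c : ℂ) (g h : Sphere → ℂ) :
    spherePairing (c • g) h = c * spherePairing g h := by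
  rw [spherePairing, spherePairing, ← integral_const_mul]
  simp only [Pi.smul_apply, smul_eq_mul, mul_assoc]

theorem spherePairing_comm (g h : Sphere → ℂ) : spherePairing g h = spherePairing h g := by
  simp only [spherePairing, mul_comm]

/-- The eigenvalue equation on the sphere away from `∞`; together with `C²` smoothness at `∞` this
is all that the spectral argument uses. -/
def IsSphereEigen (lam : ℂ) (g : Sphere → ℂ) : Prop :=
  IsC2Sphere g ∧ ∀ z : ℂ, lapSphere (fun u : ℂ => g u) z = lam * g z

theorem IsSphereEigen.sub {lam : ℂ} {f g : Sphere → ℂ} (hf : IsSphereEigen lam f)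
    (hg : IsSphereEigen lam g) : IsSphereEigen lam (f - g) := by
  refine ⟨⟨hf.1.1.sub hg.1.1, hf.1.2.sub hg.1.2⟩, fun z => ?_⟩
  have e : (fun u : ℂ => (f - g) u) = (fun u : ℂ => f u) + (-1 : ℂ) • fun u : ℂ => g u := by
    funext u
    simp [sub_eq_add_neg]
  have h1 := hf.2 z
  have h2 := hg.2 z
  simp only [lapSphere] at h1 h2 ⊢
  have hg' : ContDiffAt ℝ 2 ((-1 : ℂ) • fun u : ℂ => g u) z :=
    (hg.1.1.contDiffAt).const_smul (-1 : ℂ)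
  rw [e, wirt_add hf.1.1.contDiffAt hg', wirt_smul _ hg.1.1.contDiffAt,
    Pi.sub_apply, mul_sub, ← h1, ← h2]
  ring

theorem spherePairing_lapSphere {lam : ℂ} {g h k : Sphere → ℂ} (hg : IsSphereEigen lam g)
    (hh : IsC2Sphere h) (hk : Continuous k)
    (hlap : ∀ z : ℂ, lapSphere (fun u : ℂ => h u) z = k z) :
    lam * spherePairing g h = spherePairing g k := by
  obtain ⟨C1, h1⟩ := exists_bound_of_isC2Sphere hg.1
  obtain ⟨C2, h2⟩ := exists_bound_of_isC2Sphere hh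
  obtain ⟨C3, h3⟩ := exists_norm_le_of_continuous hk
  have le1 : C1 ≤ max (max C1 C2) (max C3 (‖lam‖ * C1)) := by simp
  have le2 : C2 ≤ max (max C1 C2) (max C3 (‖lam‖ * C1)) := by simp
  have green := integral_lapSphere_mul hg.1.1 hh.1 (C := max (max C1 C2) (max C3 (‖lam‖ * C1)))
    (fun z => (h1 z).1.trans le1)
    (fun z => (h1 z).2.trans (div_le_div_of_nonneg_right le1 (by positivity)))
    (fun z => (h2 z).1.trans le2)
    (fun z => (h2 z).2.trans (div_le_div_of_nonneg_right le2 (by positivity)))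
    (fun z => by
      rw [hg.2, norm_mul]
      exact (mul_le_mul_of_nonneg_left (h1 z).1 (norm_nonneg _)).trans (by simp))
    (fun z => by
      rw [hlap]
      exact (h3 z).trans (by simp))
  simp only [hg.2, hlap] at green
  rw [spherePairing, spherePairing, ← green, ← integral_const_mul]
  simp only [mul_assoc]

theorem continuous_testFun {a b n : ℕ} (ha : a ≤ n) (hb : b ≤ n) : Continuous (testFun a b n) :=
  continuous_of_isC2Sphere (isC2Sphere_testFun ha hb)

theorem spherePairing_recursion {lam : ℂ} {g : Sphere → ℂ} (hg : IsSphereEigen lam g) (n : ℕ)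
    (k : ℕ) (t : ℕ → Sphere → ℂ) (ht : IsC2Sphere (t n)) (ht' : k < n → Continuous (t (n - 1)))
    (hk : k ≤ n) (hlap : ∀ z : ℂ, lapSphere (fun u : ℂ => t n u) z =
      4 * n * (n + 1) * t n z - 4 * n * (n - k) * t (n - 1) z) :
    (lam - 4 * n * (n + 1)) * spherePairing g (t n) =
      -(4 * n * (n - k)) * spherePairing g (t (n - 1)) := by
  have hgc := continuous_of_isC2Sphere hg.1
  have htc := continuous_of_isC2Sphere ht
  have key : lam * spherePairing g (t n) = spherePairing g
      ((4 * n * (n + 1) : ℂ) • t n + (-(4 * n * (n - k)) : ℂ) • t (n - 1)) ∧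
      spherePairing g ((4 * n * (n + 1) : ℂ) • t n + (-(4 * n * (n - k)) : ℂ) • t (n - 1)) =
        4 * n * (n + 1) * spherePairing g (t n) +
          -(4 * n * (n - k)) * spherePairing g (t (n - 1)) := by
    have hz (z : ℂ) : lapSphere (fun u : ℂ => t n u) z =
        ((4 * n * (n + 1) : ℂ) • t n + (-(4 * n * (n - k)) : ℂ) • t (n - 1)) z := by
      rw [hlap]
      simp [sub_eq_add_neg]
    rcases hk.lt_or_eq with hk | rfl
    · have hc := ht' hk
      refine ⟨spherePairing_lapSphere hg ht ((htc.const_smul _).add (hc.const_smul _)) hz, ?_⟩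
      rw [spherePairing_comm, spherePairing_add_left (htc.const_smul _) (hc.const_smul _) hgc,
        spherePairing_smul_left, spherePairing_smul_left, spherePairing_comm,
        spherePairing_comm g (t (n - 1))]
    · -- for `k = n` the lower order term is absent
      simp only [sub_self, mul_zero, neg_zero, zero_smul, add_zero, zero_mul] at hz ⊢
      refine ⟨spherePairing_lapSphere hg ht (htc.const_smul _) hz, ?_⟩
      rw [spherePairing_comm, spherePairing_smul_left, spherePairing_comm]
  linear_combination key.1.trans key.2

/-- If an eigenfunction pairs to zero with the finitely many test functions which belong to its
eigenvalue, then it pairs to zero with all test functions. -/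
theorem spherePairing_eq_zero_of_recursion {lam : ℂ} {g : Sphere → ℂ} (hg : IsSphereEigen lam g)
    (k : ℕ) (t : ℕ → Sphere → ℂ) (ht : ∀ n, k ≤ n → IsC2Sphere (t n))
    (hlap : ∀ (n : ℕ) (z : ℂ), lapSphere (fun u : ℂ => t n u) z =
      4 * n * (n + 1) * t n z - 4 * n * (n - k) * t (n - 1) z)
    (h0 : ∀ n : ℕ, lam = 4 * n * (n + 1) → k ≤ n → spherePairing g (t n) = 0) (n : ℕ)
    (hn : k ≤ n) : spherePairing g (t n) = 0 := by
  induction n, hn using Nat.le_induction with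
  | base =>
    by_cases hl : lam = 4 * k * (k + 1)
    · exact h0 k hl le_rfl
    · have := spherePairing_recursion hg k k t (ht k le_rfl) (fun h => absurd h (lt_irrefl k)) le_rfl
        (hlap k)
      rw [sub_self, mul_zero, neg_zero, zero_mul] at this
      exact (mul_eq_zero.1 this).resolve_left (sub_ne_zero.2 hl)
  | succ n hn ih =>
    by_cases hl : lam = 4 * (n + 1 : ℕ) * ((n + 1 : ℕ) + 1)
    · exact h0 (n + 1) hl (by omega)
    · have := spherePairing_recursion hg (n + 1) k t (ht _ (by omega))
        (fun _ => continuous_of_isC2Sphere (ht n hn)) (by omega) (hlap (n + 1))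
      rw [Nat.add_one_sub_one, ih, mul_zero] at this
      exact (mul_eq_zero.1 this).resolve_left (sub_ne_zero.2 hl)

theorem spherePairing_testFun_eq_zero {g : Sphere → ℂ} (hg : Continuous g)
    (h1 : ∀ k n, k ≤ n → spherePairing g (testFun k 0 n) = 0)
    (h2 : ∀ k n, k ≤ n → spherePairing g (testFun 0 k n) = 0) (a b n : ℕ) (ha : a ≤ n)
    (hb : b ≤ n) : spherePairing g (testFun a b n) = 0 := by
  induction a generalizing b n with
  | zero => exact h2 b n hb
  | succ a ih =>
    cases b with
    | zero => exact h1 _ n ha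
    | succ b =>
      cases n with
      | zero => omega
      | succ n =>
        have e : spherePairing g (testFun (a + 1) (b + 1) (n + 1)) =
            spherePairing g (testFun a b n) - spherePairing g (testFun a b (n + 1)) := by
          rw [spherePairing, spherePairing, spherePairing, ← integral_sub
            (integrable_pairing hg (continuous_testFun (by omega) (by omega)))
            (integrable_pairing hg (continuous_testFun (by omega) (by omega)))]
          simp only [testFun_succ_succ, mul_sub, sub_mul]
        rw [e, ih b n (by omega) (by omega), ih b (n + 1) (by omega) (by omega), sub_zero]

/-- The test functions as elements of the algebra of continuous functions. -/
noncomputable def testMap (i : {i : ℕ × ℕ × ℕ // i.1 ≤ i.2.2 ∧ i.2.1 ≤ i.2.2}) : C(Sphere, ℂ) :=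
  ⟨testFun i.1.1 i.1.2.1 i.1.2.2, continuous_testFun i.2.1 i.2.2⟩

theorem testFun_infty_mul {a b n a' b' n' : ℕ} (ha : a ≤ n) (hb : b ≤ n) (ha' : a' ≤ n')
    (hb' : b' ≤ n') : testFun a b n OnePoint.infty * testFun a' b' n' OnePoint.infty =
      testFun (a + a') (b + b') (n + n') OnePoint.infty := by
  change (0 : ℂ) ^ (n - a) * 0 ^ (n - b) * (0 ^ (n' - a') * 0 ^ (n' - b')) =
    0 ^ (n + n' - (a + a')) * 0 ^ (n + n' - (b + b'))
  rw [show n + n' - (a + a') = (n - a) + (n' - a') by omega,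
    show n + n' - (b + b') = (n - b) + (n' - b') by omega, pow_add, pow_add]
  ring

theorem closure_range_testMap :
    ((Submonoid.closure (Set.range testMap ∪ star (Set.range testMap)) : Submonoid C(Sphere, ℂ)) :
      Set C(Sphere, ℂ)) ⊆ Set.range testMap := by
  intro f hf
  induction hf using Submonoid.closure_induction with
  | mem f hf =>
    rcases hf with hf | hf
    · exact hf
    · obtain ⟨i, hi⟩ := hf
      refine ⟨⟨(i.1.2.1, i.1.1, i.1.2.2), i.2.2, i.2.1⟩, ?_⟩
      rw [← star_star f, ← hi]
      ext x
      change testFun i.1.2.1 i.1.1 i.1.2.2 x = (starRingEnd ℂ) (testFun i.1.1 i.1.2.1 i.1.2.2 x)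
      induction x using OnePoint.rec with
      | infty =>
        change (0 : ℂ) ^ (i.1.2.2 - i.1.2.1) * 0 ^ (i.1.2.2 - i.1.1) =
          (starRingEnd ℂ) (0 ^ (i.1.2.2 - i.1.1) * 0 ^ (i.1.2.2 - i.1.2.1))
        simp [mul_comm]
      | coe z =>
        simp only [testFun_coe, map_div₀, map_mul, map_pow, map_add, map_one, Complex.conj_conj]
        rw [mul_comm (z ^ _), mul_comm z]
  | one =>
    refine ⟨⟨(0, 0, 0), le_rfl, le_rfl⟩, ?_⟩
    ext x
    change testFun 0 0 0 x = 1
    induction x using OnePoint.rec with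
    | infty =>
      change (0 : ℂ) ^ 0 * 0 ^ 0 = 1
      simp
    | coe z => simp [testFun_coe]
  | mul f g _ _ hf hg =>
    obtain ⟨i, rfl⟩ := hf
    obtain ⟨j, rfl⟩ := hg
    refine ⟨⟨(i.1.1 + j.1.1, i.1.2.1 + j.1.2.1, i.1.2.2 + j.1.2.2), add_le_add i.2.1 j.2.1,
      add_le_add i.2.2 j.2.2⟩, ?_⟩
    ext x
    change testFun _ _ _ x = testFun _ _ _ x * testFun _ _ _ x
    induction x using OnePoint.rec with
    | infty => exact (testFun_infty_mul i.2.1 i.2.2 j.2.1 j.2.2).symm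
    | coe z =>
      simp only [testFun_coe, pow_add]
      rw [div_mul_div_comm]
      ring

theorem separatesPoints_testMap :
    (StarAlgebra.adjoin ℂ (Set.range testMap)).SeparatesPoints := by
  have hmem (i) : testMap i ∈ StarAlgebra.adjoin ℂ (Set.range testMap) :=
    StarAlgebra.subset_adjoin ℂ _ ⟨i, rfl⟩
  intro x y hxy
  by_contra! hne
  have h0 : testFun 0 0 1 x = testFun 0 0 1 y :=
    hne _ ⟨_, hmem ⟨(0, 0, 1), by simp⟩, rfl⟩
  have h1 : testFun 1 0 1 x = testFun 1 0 1 y :=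
    hne _ ⟨_, hmem ⟨(1, 0, 1), by simp⟩, rfl⟩
  have hinf : testFun 0 0 1 OnePoint.infty = 0 := by
    change (0 : ℂ) ^ (1 - 0) * 0 ^ (1 - 0) = 0
    simp
  have hcoe (z : ℂ) : testFun 0 0 1 (z : Sphere) ≠ 0 := by
    simpa [testFun_coe] using one_add_mul_conj_ne_zero z
  induction x using OnePoint.rec with
  | infty =>
    induction y using OnePoint.rec with
    | infty => exact hxy rfl
    | coe w => exact hcoe w (h0.symm.trans hinf)
  | coe z =>
    induction y using OnePoint.rec with
    | infty => exact hcoe z (h0.trans hinf)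
    | coe w =>
      have e (u : ℂ) : testFun 1 0 1 (u : Sphere) = u * testFun 0 0 1 (u : Sphere) := by
        simp [testFun_coe, div_eq_mul_inv]
      rw [e, e, h0] at h1
      exact hxy (congrArg _ (mul_right_cancel₀ (hcoe w) h1))

/-- By the Stone–Weierstrass theorem, the test functions are total. -/
theorem eq_zero_of_spherePairing {g : Sphere → ℂ} (hg : Continuous g)
    (h : ∀ a b n, a ≤ n → b ≤ n → spherePairing g (testFun a b n) = 0) : g = 0 := by
  obtain ⟨C, hC⟩ := exists_norm_le_of_continuous hg
  let ℓ : C(Sphere, ℂ) →ₗ[ℂ] ℂ :=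
    { toFun := fun f => spherePairing g f
      map_add' := fun f₁ f₂ => by
        rw [spherePairing_comm, spherePairing_comm g, spherePairing_comm g]
        exact spherePairing_add_left f₁.continuous f₂.continuous hg
      map_smul' := fun c f => by
        rw [spherePairing_comm, spherePairing_comm g]
        exact spherePairing_smul_left c _ _ }
  let L : C(Sphere, ℂ) →L[ℂ] ℂ := ℓ.mkContinuous (∫ z : ℂ, C * ‖sphereDensity z‖) fun f => by
    rw [← integral_mul_const]
    refine norm_integral_le_of_norm_le ((integrable_sphereDensity.norm.const_mul C).mul_const _)
      (Filter.Eventually.of_forall fun z => ?_)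
    rw [norm_mul, norm_mul, mul_right_comm]
    have hC0 : 0 ≤ C := (norm_nonneg _).trans (hC OnePoint.infty)
    exact mul_le_mul (mul_le_mul_of_nonneg_right (hC z) (norm_nonneg _)) (f.norm_coe_le_norm z)
      (norm_nonneg _) (by positivity)
  have hL0 : ∀ f ∈ StarAlgebra.adjoin ℂ (Set.range testMap), L f = 0 := by
    intro f hf
    have hf' : f ∈ Submodule.span ℂ (Set.range testMap) := by
      have h1 : f ∈ Subalgebra.toSubmodule
          (StarAlgebra.adjoin ℂ (Set.range testMap)).toSubalgebra := hf
      rw [StarAlgebra.adjoin_eq_span] at h1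
      exact Submodule.span_mono closure_range_testMap h1
    have h2 : Submodule.span ℂ (Set.range testMap) ≤ LinearMap.ker ℓ := by
      rw [Submodule.span_le]
      rintro _ ⟨i, rfl⟩
      exact h _ _ _ i.2.1 i.2.2
    exact h2 hf'
  have hL (f : C(Sphere, ℂ)) : L f = 0 := by
    have hf : f ∈ (StarAlgebra.adjoin ℂ (Set.range testMap)).topologicalClosure := by
      rw [ContinuousMap.starSubalgebra_topologicalClosure_eq_top_of_separatesPoints _
        separatesPoints_testMap]
      trivial
    have hcl : IsClosed {f | L f = 0} := isClosed_eq L.continuous continuous_const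
    exact closure_minimal (fun f hf => hL0 f hf) hcl hf
  -- pair `g` with its complex conjugate
  have h1 := hL ⟨fun x => (starRingEnd ℂ) (g x), Complex.continuous_conj.comp hg⟩
  have h2 : ∫ z : ℂ, ‖g z‖ ^ 2 * ((1 + ‖z‖ ^ 2) ^ 2)⁻¹ = 0 := by
    have h3 : ∫ z : ℂ, ((‖g z‖ ^ 2 * ((1 + ‖z‖ ^ 2) ^ 2)⁻¹ : ℝ) : ℂ) = 0 := by
      rw [← h1]
      refine integral_congr_ae (Filter.Eventually.of_forall fun z => ?_)
      simp only [ContinuousMap.coe_mk, Complex.mul_conj', sphereDensity]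
      push_cast
      rfl
    rw [integral_complex_ofReal] at h3
    exact_mod_cast h3
  have hgc : Continuous fun z : ℂ => g z := hg.comp OnePoint.continuous_coe
  have hint : Integrable fun z : ℂ => ‖g z‖ ^ 2 * ((1 + ‖z‖ ^ 2) ^ 2)⁻¹ := by
    have := (integrable_pairing hg (Complex.continuous_conj.comp hg)).norm
    refine this.congr (Filter.Eventually.of_forall fun z => ?_)
    simp only [norm_mul, norm_sphereDensity, Function.comp_apply, RCLike.norm_conj]
    ring
  rw [integral_eq_zero_iff_of_nonneg (fun z => by positivity) hint,
    Continuous.ae_eq_iff_eq volume ?_ continuous_zero] at h2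
  · have h3 (z : ℂ) : g z = 0 := by
      have := congrFun h2 z
      have h4 : ((1 + ‖z‖ ^ 2) ^ 2)⁻¹ ≠ 0 := by positivity
      simpa [h4] using (mul_eq_zero.1 this).resolve_right h4
    funext x
    have hd : DenseRange ((↑) : ℂ → Sphere) := OnePoint.denseRange_coe
    exact congrFun (hd.equalizer hg continuous_const (funext h3)) x
  · exact (hgc.norm.pow 2).mul (Continuous.inv₀ (by fun_prop) fun z => by positivity)

theorem IsSphereEigen.eq_zero {lam : ℂ} {g : Sphere → ℂ} (hg : IsSphereEigen lam g)
    (h : ∀ m : ℕ, lam = 4 * m * (m + 1) → ∀ k ≤ m,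
      spherePairing g (testFun k 0 m) = 0 ∧ spherePairing g (testFun 0 k m) = 0) : g = 0 := by
  refine eq_zero_of_spherePairing (continuous_of_isC2Sphere hg.1)
    (spherePairing_testFun_eq_zero (continuous_of_isC2Sphere hg.1) (fun k n hk => ?_)
      fun k n hk => ?_)
  · exact spherePairing_eq_zero_of_recursion hg k (fun n => testFun k 0 n)
      (fun n hn => isC2Sphere_testFun hn (Nat.zero_le _)) (fun n z => lapSphere_testFun_fst k n z)
      (fun n hn hk => (h n hn k hk).1) n hk
  · exact spherePairing_eq_zero_of_recursion hg k (fun n => testFun 0 k n)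
      (fun n hn => isC2Sphere_testFun (Nat.zero_le _) hn) (fun n z => lapSphere_testFun_snd k n z)
      (fun n hn hk => (h n hn k hk).2) n hk

theorem IsSphereEigen.exists_nat {lam : ℂ} {g : Sphere → ℂ} (hg : IsSphereEigen lam g)
    (h0 : g ≠ 0) : ∃ m : ℕ, lam = 4 * m * (m + 1) := by
  by_contra! hne
  exact h0 (hg.eq_zero fun m hm => absurd hm (hne m))

/-! ### The eigenspaces on `Ω` and on the sphere -/

theorem isSphereEigen_restrictSph {lam : ℂ} {F : Omega → ℂ} (hF : F ∈ eigenspace lam Omega) :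
    IsSphereEigen lam (restrictSph F) := by
  refine ⟨isC2Sphere_restrictSph hF.1, fun z => ?_⟩
  rw [lapSphere_restrictSph hF.1, restrictSph_coe]
  exact hF.2.1 _ (stdMap_mem_Omega.2 (slice_neg_one_mem z))

theorem isSphereEigen_of_mem {lam : ℂ} {g : Sphere → ℂ} (hg : g ∈ sphereEigenspace lam) :
    IsSphereEigen lam g := ⟨hg.1, hg.2.1⟩

theorem eigenvalue_injective {m n : ℕ} (h : (4 * m * (m + 1) : ℂ) = 4 * n * (n + 1)) : m = n := by
  have h' : 4 * m * (m + 1) = 4 * n * (n + 1) := by exact_mod_cast h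
  rcases lt_trichotomy m n with h1 | h1 | h1
  · nlinarith
  · exact h1
  · nlinarith

/-- An enumeration of the `2 m + 1` test functions `testFun k 0 m` and `testFun 0 k m`, `k ≤ m`. -/
noncomputable def extremalTest (m : ℕ) (i : Fin (2 * m + 1)) : Sphere → ℂ :=
  if (i : ℕ) ≤ m then testFun i 0 m else testFun 0 (i - m) m

theorem continuous_extremalTest (m : ℕ) (i : Fin (2 * m + 1)) : Continuous (extremalTest m i) := by
  unfold extremalTest
  split_ifs with h
  · exact continuous_testFun h (Nat.zero_le _)
  · exact continuous_testFun (Nat.zero_le _) (by omega)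

theorem IsSphereEigen.eq_zero_of_extremalTest {m : ℕ} {g : Sphere → ℂ}
    (hg : IsSphereEigen (4 * m * (m + 1)) g)
    (h : ∀ i, spherePairing g (extremalTest m i) = 0) : g = 0 := by
  have h1 (k : ℕ) (hk : k ≤ m) : spherePairing g (testFun k 0 m) = 0 := by
    have := h ⟨k, by omega⟩
    rwa [extremalTest, if_pos hk] at this
  refine hg.eq_zero fun n hn k hk => ?_
  obtain rfl := eigenvalue_injective hn
  refine ⟨h1 k hk, ?_⟩
  rcases Nat.eq_zero_or_pos k with rfl | hk0
  · exact h1 0 hk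
  · have := h ⟨m + k, by omega⟩
    rwa [extremalTest, if_neg (by simp only; omega), Nat.add_sub_cancel_left] at this

/-- The coordinates of an eigenfunction given by its pairings with the extremal test functions. -/
noncomputable def extremalPairing (m : ℕ) :
    eigenspace (4 * m * (m + 1)) Omega →ₗ[ℂ] (Fin (2 * m + 1) → ℂ) where
  toFun F i := spherePairing (restrictSph F) (extremalTest m i)
  map_add' F G := by
    funext i
    exact spherePairing_add_left (continuous_of_isC2Sphere (isC2Sphere_restrictSph F.2.1))
      (continuous_of_isC2Sphere (isC2Sphere_restrictSph G.2.1)) (continuous_extremalTest m i)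
  map_smul' c F := by
    funext i
    exact spherePairing_smul_left c _ _

theorem extremalPairing_injective (m : ℕ) : Function.Injective (extremalPairing m) := by
  rw [← LinearMap.ker_eq_bot, LinearMap.ker_eq_bot']
  intro F hF
  have h1 : restrictSph (F : Omega → ℂ) = restrictSph 0 := by
    rw [map_zero]
    exact (isSphereEigen_restrictSph F.2).eq_zero_of_extremalTest fun i => congrFun hF i
  exact Subtype.ext (eq_of_restrictSph_eq F.2.1 (eigenspace (4 * m * (m + 1)) Omega).zero_mem.1 h1)

theorem finiteDimensional_eigenspace (m : ℕ) :
    FiniteDimensional ℂ (eigenspace (4 * m * (m + 1)) Omega) :=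
  FiniteDimensional.of_injective _ (extremalPairing_injective m)

theorem finrank_eigenspace (m : ℕ) :
    Module.finrank ℂ (eigenspace (4 * m * (m + 1)) Omega) = 2 * m + 1 := by
  have := finiteDimensional_eigenspace m
  apply le_antisymm
  · simpa using LinearMap.finrank_le_finrank_of_injective (extremalPairing_injective m)
  · have h1 := linearIndependent_kernel m (t := fun i => ((i : ℕ) : ℂ))
      (fun i j h => Fin.ext (by simpa using h))
    have h2 : LinearIndependent ℂ fun i : Fin (2 * m + 1) =>
        (⟨kernel m 1 (-((i : ℕ) : ℂ)), kernel_mem m _ _⟩ : eigenspace (4 * m * (m + 1)) Omega) :=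
      LinearIndependent.of_comp (Submodule.subtype _) h1
    simpa using h2.fintype_card_le_finrank

theorem span_kernel (m : ℕ) {t : Fin (2 * m + 1) → ℂ} (ht : Function.Injective t) :
    Submodule.span ℂ (Set.range fun i => kernel m 1 (-t i)) = eigenspace (4 * m * (m + 1)) Omega := by
  have := finiteDimensional_eigenspace m
  apply Submodule.eq_of_le_of_finrank_eq
  · rw [Submodule.span_le]
    rintro _ ⟨i, rfl⟩
    exact kernel_mem m _ _
  · rw [finrank_span_eq_card (linearIndependent_kernel m ht), finrank_eigenspace]
    simp

theorem sphereEigenspace_eq (m : ℕ) :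
    sphereEigenspace (4 * m * (m + 1)) = (eigenspace (4 * m * (m + 1)) Omega).map restrictSph := by
  have := finiteDimensional_eigenspace m
  apply le_antisymm
  · intro g hg
    have hg' := isSphereEigen_of_mem hg
    have hsurj : Function.Surjective (extremalPairing m) :=
      (LinearMap.injective_iff_surjective_of_finrank_eq_finrank
        (by rw [finrank_eigenspace]; simp)).1 (extremalPairing_injective m)
    obtain ⟨F, hF⟩ := hsurj fun i => spherePairing g (extremalTest m i)
    have hF' := isSphereEigen_restrictSph F.2
    refine ⟨F, F.2, (sub_eq_zero.1 ((hg'.sub hF').eq_zero_of_extremalTest fun i => ?_)).symm⟩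
    have e : g - restrictSph (F : Omega → ℂ) = g + (-1 : ℂ) • restrictSph (F : Omega → ℂ) := by
      rw [neg_one_smul, sub_eq_add_neg]
    rw [e, spherePairing_add_left (continuous_of_isC2Sphere hg.1)
      ((continuous_of_isC2Sphere hF'.1).const_smul _) (continuous_extremalTest m i),
      spherePairing_smul_left, ← congrFun hF i]
    change _ + -1 * spherePairing (restrictSph F) (extremalTest m i) = 0
    change spherePairing (restrictSph F) (extremalTest m i) + _ = 0
    ring
  · rw [← span_kernel m (t := fun i => ((i : ℕ) : ℂ)) (fun i j h => Fin.ext (by simpa using h)),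
      Submodule.map_span, Submodule.span_le]
    rintro _ ⟨_, ⟨i, rfl⟩, rfl⟩
    exact restrictSph_kernel_mem m _ _

theorem hasHoloExtension_Omega_iff {F : bidisk → ℂ} :
    HasHoloExtension F Omega ↔ ∃ G : Omega → ℂ, IsHolo G ∧ restrictBidisk G = F :=
  ⟨fun ⟨_, G, hG, h⟩ => ⟨G, hG, h.symm⟩, fun ⟨G, hG, h⟩ => ⟨bidisk_subset_Omega, G, hG, h.symm⟩⟩

theorem exists_nat_of_extension {lam : ℂ} {F : bidisk → ℂ} (hF : F ∈ eigenspace lam bidisk)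
    (h0 : F ≠ 0) (hext : HasHoloExtension F Omega) : ∃ m : ℕ, lam = 4 * m * (m + 1) := by
  obtain ⟨G, hG, rfl⟩ := hasHoloExtension_Omega_iff.1 hext
  have hS : IsSphereEigen lam (restrictSph G) := by
    refine ⟨isC2Sphere_restrictSph hG, fun z => ?_⟩
    rw [lapSphere_restrictSph hG, restrictSph_coe,
      lapZW_stdMap_of_restrictBidisk hG hF (slice_neg_one_mem z)]
  refine hS.exists_nat fun h => h0 ?_
  rw [eq_of_restrictSph_eq hG (eigenspace lam Omega).zero_mem.1 (h.trans (map_zero _).symm),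
    map_zero]

theorem hasHoloExtension_restrictBidisk {lam : ℂ} {G : Omega → ℂ} (hG : G ∈ eigenspace lam Omega) :
    HasHoloExtension (restrictBidisk G) Omega :=
  hasHoloExtension_Omega_iff.2 ⟨G, hG.1, rfl⟩

theorem kernel_ne_zero (m : ℕ) : kernel m 1 1 ≠ 0 := by
  intro h
  have h1 := kernel_stdMap m 1 1 zero_mem_chartDomain
  rw [h, extendZero_zero] at h1
  simp [poisson] at h1

theorem restrictSph_kernel_ne_zero (m : ℕ) : restrictSph (kernel m 1 1) ≠ 0 := fun h =>
  kernel_ne_zero m (eq_of_restrictSph_eq (kernel_mem m 1 1).1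
    (eigenspace (4 * m * (m + 1)) Omega).zero_mem.1 (h.trans (map_zero _).symm))

theorem restrictBidisk_kernel_ne_zero (m : ℕ) : restrictBidisk (kernel m 1 1) ≠ 0 := fun h =>
  kernel_ne_zero m (eq_of_restrictBidisk_eq (kernel_mem m 1 1).1
    (eigenspace (4 * m * (m + 1)) Omega).zero_mem.1 (h.trans (map_zero _).symm))

theorem tfae_eigenvalue (lam : ℂ) :
    List.TFAE [
      ∃ F ∈ eigenspace lam bidisk, F ≠ 0 ∧ IsMaximalDomainOfExistence F Omega,
      ∃ g ∈ sphereEigenspace lam, g ≠ 0,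
      ∃ m : ℕ, lam = 4 * m * (m + 1)] := by
  tfae_have 1 → 3 := fun ⟨F, hF, h0, hmax⟩ => exists_nat_of_extension hF h0 hmax.2.2.2.1
  tfae_have 2 → 3 := fun ⟨g, hg, h0⟩ => (isSphereEigen_of_mem hg).exists_nat h0
  tfae_have 3 → 2 := by
    rintro ⟨m, rfl⟩
    exact ⟨_, restrictSph_kernel_mem m 1 1, restrictSph_kernel_ne_zero m⟩
  tfae_have 3 → 1 := by
    rintro ⟨m, rfl⟩
    exact ⟨_, restrictBidisk_mem (kernel_mem m 1 1), restrictBidisk_kernel_ne_zero m,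
      (isMaximalDomain_iff (hasHoloExtension_restrictBidisk (kernel_mem m 1 1)) _).2 rfl⟩
  tfae_finish

/-- The space of the restrictions to the disk of the eigenfunctions on `Ω`. -/
noncomputable def hypSpace (lam : ℂ) : Submodule ℂ (disk → ℂ) :=
  ((eigenspace lam Omega).map restrictBidisk).map restrictHyp

theorem mem_hypSpace {lam : ℂ} {f : disk → ℂ} :
    f ∈ hypSpace lam ↔ ∃ G ∈ eigenspace lam Omega, restrictHyp (restrictBidisk G) = f := by
  simp [hypSpace]

theorem hasHoloExtension_of_restrictHyp_mem {lam : ℂ} {F : bidisk → ℂ}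
    (hF : F ∈ eigenspace lam bidisk) (h : restrictHyp F ∈ hypSpace lam) :
    HasHoloExtension F Omega := by
  obtain ⟨G, hG, h⟩ := mem_hypSpace.1 h
  rw [← eq_of_restrictHyp_eq (restrictBidisk_mem hG).1 hF.1 h]
  exact hasHoloExtension_restrictBidisk hG

theorem finrank_hypSpace (m : ℕ) : Module.finrank ℂ (hypSpace (4 * m * (m + 1))) = 2 * m + 1 := by
  rw [← finrank_eigenspace m, hypSpace, ← Submodule.map_comp]
  refine (LinearEquiv.finrank_eq (LinearEquiv.ofBijective
    (LinearMap.submoduleMap (restrictHyp.comp restrictBidisk) (eigenspace (4 * m * (m + 1)) Omega))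
    ⟨?_, LinearMap.submoduleMap_surjective _ _⟩)).symm
  intro F G h
  have h1 : restrictHyp (restrictBidisk (F : Omega → ℂ)) = restrictHyp (restrictBidisk G) :=
    congrArg Subtype.val h
  exact Subtype.ext (eq_of_restrictBidisk_eq F.2.1 G.2.1
    (eq_of_restrictHyp_eq (restrictBidisk_mem F.2).1 (restrictBidisk_mem G.2).1 h1))

theorem hypSpace_le (lam : ℂ) : hypSpace lam ≤ diskEigenspace lam := by
  intro f hf
  obtain ⟨G, hG, rfl⟩ := mem_hypSpace.1 hf
  exact restrictHyp_mem (restrictBidisk_mem hG)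

/-- The restriction of the kernel to the disk. -/
noncomputable def diskKernel (m : ℕ) (s t : ℂ) : disk → ℂ :=
  restrictHyp (restrictBidisk (kernel m s t))

theorem diskKernel_apply (m : ℕ) (s t : ℂ) (z : disk) :
    diskKernel m s t z = poisson s t (z, (starRingEnd ℂ) (z : ℂ)) ^ m := rfl

theorem diskKernel_mem (m : ℕ) (s t : ℂ) : diskKernel m s t ∈ hypSpace (4 * m * (m + 1)) :=
  mem_hypSpace.2 ⟨_, kernel_mem m s t, rfl⟩

theorem span_diskKernel (m : ℕ) {t : Fin (2 * m + 1) → ℂ} (ht : Function.Injective t) :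
    Submodule.span ℂ (Set.range fun i => diskKernel m 1 (-t i)) = hypSpace (4 * m * (m + 1)) := by
  rw [hypSpace, ← span_kernel m ht, Submodule.map_span, Submodule.map_span, ← Set.range_comp,
    ← Set.range_comp]
  rfl

end

/-! ### Conformal automorphisms of the disk -/

/-- The Möbius transformation `z ↦ c (z - a) / (1 - conj a z)`. -/
noncomputable def moebius (c a z : ℂ) : ℂ := c * (z - a) / (1 - (starRingEnd ℂ) a * z)

theorem one_sub_conj_mul_ne_zero {a z : ℂ} (ha : ‖a‖ < 1) (hz : ‖z‖ < 1) :
    1 - (starRingEnd ℂ) a * z ≠ 0 := by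
  intro h
  have h1 : ‖(starRingEnd ℂ) a * z‖ = 1 := by rw [← sub_eq_zero.1 h, norm_one]
  rw [norm_mul, RCLike.norm_conj] at h1
  nlinarith [norm_nonneg a, norm_nonneg z]

theorem norm_moebius_lt {c a z : ℂ} (hc : ‖c‖ = 1) (ha : ‖a‖ < 1) (hz : ‖z‖ < 1) :
    ‖moebius c a z‖ < 1 := by
  have h0 := one_sub_conj_mul_ne_zero ha hz
  rw [moebius, norm_div, norm_mul, hc, one_mul, div_lt_one (norm_pos_iff.2 h0)]
  have h1 : ‖1 - (starRingEnd ℂ) a * z‖ ^ 2 - ‖z - a‖ ^ 2 = (1 - ‖a‖ ^ 2) * (1 - ‖z‖ ^ 2) := by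
    have : ((‖1 - (starRingEnd ℂ) a * z‖ ^ 2 - ‖z - a‖ ^ 2 : ℝ) : ℂ) =
        (((1 - ‖a‖ ^ 2) * (1 - ‖z‖ ^ 2) : ℝ) : ℂ) := by
      push_cast
      simp only [ofReal_norm_sq, map_sub, map_mul, map_one, Complex.conj_conj]
      ring
    exact_mod_cast this
  have h2 : 0 < (1 - ‖a‖ ^ 2) * (1 - ‖z‖ ^ 2) := by
    apply mul_pos <;> nlinarith [norm_nonneg a, norm_nonneg z]
  exact lt_of_pow_lt_pow_left₀ 2 (norm_nonneg _) (by linarith)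

theorem mul_conj_eq_one {c : ℂ} (hc : ‖c‖ = 1) : c * (starRingEnd ℂ) c = 1 := by
  rw [← ofReal_norm_sq, hc]
  simp

theorem moebius_moebius {c a z : ℂ} (hc : ‖c‖ = 1) (ha : ‖a‖ < 1) (hz : ‖z‖ < 1) :
    moebius ((starRingEnd ℂ) c) (-(c * a)) (moebius c a z) = z := by
  have h0 := one_sub_conj_mul_ne_zero ha hz
  have ha0 := one_sub_conj_mul_ne_zero ha ha
  have hcc := mul_conj_eq_one hc
  have e1 : (starRingEnd ℂ) c * (moebius c a z - -(c * a)) =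
      z * (1 - (starRingEnd ℂ) a * a) / (1 - (starRingEnd ℂ) a * z) := by
    rw [moebius, eq_div_iff h0, mul_assoc, sub_mul, div_mul_cancel₀ _ h0]
    linear_combination (z - (starRingEnd ℂ) a * z * a) * hcc
  have e2 : 1 - (starRingEnd ℂ) (-(c * a)) * moebius c a z =
      (1 - (starRingEnd ℂ) a * a) / (1 - (starRingEnd ℂ) a * z) := by
    rw [moebius, eq_div_iff h0, sub_mul, mul_assoc, div_mul_cancel₀ _ h0, map_neg, map_mul]
    linear_combination (starRingEnd ℂ) a * (z - a) * hcc
  rw [moebius, e1, e2, div_div_div_cancel_right₀ h0, mul_div_cancel_right₀ _ ha0]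

theorem moebius_moebius' {c a z : ℂ} (hc : ‖c‖ = 1) (ha : ‖a‖ < 1) (hz : ‖z‖ < 1) :
    moebius c a (moebius ((starRingEnd ℂ) c) (-(c * a)) z) = z := by
  have hcc := mul_conj_eq_one hc
  have h := moebius_moebius (c := (starRingEnd ℂ) c) (a := -(c * a)) (z := z) (by simpa using hc)
    (by simpa [hc] using ha) hz
  have e : -((starRingEnd ℂ) c * -(c * a)) = a := by linear_combination a * hcc
  rwa [Complex.conj_conj, e] at h

theorem differentiableOn_moebius (c : ℂ) {a : ℂ} (ha : ‖a‖ < 1) :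
    DifferentiableOn ℂ (moebius c a) disk := by
  intro z hz
  have h0 := one_sub_conj_mul_ne_zero ha (mem_disk.1 hz)
  have : DifferentiableAt ℂ (moebius c a) z := by
    unfold moebius
    fun_prop (disch := exact h0)
  exact this.differentiableWithinAt

/-- The Möbius transformation `moebius c a` as a self-map of the disk. -/
noncomputable def diskMoebius {c a : ℂ} (hc : ‖c‖ = 1) (ha : ‖a‖ < 1) (z : disk) : disk :=
  ⟨moebius c a z, mem_disk.2 (norm_moebius_lt hc ha (mem_disk.1 z.2))⟩

theorem isDiskAut_diskMoebius {c a : ℂ} (hc : ‖c‖ = 1) (ha : ‖a‖ < 1) :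
    IsDiskAut (diskMoebius hc ha) := by
  have hc' : ‖(starRingEnd ℂ) c‖ = 1 := by simpa using hc
  have ha' : ‖-(c * a)‖ < 1 := by simpa [hc] using ha
  refine ⟨Function.bijective_iff_has_inverse.2 ⟨diskMoebius hc' ha', fun z => ?_, fun z => ?_⟩, ?_⟩
  · exact Subtype.ext (moebius_moebius hc ha (mem_disk.1 z.2))
  · exact Subtype.ext (moebius_moebius' hc ha (mem_disk.1 z.2))
  · refine (differentiableOn_moebius c ha).congr fun z hz => ?_
    rw [extendZero_of_mem _ hz]
    rfl

/-- The inverse of a holomorphic bijection of the disk is holomorphic. -/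
theorem differentiableOn_inverse {f g : ℂ → ℂ} (hf : DifferentiableOn ℂ f disk)
    (hgm : Set.MapsTo g disk disk)
    (hgf : ∀ z ∈ disk, g (f z) = z) (hfg : ∀ z ∈ disk, f (g z) = z) :
    DifferentiableOn ℂ g disk := by
  have hfa : AnalyticOnNhd ℂ f disk := hf.analyticOnNhd isOpen_disk
  have hconn : IsPreconnected disk := (convex_ball (0 : ℂ) 1).isPreconnected
  have hinj : Set.InjOn f disk := Set.LeftInvOn.injOn hgf
  have hhalf : (1 / 2 : ℂ) ∈ disk := by
    rw [mem_disk]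
    norm_num
  have hopen : ∀ s ⊆ disk, IsOpen s → IsOpen (f '' s) := by
    refine (hfa.is_constant_or_isOpen hconn).resolve_left ?_
    rintro ⟨w, hw⟩
    have := hinj zero_mem_disk hhalf ((hw 0 zero_mem_disk).trans (hw _ hhalf).symm)
    norm_num at this
  have hcont : ∀ w ∈ disk, ContinuousAt g w := by
    intro w hw s hs
    obtain ⟨V, hVs, hV, hwV⟩ := mem_nhds_iff.1 hs
    have h1 : IsOpen (f '' (V ∩ disk)) :=
      hopen _ Set.inter_subset_right (hV.inter isOpen_disk)
    rw [Filter.mem_map]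
    refine Filter.mem_of_superset (h1.mem_nhds ⟨g w, ⟨hwV, hgm hw⟩, hfg w hw⟩) ?_
    rintro _ ⟨z, ⟨hzV, hz⟩, rfl⟩
    rw [Set.mem_preimage, hgf z hz]
    exact hVs hzV
  have hreg : ∀ w ∈ disk, deriv f (g w) ≠ 0 → DifferentiableAt ℂ g w := fun w hw h =>
    (((hfa _ (hgm hw)).differentiableAt.hasDerivAt).of_local_left_inverse (hcont w hw) h
      (Filter.mem_of_superset (isOpen_disk.mem_nhds hw) hfg)).differentiableAt
  intro w hw
  refine AnalyticAt.differentiableWithinAt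
    (Complex.analyticAt_of_differentiable_on_punctured_nhds_of_continuousAt ?_ (hcont w hw))
  have hne : ∀ᶠ z in 𝓝[≠] (g w), deriv f z ≠ 0 := by
    refine (hfa _ (hgm hw)).deriv.eventually_eq_zero_or_eventually_ne_zero.resolve_left fun h => ?_
    obtain ⟨r, hr, hball⟩ := Metric.eventually_nhds_iff_ball.1
      (h.and (isOpen_disk.mem_nhds (hgm hw)))
    have hmem : g w + (r / 2 : ℝ) ∈ Metric.ball (g w) r := by
      rw [Metric.mem_ball, dist_eq_norm, add_sub_cancel_left, Complex.norm_real, Real.norm_eq_abs,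
        abs_of_pos (by positivity)]
      linarith
    have h1 : f (g w + (r / 2 : ℝ)) = f (g w) :=
      Metric.isOpen_ball.is_const_of_deriv_eq_zero (convex_ball _ _).isPreconnected
        (fun z hz => (hfa z (hball z hz).2).differentiableAt.differentiableWithinAt)
        (fun z hz => (hball z hz).1) hmem (Metric.mem_ball_self hr)
    have h2 := hinj (hball _ hmem).2 (hgm hw) h1
    rw [add_eq_left, Complex.ofReal_eq_zero] at h2
    linarith
  have htend : Filter.Tendsto g (𝓝[≠] w) (𝓝[≠] (g w)) := by
    refine tendsto_nhdsWithin_iff.2 ⟨(hcont w hw).tendsto.mono_left nhdsWithin_le_nhds, ?_⟩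
    filter_upwards [self_mem_nhdsWithin, mem_nhdsWithin_of_mem_nhds (isOpen_disk.mem_nhds hw)]
      with y hy hyd h
    exact hy (by rw [Set.mem_singleton_iff, ← hfg y hyd, h, hfg w hw])
  filter_upwards [htend.eventually hne, mem_nhdsWithin_of_mem_nhds (isOpen_disk.mem_nhds hw)]
    with y hy hyd using hreg y hyd hy

/-- By the Schwarz lemma for the map and its inverse, an automorphism fixing `0` is a rotation. -/
theorem exists_rotation {f g : ℂ → ℂ} (hf : DifferentiableOn ℂ f disk)
    (hfm : Set.MapsTo f disk disk) (hgm : Set.MapsTo g disk disk)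
    (hgf : ∀ z ∈ disk, g (f z) = z) (hfg : ∀ z ∈ disk, f (g z) = z) (h0 : f 0 = 0) :
    ∃ c : ℂ, ‖c‖ = 1 ∧ ∀ z ∈ disk, f z = c * z := by
  have hg := differentiableOn_inverse hf hgm hgf hfg
  have hg0 : g 0 = 0 := by simpa [h0] using hgf 0 zero_mem_disk
  have hle {k : ℂ → ℂ} (hk : DifferentiableOn ℂ k disk) (hkm : Set.MapsTo k disk disk)
      (hk0 : k 0 = 0) {z : ℂ} (hz : z ∈ disk) : ‖k z‖ ≤ ‖z‖ :=
    Complex.norm_le_norm_of_mapsTo_ball hk (hkm.mono_right Metric.ball_subset_closedBall) hk0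
      (mem_disk.1 hz)
  have heq {z : ℂ} (hz : z ∈ disk) : ‖f z‖ = ‖z‖ := by
    refine le_antisymm (hle hf hfm h0 hz) ?_
    have := hle hg hgm hg0 (hfm hz)
    rwa [hgf z hz] at this
  have hhalf : (1 / 2 : ℂ) ∈ disk := by
    rw [mem_disk]
    norm_num
  obtain ⟨c, hc, hfc⟩ := Complex.affine_of_mapsTo_ball_of_exists_norm_dslope_eq_div' (f := f)
    (c := 0) (R₁ := 1) (R₂ := 1) hf
    (by rw [h0]; exact hfm.mono_right Metric.ball_subset_closedBall)
    ⟨1 / 2, hhalf, by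
      rw [dslope_of_ne _ (by norm_num), slope_def_module, h0, norm_smul, sub_zero, sub_zero,
        heq hhalf]
      norm_num⟩
  refine ⟨c, by simpa using hc, fun z hz => ?_⟩
  rw [hfc hz, h0]
  simp [mul_comm]

theorem exists_moebius_of_isDiskAut {φ : disk → disk} (hφ : IsDiskAut φ) :
    ∃ c a : ℂ, ‖c‖ = 1 ∧ ‖a‖ < 1 ∧ ∀ z : disk, (φ z : ℂ) = moebius c a z := by
  obtain ⟨hbij, hd⟩ := hφ
  obtain ⟨ψ, hψφ, hφψ⟩ := Function.bijective_iff_has_inverse.1 hbij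
  set a : ℂ := ((ψ ⟨0, zero_mem_disk⟩ : disk) : ℂ) with ha_def
  have ha : ‖a‖ < 1 := mem_disk.1 (ψ ⟨0, zero_mem_disk⟩).2
  have ha' : ‖-(1 * a)‖ < 1 := by simpa using ha
  have h1 : ‖(1 : ℂ)‖ = 1 := norm_one
  have hc1 : (starRingEnd ℂ) (1 : ℂ) = 1 := map_one _
  have hM {z : ℂ} (hz : z ∈ disk) : moebius 1 a z ∈ disk :=
    mem_disk.2 (norm_moebius_lt h1 ha (mem_disk.1 hz))
  have hM' {z : ℂ} (hz : z ∈ disk) : moebius 1 (-(1 * a)) z ∈ disk :=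
    mem_disk.2 (norm_moebius_lt h1 ha' (mem_disk.1 hz))
  have hMM {z : ℂ} (hz : z ∈ disk) : moebius 1 (-(1 * a)) (moebius 1 a z) = z := by
    have := moebius_moebius h1 ha (mem_disk.1 hz)
    rwa [hc1] at this
  have hMM' {z : ℂ} (hz : z ∈ disk) : moebius 1 a (moebius 1 (-(1 * a)) z) = z := by
    have := moebius_moebius' h1 ha (mem_disk.1 hz)
    rwa [hc1] at this
  have hE (χ : disk → disk) {z : ℂ} (hz : z ∈ disk) :
      extendZero (fun z => (χ z : ℂ)) z = χ ⟨z, hz⟩ := extendZero_of_mem _ hz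
  have hEm (χ : disk → disk) {z : ℂ} (hz : z ∈ disk) :
      extendZero (fun z => (χ z : ℂ)) z ∈ disk := by
    rw [hE χ hz]
    exact (χ _).2
  obtain ⟨c, hc, hrot⟩ := exists_rotation
    (f := fun z => extendZero (fun z => (φ z : ℂ)) (moebius 1 (-(1 * a)) z))
    (g := fun z => moebius 1 a (extendZero (fun z => (ψ z : ℂ)) z))
    (hd.comp (differentiableOn_moebius 1 ha') fun z hz => hM' hz)
    (fun z hz => hEm φ (hM' hz)) (fun z hz => hM (hEm ψ hz))
    (fun z hz => by
      simp only [hE φ (hM' hz), hE ψ (φ _).2, Subtype.coe_eta, hψφ _, hMM' hz])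
    (fun z hz => by
      simp only [hE ψ hz, hMM (ψ _).2, hE φ (ψ _).2, Subtype.coe_eta, hφψ _])
    (by
      have : moebius 1 (-(1 * a)) 0 = a := by simp [moebius]
      have h2 := hE φ (ψ ⟨0, zero_mem_disk⟩).2
      rw [Subtype.coe_eta, hφψ] at h2
      simp only [this]
      exact h2)
  refine ⟨c, a, hc, ha, fun z => ?_⟩
  have := hrot _ (hM z.2)
  simp only [hMM z.2, hE φ z.2, Subtype.coe_eta] at this
  rw [this, moebius, moebius, one_mul, mul_div_assoc]

/-! ### Möbius invariance of the restricted eigenspace -/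

theorem poisson_moebius {c a z : ℂ} (hc : ‖c‖ = 1) (ha : ‖a‖ < 1) (hz : ‖z‖ < 1) (s t : ℂ) :
    poisson s t (moebius c a z, (starRingEnd ℂ) (moebius c a z)) =
      (starRingEnd ℂ) c / (1 - (starRingEnd ℂ) a * a) *
        poisson (s + t * c * a) (s * (starRingEnd ℂ) a + t * c) (z, (starRingEnd ℂ) z) := by
  have h0 := one_sub_conj_mul_ne_zero ha hz
  have ha0 := one_sub_conj_mul_ne_zero ha ha
  have hz0 := one_sub_conj_mul_ne_zero hz hz
  have h0' : 1 - a * (starRingEnd ℂ) z ≠ 0 := by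
    have := one_sub_conj_mul_ne_zero hz ha
    rwa [mul_comm] at this
  have hcc := mul_conj_eq_one hc
  have hconj : (starRingEnd ℂ) (moebius c a z) =
      (starRingEnd ℂ) c * ((starRingEnd ℂ) z - (starRingEnd ℂ) a) /
        (1 - a * (starRingEnd ℂ) z) := by
    simp only [moebius, map_div₀, map_mul, map_sub, map_one, Complex.conj_conj]
  rw [hconj]
  simp only [poisson, moebius]
  generalize (starRingEnd ℂ) z = w at *
  generalize (starRingEnd ℂ) a = b at *
  generalize (starRingEnd ℂ) c = d at *
  have e1 : s - t * (c * (z - a) / (1 - b * z)) =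
      (s + t * c * a - (s * b + t * c) * z) / (1 - b * z) := by
    rw [eq_div_iff h0, sub_mul, mul_assoc t, div_mul_cancel₀ _ h0]
    ring
  have e2 : t - s * (d * (w - b) / (1 - a * w)) =
      d * (s * b + t * c - (s + t * c * a) * w) / (1 - a * w) := by
    rw [eq_div_iff h0', sub_mul, mul_assoc s, div_mul_cancel₀ _ h0']
    linear_combination (-t + t * a * w) * hcc
  have e3 : 1 - c * (z - a) / (1 - b * z) * (d * (w - b) / (1 - a * w)) =
      (1 - b * a) * (1 - z * w) / ((1 - b * z) * (1 - a * w)) := by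
    rw [eq_div_iff (mul_ne_zero h0 h0'), sub_mul, div_mul_div_comm,
      div_mul_cancel₀ _ (mul_ne_zero h0 h0')]
    linear_combination -((z - a) * (w - b)) * hcc
  rw [e1, e2, e3]
  have hz0' : 1 - z * w ≠ 0 := by rwa [mul_comm]
  field_simp

theorem diskKernel_comp_moebius (m : ℕ) {c a : ℂ} (hc : ‖c‖ = 1) (ha : ‖a‖ < 1) (s t : ℂ) (z : disk)
    {w : disk} (hw : (w : ℂ) = moebius c a z) :
    diskKernel m s t w = ((starRingEnd ℂ) c / (1 - (starRingEnd ℂ) a * a)) ^ m *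
      diskKernel m (s + t * c * a) (s * (starRingEnd ℂ) a + t * c) z := by
  rw [diskKernel_apply, diskKernel_apply, hw, poisson_moebius hc ha (mem_disk.1 z.2), mul_pow]

theorem hypSpace_comp_mem (m : ℕ) {f : disk → ℂ} (hf : f ∈ hypSpace (4 * m * (m + 1)))
    {φ : disk → disk} (hφ : IsDiskAut φ) : f ∘ φ ∈ hypSpace (4 * m * (m + 1)) := by
  obtain ⟨c, a, hc, ha, h⟩ := exists_moebius_of_isDiskAut hφ
  have hle : hypSpace (4 * m * (m + 1)) ≤
      (hypSpace (4 * m * (m + 1))).comap (LinearMap.funLeft ℂ ℂ φ) := by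
    conv_lhs => rw [← span_diskKernel m (t := fun i => ((i : ℕ) : ℂ))
      (fun i j h => Fin.ext (by simpa using h))]
    rw [Submodule.span_le]
    rintro _ ⟨i, rfl⟩
    have e : LinearMap.funLeft ℂ ℂ φ (diskKernel m 1 (-((i : ℕ) : ℂ))) =
        ((starRingEnd ℂ) c / (1 - (starRingEnd ℂ) a * a)) ^ m •
          diskKernel m (1 + -((i : ℕ) : ℂ) * c * a) (1 * (starRingEnd ℂ) a + -((i : ℕ) : ℂ) * c) :=
      funext fun z => diskKernel_comp_moebius m hc ha _ _ z (h z)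
    change LinearMap.funLeft ℂ ℂ φ (diskKernel m 1 (-((i : ℕ) : ℂ))) ∈
      hypSpace (4 * m * (m + 1))
    rw [e]
    exact Submodule.smul_mem _ _ (diskKernel_mem m _ _)
  exact hle hf

theorem finiteDimensional_hypSpace (m : ℕ) :
    FiniteDimensional ℂ (hypSpace (4 * m * (m + 1))) :=
  Module.finite_of_finrank_pos (by rw [finrank_hypSpace]; omega)

theorem isMoebiusInvariant_hypSpace (m : ℕ) : IsMoebiusInvariant (hypSpace (4 * m * (m + 1))) := by
  have := finiteDimensional_hypSpace m
  refine ⟨fun f hf => (hypSpace_le _ hf).1, fun u f hu _ hlim => ?_,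
    fun f hf φ hφ => hypSpace_comp_mem m hf hφ⟩
  have hcl : IsClosed (hypSpace (4 * m * (m + 1)) : Set (disk → ℂ)) :=
    Submodule.closed_of_finiteDimensional _
  refine hcl.mem_of_tendsto (f := u) (b := Filter.atTop) (tendsto_pi_nhds.2 fun z => ?_)
    (Filter.Eventually.of_forall hu)
  exact (tendstoLocallyUniformlyOn_univ.2 hlim).tendsto_at (Set.mem_univ z)

/-! ### The full eigenspace of the disk is larger -/

/-- The power of the Poisson kernel of the disk with pole `1` which has the same eigenvalue as the
`m`-th power of its inverse. -/
noncomputable def poissonPow (m : ℕ) (z : disk) : ℂ :=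
  (poisson 1 1 (z, (starRingEnd ℂ) (z : ℂ)))⁻¹ ^ (m + 1)

theorem poisson_one_one_ne_zero {z : ℂ} (hz : z ∈ disk) : poisson 1 1 (slice 1 z) ≠ 0 := by
  have h0 := one_sub_ne_zero (bidisk_chart_subset (slice_one_mem hz))
  have h1 : ∀ {w : ℂ}, w ∈ disk → 1 - w ≠ 0 := fun hw h => by
    rw [mem_disk, ← sub_eq_zero.1 h, norm_one] at hw
    exact lt_irrefl _ hw
  simp only [poisson, slice_apply, one_mul] at h0 ⊢
  exact div_ne_zero (mul_ne_zero (h1 hz) (h1 (conj_mem_disk hz))) h0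

theorem poissonPow_mem (m : ℕ) : poissonPow m ∈ diskEigenspace (4 * m * (m + 1)) := by
  have e {z : ℂ} (hz : z ∈ disk) :
      extendZero (poissonPow m) z = (fun p => (poisson 1 1 p)⁻¹ ^ (m + 1)) (slice 1 z) := by
    rw [extendZero_of_mem _ hz]
    simp [poissonPow]
  have e' {z : ℂ} (hz : z ∈ disk) : extendZero (poissonPow m) =ᶠ[𝓝 z]
      fun u => (fun p => (poisson 1 1 p)⁻¹ ^ (m + 1)) (slice 1 u) := by
    filter_upwards [isOpen_disk.mem_nhds hz] with u hu using e hu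
  have han {z : ℂ} (hz : z ∈ disk) :
      AnalyticAt ℂ (fun p => (poisson 1 1 p)⁻¹ ^ (m + 1)) (slice 1 z) :=
    ((analyticAt_poisson 1 1 (bidisk_chart_subset (slice_one_mem hz))).inv
      (poisson_one_one_ne_zero hz)).pow _
  refine ⟨fun z hz => (contDiffAt_comp_slice (han hz)).congr_of_eventuallyEq (e' hz),
    fun z hz => ?_⟩
  rw [lapDisk_congr (e' hz), lapDisk_comp_slice (han hz), lapZW_poisson_inv_pow 1 1 m
    (bidisk_chart_subset (slice_one_mem hz)) (poisson_one_one_ne_zero hz), e hz]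

/-- Radial growth at the boundary point `1` separates the two kinds of eigenfunctions. -/
theorem tendsto_of_mem_hypSpace (m : ℕ) {f : disk → ℂ} (hf : f ∈ hypSpace (4 * m * (m + 1))) :
    Filter.Tendsto (fun r : ℝ => (1 - r : ℂ) ^ (m + 1) * extendZero f r) (𝓝[<] 1) (𝓝 0) := by
  rw [← span_diskKernel m (t := fun i => ((i : ℕ) : ℂ))
      (fun i j h => Fin.ext (by simpa using h))] at hf
  induction hf using Submodule.span_induction with
  | zero => simp [extendZero_zero]
  | add f g _ _ hf hg =>
    simp only [extendZero_add, Pi.add_apply, mul_add]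
    simpa using hf.add hg
  | smul c f _ hf =>
    simp only [extendZero_smul, Pi.smul_apply, smul_eq_mul, mul_left_comm]
    simpa using hf.const_mul c
  | mem f hf =>
    obtain ⟨i, rfl⟩ := hf
    change Filter.Tendsto (fun r : ℝ => (1 - r : ℂ) ^ (m + 1) *
      extendZero (diskKernel m 1 (-((i : ℕ) : ℂ))) r) _ _
    generalize -((i : ℕ) : ℂ) = t
    have h1 : Filter.Tendsto (fun r : ℝ => (1 - r : ℂ) * ((1 - t * r) * (t - r) / (1 + r)) ^ m)
        (𝓝[<] 1) (𝓝 0) := by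
      have hc : ContinuousAt
          (fun r : ℝ => (1 - r : ℂ) * ((1 - t * r) * (t - r) / (1 + r)) ^ m) 1 := by
        have : (1 : ℂ) + ((1 : ℝ) : ℂ) ≠ 0 := by norm_num
        fun_prop (disch := exact this)
      refine (hc.tendsto.mono_left nhdsWithin_le_nhds).trans (le_of_eq ?_)
      simp
    refine h1.congr' ?_
    filter_upwards [Ioo_mem_nhdsLT (show (-1 : ℝ) < 1 by norm_num)] with r hr
    have hr' : (r : ℂ) ∈ disk := by
      rw [mem_disk, Complex.norm_real, Real.norm_eq_abs, abs_lt]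
      exact hr
    rw [extendZero_of_mem _ hr', diskKernel_apply]
    simp only [poisson, Complex.conj_ofReal, one_mul]
    have e1 : (1 - r : ℂ) ≠ 0 := by
      rw [sub_ne_zero]
      exact_mod_cast hr.2.ne'
    have e2 : (1 + r : ℂ) ≠ 0 := by
      have : (0 : ℝ) < 1 + r := by linarith [hr.1]
      exact_mod_cast this.ne'
    rw [pow_succ', mul_assoc, ← mul_pow, show (1 : ℂ) - r * r = (1 - r) * (1 + r) by ring]
    congr 2
    field_simp

theorem hypSpace_ne (m : ℕ) : hypSpace (4 * m * (m + 1)) ≠ diskEigenspace (4 * m * (m + 1)) := by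
  intro h
  have h1 := tendsto_of_mem_hypSpace m (h ▸ poissonPow_mem m)
  have h2 : Filter.Tendsto (fun r : ℝ => (1 + r : ℂ) ^ (m + 1)) (𝓝[<] 1) (𝓝 (2 ^ (m + 1))) := by
    have hc : Continuous (fun r : ℝ => (1 + r : ℂ) ^ (m + 1)) := by fun_prop
    refine (hc.continuousAt.tendsto.mono_left nhdsWithin_le_nhds).trans (le_of_eq ?_)
    norm_num
  have h3 := tendsto_nhds_unique (h1.congr' ?_) h2
  · exact pow_ne_zero (m + 1) two_ne_zero h3.symm
  · filter_upwards [Ioo_mem_nhdsLT (show (-1 : ℝ) < 1 by norm_num)] with r hr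
    have hr' : (r : ℂ) ∈ disk := by
      rw [mem_disk, Complex.norm_real, Real.norm_eq_abs, abs_lt]
      exact hr
    rw [extendZero_of_mem _ hr', poissonPow]
    simp only [poisson, Complex.conj_ofReal, one_mul]
    have e1 : (1 - r : ℂ) ≠ 0 := by
      rw [sub_ne_zero]
      exact_mod_cast hr.2.ne'
    have e2 : (1 + r : ℂ) ≠ 0 := by
      have : (0 : ℝ) < 1 + r := by linarith [hr.1]
      exact_mod_cast this.ne'
    rw [← mul_pow, show (1 : ℂ) - r * r = (1 - r) * (1 + r) by ring]
    congr 1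
    field_simp

theorem isFiniteMoebiusSubspace_hypSpace (m : ℕ) :
    IsFiniteMoebiusSubspace (4 * m * (m + 1)) (hypSpace (4 * m * (m + 1))) := by
  have := finiteDimensional_hypSpace m
  refine ⟨hypSpace_le _, isMoebiusInvariant_hypSpace m, fun h => ?_, hypSpace_ne m, this⟩
  have h1 := finrank_hypSpace m
  rw [h, finrank_bot] at h1
  omega

/-! ### Infinitesimal automorphisms of the disk -/

theorem fderiv_eq_wirt (f : ℂ → ℂ) (z v : ℂ) :
    fderiv ℝ f z v = v * wirtZ f z + (starRingEnd ℂ) v * wirtZbar f z := by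
  obtain ⟨x, y⟩ := v
  have h : (⟨x, y⟩ : ℂ) = x • (1 : ℂ) + y • Complex.I := by apply Complex.ext <;> simp
  have h' : (starRingEnd ℂ) (⟨x, y⟩ : ℂ) = x - y * Complex.I := by apply Complex.ext <;> simp
  rw [h', h, map_add, map_smul, map_smul, wirtZ, wirtZbar]
  simp only [Complex.real_smul, mul_one]
  linear_combination (y * fderiv ℝ f z Complex.I) * Complex.I_mul_I

/-- The generator `z ∂_z - conj z ∂_{conj z}` of the rotations. -/
noncomputable def rotOp (f : disk → ℂ) (z : disk) : ℂ :=
  z * wirtZ (extendZero f) z - (starRingEnd ℂ) (z : ℂ) * wirtZbar (extendZero f) z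

/-- The infinitesimal automorphism `∂_{conj z} - z² ∂_z` of the disk, in the complexified Lie
algebra. It raises weights by one. -/
noncomputable def raiseOp (f : disk → ℂ) (z : disk) : ℂ :=
  wirtZbar (extendZero f) z - (z : ℂ) ^ 2 * wirtZ (extendZero f) z

/-- The infinitesimal automorphism `∂_z - (conj z)² ∂_{conj z}` of the disk, in the complexified Lie
algebra. It lowers weights by one. -/
noncomputable def lowerOp (f : disk → ℂ) (z : disk) : ℂ :=
  wirtZ (extendZero f) z - (starRingEnd ℂ) (z : ℂ) ^ 2 * wirtZbar (extendZero f) z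

theorem IsC2Disk.differentiableAt {f : disk → ℂ} (hf : IsC2Disk f) {z : ℂ} (hz : z ∈ disk) :
    DifferentiableAt ℝ (extendZero f) z := (hf z hz).differentiableAt (by norm_num)

/-- Finite dimensional invariant spaces are closed under differentiation along one-parameter
families of automorphisms, as they are closed in the topology of pointwise convergence. -/
theorem fderiv_mem {Y : Submodule ℂ (disk → ℂ)} [FiniteDimensional ℂ Y]
    (hY : IsMoebiusInvariant Y) {f : disk → ℂ} (hf : f ∈ Y) {c a : ℝ → ℂ}
    (hca : ∀ᶠ t in 𝓝 (0 : ℝ), ‖c t‖ = 1 ∧ ‖a t‖ < 1) (hc0 : c 0 = 1) (ha0 : a 0 = 0) {v : ℂ → ℂ}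
    (hv : ∀ z : ℂ, HasDerivAt (fun t => moebius (c t) (a t) z) (v z) 0) :
    (fun z : disk => fderiv ℝ (extendZero f) z (v z)) ∈ Y := by
  have h0 (z : ℂ) : moebius (c 0) (a 0) z = z := by simp [moebius, hc0, ha0]
  have hcl : IsClosed (Y : Set (disk → ℂ)) := Submodule.closed_of_finiteDimensional Y
  have hlim (z : disk) : Filter.Tendsto (fun t : ℝ => ((t⁻¹ : ℝ) : ℂ) *
      (extendZero f (moebius (c t) (a t) z) - extendZero f z)) (𝓝[≠] 0)
        (𝓝 (fderiv ℝ (extendZero f) z (v z))) := by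
    have h2 : HasFDerivAt (extendZero f) (fderiv ℝ (extendZero f) z)
        (moebius (c 0) (a 0) z) := by
      rw [h0]
      exact ((hY.1 f hf).differentiableAt z.2).hasFDerivAt
    have h3 : HasDerivAt (fun t => extendZero f (moebius (c t) (a t) z))
        (fderiv ℝ (extendZero f) z (v z)) 0 :=
      HasFDerivAt.comp_hasDerivAt (f := fun t => moebius (c t) (a t) z) (0 : ℝ) h2 (hv z)
    refine (hasDerivAt_iff_tendsto_slope_zero.1 h3).congr fun t => ?_
    rw [zero_add, h0, Complex.real_smul]
  refine hcl.mem_of_tendsto (tendsto_pi_nhds.2 hlim) ?_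
  filter_upwards [mem_nhdsWithin_of_mem_nhds hca] with t ht
  have e : (fun z : disk => ((t⁻¹ : ℝ) : ℂ) *
      (extendZero f (moebius (c t) (a t) z) - extendZero f z)) =
        ((t⁻¹ : ℝ) : ℂ) • (f ∘ diskMoebius ht.1 ht.2 - f) := by
    funext z
    rw [extendZero_apply,
      extendZero_of_mem f (mem_disk.2 (norm_moebius_lt ht.1 ht.2 (mem_disk.1 z.2)))]
    rfl
  rw [e]
  exact Y.smul_mem _ (Y.sub_mem (hY.2.2 f hf _ (isDiskAut_diskMoebius ht.1 ht.2)) hf)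

theorem rotOp_mem {Y : Submodule ℂ (disk → ℂ)} [FiniteDimensional ℂ Y]
    (hY : IsMoebiusInvariant Y) {f : disk → ℂ} (hf : f ∈ Y) : rotOp f ∈ Y := by
  have h := fderiv_mem hY hf (c := fun t => Complex.exp (t * Complex.I)) (a := fun _ => 0)
    (v := fun z => Complex.I * z)
    (Filter.Eventually.of_forall fun t => by simp [Complex.norm_exp_ofReal_mul_I]) (by simp) rfl
    fun z => by
      have h1 : HasDerivAt (fun t : ℝ => Complex.exp (t * Complex.I)) Complex.I 0 := by
        have := ((Complex.ofRealCLM.hasDerivAt (x := 0)).mul_const Complex.I).cexp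
        simpa using this
      simpa [moebius] using h1.mul_const z
  have e : rotOp f = -Complex.I • fun z : disk => fderiv ℝ (extendZero f) z (Complex.I * z) := by
    funext z
    simp only [rotOp, Pi.smul_apply, smul_eq_mul, fderiv_eq_wirt, map_mul, Complex.conj_I]
    linear_combination (z * wirtZ (extendZero f) z -
      (starRingEnd ℂ) (z : ℂ) * wirtZbar (extendZero f) z) * Complex.I_mul_I
  rw [e]
  exact Y.smul_mem _ h

/-- The derivative along the hyperbolic translations `z ↦ (z + t α) / (1 + t (conj α) z)`. -/
theorem translation_mem {Y : Submodule ℂ (disk → ℂ)} [FiniteDimensional ℂ Y]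
    (hY : IsMoebiusInvariant Y) {f : disk → ℂ} (hf : f ∈ Y) (α : ℂ) :
    (fun z : disk => fderiv ℝ (extendZero f) z (α - (starRingEnd ℂ) α * (z : ℂ) ^ 2)) ∈ Y := by
  refine fderiv_mem hY hf (c := fun _ => 1) (a := fun t => -(t * α))
    (v := fun z => α - (starRingEnd ℂ) α * z ^ 2) ?_ rfl (by simp) fun z => ?_
  · have h1 : Continuous fun t : ℝ => ‖-(t * α)‖ := by fun_prop
    have h2 : ∀ᶠ t : ℝ in 𝓝 0, ‖-(t * α)‖ < 1 :=
      h1.continuousAt.eventually_lt continuousAt_const (by simp)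
    filter_upwards [h2] with t ht using ⟨norm_one, ht⟩
  · have h1 : HasDerivAt (fun t : ℝ => (t : ℂ)) 1 0 := Complex.ofRealCLM.hasDerivAt
    have e : (fun t : ℝ => moebius 1 (-(t * α)) z) = fun t : ℝ =>
        (z + t * α) / (1 + t * ((starRingEnd ℂ) α * z)) := by
      funext t
      simp only [moebius, one_mul, sub_neg_eq_add, map_neg, map_mul, Complex.conj_ofReal]
      congr 1
      ring
    rw [e]
    refine (((h1.mul_const α).const_add z).fun_div
      ((h1.mul_const ((starRingEnd ℂ) α * z)).const_add 1) (by simp)).congr_deriv ?_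
    simp
    ring

theorem raiseOp_mem {Y : Submodule ℂ (disk → ℂ)} [FiniteDimensional ℂ Y]
    (hY : IsMoebiusInvariant Y) {f : disk → ℂ} (hf : f ∈ Y) : raiseOp f ∈ Y := by
  have e : raiseOp f = (2⁻¹ : ℂ) • ((fun z : disk => fderiv ℝ (extendZero f) z
      (1 - (starRingEnd ℂ) 1 * (z : ℂ) ^ 2)) + Complex.I • fun z : disk =>
        fderiv ℝ (extendZero f) z (Complex.I - (starRingEnd ℂ) Complex.I * (z : ℂ) ^ 2)) := by
    funext z
    simp only [raiseOp, Pi.smul_apply, Pi.add_apply, smul_eq_mul, fderiv_eq_wirt, map_sub, map_mul,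
      map_pow, Complex.conj_I, map_one, map_neg]
    linear_combination (-(2⁻¹ : ℂ)) * ((1 + z ^ 2) * wirtZ (extendZero f) z -
      (1 + (starRingEnd ℂ) (z : ℂ) ^ 2) * wirtZbar (extendZero f) z) * Complex.I_mul_I
  rw [e]
  exact Y.smul_mem _ (Y.add_mem (translation_mem hY hf 1)
    (Y.smul_mem _ (translation_mem hY hf Complex.I)))

theorem lowerOp_mem {Y : Submodule ℂ (disk → ℂ)} [FiniteDimensional ℂ Y]
    (hY : IsMoebiusInvariant Y) {f : disk → ℂ} (hf : f ∈ Y) : lowerOp f ∈ Y := by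
  have e : lowerOp f = (2⁻¹ : ℂ) • ((fun z : disk => fderiv ℝ (extendZero f) z
      (1 - (starRingEnd ℂ) 1 * (z : ℂ) ^ 2)) + (-Complex.I) • fun z : disk =>
        fderiv ℝ (extendZero f) z (Complex.I - (starRingEnd ℂ) Complex.I * (z : ℂ) ^ 2)) := by
    funext z
    simp only [lowerOp, Pi.smul_apply, Pi.add_apply, smul_eq_mul, fderiv_eq_wirt, map_sub, map_mul,
      map_pow, Complex.conj_I, map_one, map_neg]
    linear_combination (2⁻¹ : ℂ) * ((1 + z ^ 2) * wirtZ (extendZero f) z -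
      (1 + (starRingEnd ℂ) (z : ℂ) ^ 2) * wirtZbar (extendZero f) z) * Complex.I_mul_I
  rw [e]
  exact Y.smul_mem _ (Y.add_mem (translation_mem hY hf 1)
    (Y.smul_mem _ (translation_mem hY hf Complex.I)))

theorem wirtZ_add {f g : disk → ℂ} (hf : IsC2Disk f) (hg : IsC2Disk g) {z : ℂ} (hz : z ∈ disk) :
    wirtZ (extendZero (f + g)) z = wirtZ (extendZero f) z + wirtZ (extendZero g) z := by
  simp only [wirtZ, extendZero_add, fderiv_add (hf.differentiableAt hz) (hg.differentiableAt hz),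
    _root_.add_apply]
  ring

theorem wirtZbar_add {f g : disk → ℂ} (hf : IsC2Disk f) (hg : IsC2Disk g) {z : ℂ}
    (hz : z ∈ disk) :
    wirtZbar (extendZero (f + g)) z = wirtZbar (extendZero f) z + wirtZbar (extendZero g) z := by
  simp only [wirtZbar, extendZero_add,
    fderiv_add (hf.differentiableAt hz) (hg.differentiableAt hz), _root_.add_apply]
  ring

theorem wirtZ_smul {f : disk → ℂ} (hf : IsC2Disk f) (c : ℂ) {z : ℂ} (hz : z ∈ disk) :
    wirtZ (extendZero (c • f)) z = c * wirtZ (extendZero f) z := by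
  simp only [wirtZ, extendZero_smul, fderiv_const_smul (hf.differentiableAt hz),
    _root_.smul_apply, smul_eq_mul]
  ring

theorem wirtZbar_smul {f : disk → ℂ} (hf : IsC2Disk f) (c : ℂ) {z : ℂ} (hz : z ∈ disk) :
    wirtZbar (extendZero (c • f)) z = c * wirtZbar (extendZero f) z := by
  simp only [wirtZbar, extendZero_smul, fderiv_const_smul (hf.differentiableAt hz),
    _root_.smul_apply, smul_eq_mul]
  ring

/-- The generator of the rotations as an endomorphism of a finite dimensional invariant space. -/
noncomputable def rotEnd (Y : Submodule ℂ (disk → ℂ)) [FiniteDimensional ℂ Y]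
    (hY : IsMoebiusInvariant Y) : Module.End ℂ Y where
  toFun f := ⟨rotOp f, rotOp_mem hY f.2⟩
  map_add' f g := by
    refine Subtype.ext (funext fun z => ?_)
    simp only [rotOp, Submodule.coe_add, Pi.add_apply,
      wirtZ_add (hY.1 f f.2) (hY.1 g g.2) z.2, wirtZbar_add (hY.1 f f.2) (hY.1 g g.2) z.2]
    ring
  map_smul' c f := by
    refine Subtype.ext (funext fun z => ?_)
    simp only [rotOp, Submodule.coe_smul, Pi.smul_apply, RingHom.id_apply, smul_eq_mul,
      wirtZ_smul (hY.1 f f.2) c z.2, wirtZbar_smul (hY.1 f f.2) c z.2]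
    ring

/-! ### Weights -/

/-- A function on the disk has weight `k` if it transforms under the rotation by `ζ` with the
factor `ζ ^ k`. -/
def HasWeight (k : ℤ) (f : disk → ℂ) : Prop :=
  ∀ ζ : ℂ, ‖ζ‖ = 1 → ∀ z : ℂ, extendZero f (ζ * z) = ζ ^ k * extendZero f z

theorem extendZero_of_notMem (f : disk → ℂ) {z : ℂ} (hz : z ∉ disk) : extendZero f z = 0 := by
  rw [extendZero, Function.extend_apply' _ _ _ (by rintro ⟨a, rfl⟩; exact hz a.2)]
  rfl

theorem rotate_mem_disk {ζ z : ℂ} (hζ : ‖ζ‖ = 1) : ζ * z ∈ disk ↔ z ∈ disk := by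
  rw [mem_disk, mem_disk, norm_mul, hζ, one_mul]

theorem HasWeight.of_mem {k : ℤ} {f : disk → ℂ}
    (h : ∀ ζ : ℂ, ‖ζ‖ = 1 → ∀ z ∈ disk, extendZero f (ζ * z) = ζ ^ k * extendZero f z) :
    HasWeight k f := by
  intro ζ hζ z
  by_cases hz : z ∈ disk
  · exact h ζ hζ z hz
  · rw [extendZero_of_notMem f hz, extendZero_of_notMem f (mt (rotate_mem_disk hζ).1 hz), mul_zero]

/-- The Wirtinger derivatives of a function of weight `k` transform with the weights `k - 1` and
`k + 1`. -/
theorem HasWeight.wirt {k : ℤ} {f : disk → ℂ} (hf : IsC2Disk f) (h : HasWeight k f) {ζ z : ℂ}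
    (hζ : ‖ζ‖ = 1) (hz : z ∈ disk) :
    ζ * wirtZ (extendZero f) (ζ * z) = ζ ^ k * wirtZ (extendZero f) z ∧
      (starRingEnd ℂ) ζ * wirtZbar (extendZero f) (ζ * z) =
        ζ ^ k * wirtZbar (extendZero f) z := by
  have hz' := (rotate_mem_disk hζ).2 hz
  have h1 (v : ℂ) : fderiv ℝ (extendZero f) (ζ * z) (ζ * v) =
      ζ ^ k * fderiv ℝ (extendZero f) z v := by
    have e1 : HasFDerivAt (fun u => extendZero f (ζ * u))
        ((fderiv ℝ (extendZero f) (ζ * z)).comp (ContinuousLinearMap.mul ℝ ℂ ζ)) z :=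
      HasFDerivAt.comp z (g := extendZero f) (f := fun u => ζ * u)
        (hf.differentiableAt hz').hasFDerivAt (ContinuousLinearMap.mul ℝ ℂ ζ).hasFDerivAt
    have e2 : HasFDerivAt (fun u => extendZero f (ζ * u))
        (ζ ^ k • fderiv ℝ (extendZero f) z) z := by
      have : (fun u => extendZero f (ζ * u)) = fun u => ζ ^ k • extendZero f u :=
        funext fun u => h ζ hζ u
      rw [this]
      exact (hf.differentiableAt hz).hasFDerivAt.const_smul (ζ ^ k)
    have := congrArg (fun L : ℂ →L[ℝ] ℂ => L v) (e1.unique e2)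
    simpa using this
  have a1 := h1 1
  have a2 := h1 Complex.I
  simp only [fderiv_eq_wirt, map_mul, map_one, Complex.conj_I, mul_one, one_mul] at a1 a2
  constructor
  · linear_combination (1 / 2 : ℂ) * a1 - (1 / 2 : ℂ) * Complex.I * a2 +
      (1 / 2 : ℂ) * (ζ * wirtZ (extendZero f) (ζ * z) - (starRingEnd ℂ) ζ *
        wirtZbar (extendZero f) (ζ * z) - ζ ^ k * wirtZ (extendZero f) z +
          ζ ^ k * wirtZbar (extendZero f) z) * Complex.I_mul_I
  · linear_combination (1 / 2 : ℂ) * a1 + (1 / 2 : ℂ) * Complex.I * a2 -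
      (1 / 2 : ℂ) * (ζ * wirtZ (extendZero f) (ζ * z) - (starRingEnd ℂ) ζ *
        wirtZbar (extendZero f) (ζ * z) - ζ ^ k * wirtZ (extendZero f) z +
          ζ ^ k * wirtZbar (extendZero f) z) * Complex.I_mul_I

theorem HasWeight.raiseOp {k : ℤ} {f : disk → ℂ} (hf : IsC2Disk f) (h : HasWeight k f) :
    HasWeight (k + 1) (raiseOp f) := by
  refine HasWeight.of_mem fun ζ hζ z hz => ?_
  have hz' := (rotate_mem_disk hζ).2 hz
  obtain ⟨h1, h2⟩ := h.wirt hf hζ hz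
  have hcc := mul_conj_eq_one hζ
  have hζ0 : ζ ≠ 0 := left_ne_zero_of_mul_eq_one hcc
  rw [extendZero_of_mem _ hz, extendZero_of_mem _ hz', zpow_add_one₀ hζ0]
  simp only [InvLaplace.raiseOp]
  linear_combination ζ * h2 - ζ * z ^ 2 * h1 - wirtZbar (extendZero f) (ζ * z) * hcc

theorem HasWeight.lowerOp {k : ℤ} {f : disk → ℂ} (hf : IsC2Disk f) (h : HasWeight k f) :
    HasWeight (k - 1) (lowerOp f) := by
  refine HasWeight.of_mem fun ζ hζ z hz => ?_
  have hz' := (rotate_mem_disk hζ).2 hz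
  obtain ⟨h1, h2⟩ := h.wirt hf hζ hz
  have hcc := mul_conj_eq_one hζ
  have hζ0 : ζ ≠ 0 := left_ne_zero_of_mul_eq_one hcc
  have hinv : ζ⁻¹ = (starRingEnd ℂ) ζ := inv_eq_of_mul_eq_one_right hcc
  rw [extendZero_of_mem _ hz, extendZero_of_mem _ hz', zpow_sub_one₀ hζ0, hinv]
  simp only [InvLaplace.lowerOp, map_mul]
  linear_combination (starRingEnd ℂ) ζ * h1 - (starRingEnd ℂ) ζ * (starRingEnd ℂ) z ^ 2 * h2 -
    wirtZ (extendZero f) (ζ * z) * hcc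

/-- The derivative of a function along the rotation orbits. -/
theorem hasDerivAt_rotate {f : disk → ℂ} (hf : IsC2Disk f) {z : ℂ} (hz : z ∈ disk) (θ : ℝ) :
    HasDerivAt (fun θ : ℝ => extendZero f (Complex.exp (θ * Complex.I) * z))
      (Complex.I * extendZero (rotOp f) (Complex.exp (θ * Complex.I) * z)) θ := by
  have hmem : Complex.exp (θ * Complex.I) * z ∈ disk :=
    (rotate_mem_disk (Complex.norm_exp_ofReal_mul_I θ)).2 hz
  have h1 : HasDerivAt (fun t : ℝ => Complex.exp (t * Complex.I) * z)
      (Complex.I * (Complex.exp (θ * Complex.I) * z)) θ := by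
    have := (((Complex.ofRealCLM.hasDerivAt (x := θ)).mul_const Complex.I).cexp).mul_const z
    refine this.congr_deriv ?_
    simp
    ring
  refine ((hf.differentiableAt hmem).hasFDerivAt.comp_hasDerivAt θ h1).congr_deriv ?_
  rw [fderiv_eq_wirt, extendZero_of_mem _ hmem, rotOp, map_mul, Complex.conj_I]
  ring

theorem rotOp_of_hasWeight {k : ℤ} {f : disk → ℂ} (hf : IsC2Disk f) (h : HasWeight k f) :
    rotOp f = (k : ℂ) • f := by
  funext ⟨z, hz⟩
  have h1 := hasDerivAt_rotate hf hz 0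
  have h2 : HasDerivAt (fun θ : ℝ => extendZero f (Complex.exp (θ * Complex.I) * z))
      (k * Complex.I * extendZero f z) 0 := by
    have e : (fun θ : ℝ => extendZero f (Complex.exp (θ * Complex.I) * z)) =
        fun θ : ℝ => Complex.exp (θ * (k * Complex.I)) * extendZero f z := by
      funext θ
      rw [h _ (Complex.norm_exp_ofReal_mul_I θ), ← Complex.exp_int_mul]
      congr 2
      ring
    rw [e]
    have := (((Complex.ofRealCLM.hasDerivAt (x := 0)).mul_const (k * Complex.I)).cexp).mul_const
      (extendZero f z)
    refine this.congr_deriv ?_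
    simp
  have h3 := h1.unique h2
  simp only [Complex.ofReal_zero, zero_mul, Complex.exp_zero, one_mul] at h3
  rw [extendZero_of_mem _ hz, extendZero_of_mem _ hz] at h3
  refine mul_left_cancel₀ Complex.I_ne_zero (h3.trans ?_)
  simp only [Pi.smul_apply, smul_eq_mul]
  ring

/-- If `(T - μ) f = g` and `(T - μ) g = 0` for the generator `T` of the rotations, then
`f (e^{iθ} z) = e^{iμθ} (f z + i θ g z)`. -/
theorem extendZero_rotate {f g : disk → ℂ} (hf : IsC2Disk f) (hg : IsC2Disk g) {μ : ℂ}
    (hfg : rotOp f = μ • f + g) (hgg : rotOp g = μ • g) {z : ℂ} (hz : z ∈ disk) (θ : ℝ) :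
    extendZero f (Complex.exp (θ * Complex.I) * z) = Complex.exp (μ * Complex.I * θ) *
        (extendZero f z + Complex.I * θ * extendZero g z) ∧
      extendZero g (Complex.exp (θ * Complex.I) * z) =
        Complex.exp (μ * Complex.I * θ) * extendZero g z := by
  have hE (s : ℝ) : HasDerivAt (fun s : ℝ => Complex.exp (-(μ * Complex.I * s)))
      (Complex.exp (-(μ * Complex.I * s)) * -(μ * Complex.I)) s := by
    have := ((Complex.ofRealCLM.hasDerivAt (x := s)).const_mul (μ * Complex.I)).fun_neg.cexp
    refine this.congr_deriv ?_
    simp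
  have hcancel (s : ℝ) :
      Complex.exp (μ * Complex.I * s) * Complex.exp (-(μ * Complex.I * s)) = 1 := by
    rw [← Complex.exp_add, add_neg_cancel, Complex.exp_zero]
  have hG (s : ℝ) : Complex.exp (-(μ * Complex.I * s)) *
      extendZero g (Complex.exp (s * Complex.I) * z) = extendZero g z := by
    have hd (s : ℝ) : HasDerivAt (fun s : ℝ => Complex.exp (-(μ * Complex.I * s)) *
        extendZero g (Complex.exp (s * Complex.I) * z)) 0 s := by
      refine ((hE s).mul (hasDerivAt_rotate hg hz s)).congr_deriv ?_
      rw [hgg, extendZero_smul, Pi.smul_apply, smul_eq_mul]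
      ring
    have := is_const_of_deriv_eq_zero (fun s => (hd s).differentiableAt) (fun s => (hd s).deriv) s 0
    simpa using this
  have hF (s : ℝ) : Complex.exp (-(μ * Complex.I * s)) *
      extendZero f (Complex.exp (s * Complex.I) * z) - Complex.I * s * extendZero g z =
        extendZero f z := by
    have hd (s : ℝ) : HasDerivAt (fun s : ℝ => Complex.exp (-(μ * Complex.I * s)) *
        extendZero f (Complex.exp (s * Complex.I) * z) - Complex.I * s * extendZero g z) 0 s := by
      have h1 : HasDerivAt (fun s : ℝ => Complex.I * s * extendZero g z)
          (Complex.I * extendZero g z) s := by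
        simpa using ((Complex.ofRealCLM.hasDerivAt (x := s)).const_mul Complex.I).mul_const
          (extendZero g z)
      refine (((hE s).mul (hasDerivAt_rotate hf hz s)).sub h1).congr_deriv ?_
      rw [hfg, extendZero_add, Pi.add_apply, extendZero_smul, Pi.smul_apply, smul_eq_mul]
      linear_combination Complex.I * hG s
    have := is_const_of_deriv_eq_zero (fun s => (hd s).differentiableAt) (fun s => (hd s).deriv) s 0
    simpa using this
  constructor
  · linear_combination Complex.exp (μ * Complex.I * θ) * hF θ -
      extendZero f (Complex.exp (θ * Complex.I) * z) * hcancel θ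
  · linear_combination Complex.exp (μ * Complex.I * θ) * hG θ -
      extendZero g (Complex.exp (θ * Complex.I) * z) * hcancel θ

theorem exists_ne_of_ne_zero {f : disk → ℂ} (h0 : f ≠ 0) : ∃ z ∈ disk, extendZero f z ≠ 0 := by
  obtain ⟨z, hz⟩ := Function.ne_iff.1 h0
  exact ⟨z, z.2, by rwa [extendZero_apply]⟩

theorem isC2Disk_zero : IsC2Disk (0 : disk → ℂ) := fun z _ => by
  rw [extendZero_zero]
  exact contDiffAt_const

theorem extendZero_rotate_of_eigen {f : disk → ℂ} (hf : IsC2Disk f) {μ : ℂ}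
    (hμ : rotOp f = μ • f) {z : ℂ} (hz : z ∈ disk) (θ : ℝ) :
    extendZero f (Complex.exp (θ * Complex.I) * z) =
      Complex.exp (μ * Complex.I * θ) * extendZero f z := by
  have h0 : rotOp 0 = μ • (0 : disk → ℂ) := by
    funext z
    simp [rotOp, wirtZ, wirtZbar, extendZero_zero]
  have h := (extendZero_rotate hf isC2Disk_zero (hμ.trans (add_zero _).symm) h0 hz θ).1
  rwa [extendZero_zero, Pi.zero_apply, mul_zero, add_zero] at h

/-- Eigenvalues of the generator of the rotations are integers, by `2π`-periodicity. -/
theorem exists_int_of_rotOp {f : disk → ℂ} (hf : IsC2Disk f) {μ : ℂ} (hμ : rotOp f = μ • f)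
    (h0 : f ≠ 0) : ∃ k : ℤ, μ = k := by
  obtain ⟨z, hz, hfz⟩ := exists_ne_of_ne_zero h0
  have h1 := extendZero_rotate_of_eigen hf hμ hz (2 * Real.pi)
  have h2 : Complex.exp (((2 * Real.pi : ℝ) : ℂ) * Complex.I) = 1 := by
    rw [Complex.ofReal_mul, Complex.ofReal_ofNat, Complex.exp_two_pi_mul_I]
  rw [h2, one_mul] at h1
  have h3 := mul_right_cancel₀ hfz ((one_mul _).trans h1)
  obtain ⟨k, hk⟩ := Complex.exp_eq_one_iff.1 h3.symm
  refine ⟨k, ?_⟩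
  have h4 : (2 * Real.pi * Complex.I : ℂ) ≠ 0 := Complex.two_pi_I_ne_zero
  refine mul_right_cancel₀ h4 ?_
  rw [← hk]
  push_cast
  ring

theorem hasWeight_of_rotOp {f : disk → ℂ} (hf : IsC2Disk f) {k : ℤ}
    (hk : rotOp f = (k : ℂ) • f) : HasWeight k f := by
  refine HasWeight.of_mem fun ζ hζ z hz => ?_
  have h1 : Complex.exp (ζ.arg * Complex.I) = ζ := by
    simpa [hζ] using Complex.norm_mul_exp_arg_mul_I ζ
  have h2 := extendZero_rotate_of_eigen hf hk hz ζ.arg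
  rw [h1] at h2
  rw [h2]
  congr 1
  rw [mul_assoc, mul_comm Complex.I, Complex.exp_int_mul, h1]

/-- The generator of the rotations has no Jordan blocks, by `2π`-periodicity. -/
theorem eq_zero_of_rotOp {f g : disk → ℂ} (hf : IsC2Disk f) (hg : IsC2Disk g) {μ : ℂ}
    (hfg : rotOp f = μ • f + g) (hgg : rotOp g = μ • g) : g = 0 := by
  by_contra h0
  obtain ⟨k, rfl⟩ := exists_int_of_rotOp hg hgg h0
  obtain ⟨z, hz, hgz⟩ := exists_ne_of_ne_zero h0
  have h1 := (extendZero_rotate hf hg hfg hgg hz (2 * Real.pi)).1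
  have h2 : Complex.exp (((2 * Real.pi : ℝ) : ℂ) * Complex.I) = 1 := by
    rw [Complex.ofReal_mul, Complex.ofReal_ofNat, Complex.exp_two_pi_mul_I]
  rw [mul_assoc, mul_comm Complex.I, Complex.exp_int_mul, h2, one_mul, one_zpow, one_mul,
    left_eq_add] at h1
  simp [Real.pi_ne_zero, hgz] at h1

/-! ### Highest and lowest weight functions -/

/-- The solutions of the radial equation `r (1 - r²) u' = k (1 + r²) u` on `(0, 1)` are the
multiples of `(r / (1 - r²)) ^ k`. For `k < 0` the non-zero ones blow up at the origin. -/
theorem radial_solution {u u' : ℝ → ℂ} {k : ℤ} (h0 : ContinuousAt u 0)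
    (hu : ∀ r ∈ Set.Ioo (0 : ℝ) 1, HasDerivAt u (u' r) r ∧
      r * (1 - r ^ 2) * u' r = k * (1 + r ^ 2) * u r) :
    ∃ n : ℕ, ∃ c : ℂ, (c ≠ 0 → k = n) ∧
      ∀ r ∈ Set.Ico (0 : ℝ) 1, u r = c * ((r : ℂ) / (1 - r ^ 2)) ^ n := by
  have hne {r : ℝ} (hr : r ∈ Set.Ioo (0 : ℝ) 1) : (r : ℂ) ≠ 0 ∧ (1 - r ^ 2 : ℂ) ≠ 0 := by
    have h1 : (1 - r ^ 2 : ℝ) ≠ 0 := by nlinarith [hr.1, hr.2]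
    exact ⟨by exact_mod_cast hr.1.ne', by exact_mod_cast h1⟩
  have hcont (n : ℕ) : ContinuousAt (fun r : ℝ => ((r : ℂ) / (1 - r ^ 2)) ^ n) 0 := by
    refine ContinuousAt.pow (ContinuousAt.div (by fun_prop) (by fun_prop) (by simp)) n
  have hext {v w : ℝ → ℂ} (hv : ContinuousAt v 0) (hw : ContinuousAt w 0)
      (hvw : ∀ r ∈ Set.Ioo (0 : ℝ) 1, v r = w r) : v 0 = w 0 := by
    refine tendsto_nhds_unique_of_eventuallyEq (hv.tendsto.mono_left nhdsWithin_le_nhds)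
      (hw.tendsto.mono_left nhdsWithin_le_nhds) (l := 𝓝[>] (0 : ℝ)) ?_
    filter_upwards [Ioo_mem_nhdsGT (show (0 : ℝ) < 1 by norm_num)] with r hr using hvw r hr
  -- `(r / (1 - r²)) ^ (-k)` is an integrating factor
  obtain ⟨c, hc⟩ : ∃ c : ℂ, ∀ r ∈ Set.Ioo (0 : ℝ) 1,
      ((r : ℂ) / (1 - r ^ 2)) ^ (-k) * u r = c := by
    have hd : ∀ r ∈ Set.Ioo (0 : ℝ) 1,
        HasDerivAt (fun r : ℝ => ((r : ℂ) / (1 - r ^ 2)) ^ (-k) * u r) 0 r := by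
      intro r hr
      obtain ⟨hr0, hr1⟩ := hne hr
      have hq : (r : ℂ) / (1 - r ^ 2) ≠ 0 := div_ne_zero hr0 hr1
      have e1 : HasDerivAt (fun x : ℂ => x / (1 - x ^ 2))
          ((1 + (r : ℂ) ^ 2) / (1 - (r : ℂ) ^ 2) ^ 2) r := by
        refine ((hasDerivAt_id (r : ℂ)).fun_div ((hasDerivAt_pow 2 (r : ℂ)).const_sub 1)
          hr1).congr_deriv ?_
        simp
        ring
      have e2 := (((hasDerivAt_zpow (-k) _ (Or.inl hq)).comp (r : ℂ) e1).comp_ofReal).fun_mul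
        (hu r hr).1
      refine e2.congr_deriv ?_
      have e3 : u' r = k * (1 + r ^ 2) * u r / (r * (1 - r ^ 2)) := by
        rw [eq_div_iff (mul_ne_zero hr0 hr1), ← (hu r hr).2]
        ring
      simp only [Function.comp_apply]
      rw [e3, zpow_sub_one₀ hq, inv_div]
      push_cast
      field_simp
      ring
    exact isOpen_Ioo.exists_is_const_of_deriv_eq_zero isPreconnected_Ioo
      (fun r hr => (hd r hr).differentiableAt.differentiableWithinAt) fun r hr => (hd r hr).deriv
  have hu' : ∀ r ∈ Set.Ioo (0 : ℝ) 1, u r = c * ((r : ℂ) / (1 - r ^ 2)) ^ k := by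
    intro r hr
    obtain ⟨hr0, hr1⟩ := hne hr
    rw [← hc r hr, mul_right_comm, ← zpow_add₀ (div_ne_zero hr0 hr1), neg_add_cancel, zpow_zero,
      one_mul]
  have hIco (n : ℕ) (d : ℂ)
      (h : ∀ r ∈ Set.Ioo (0 : ℝ) 1, u r = d * ((r : ℂ) / (1 - r ^ 2)) ^ n) :
      ∀ r ∈ Set.Ico (0 : ℝ) 1, u r = d * ((r : ℂ) / (1 - r ^ 2)) ^ n := by
    intro r hr
    rcases hr.1.eq_or_lt with rfl | hr'
    · exact hext (w := fun r : ℝ => d * ((r : ℂ) / (1 - r ^ 2)) ^ n) h0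
        ((hcont n).const_mul d) h
    · exact h r ⟨hr', hr.2⟩
  obtain ⟨n, rfl | rfl⟩ := k.eq_nat_or_neg
  · exact ⟨n, c, fun _ => rfl, hIco n c fun r hr => by rw [hu' r hr, zpow_natCast]⟩
  · rcases Nat.eq_zero_or_pos n with rfl | hn
    · exact ⟨0, c, fun _ => by simp, hIco 0 c fun r hr => by simpa using hu' r hr⟩
    · -- for negative `k`, continuity at `0` forces the constant of integration to vanish
      have hc0 : c = 0 := by
        have := hext (v := fun r : ℝ => ((r : ℂ) / (1 - r ^ 2)) ^ n * u r) (w := fun _ => c)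
          ((hcont n).mul h0) continuousAt_const fun r hr => by
            have := hc r hr
            rwa [neg_neg, zpow_natCast] at this
        simpa [hn.ne'] using this.symm
      refine ⟨0, 0, fun h => absurd rfl h, hIco 0 0 fun r hr => ?_⟩
      rw [hu' r hr, hc0, zero_mul, zero_mul]

theorem HasWeight.rotOp_apply {k : ℤ} {f : disk → ℂ} (hf : IsC2Disk f) (h : HasWeight k f) {z : ℂ}
    (hz : z ∈ disk) : z * wirtZ (extendZero f) z - (starRingEnd ℂ) z * wirtZbar (extendZero f) z =
      k * extendZero f z := by
  have := congrFun (rotOp_of_hasWeight hf h) ⟨z, hz⟩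
  rw [extendZero_of_mem f hz]
  exact this

theorem ofReal_mem_disk {r : ℝ} (hr : r ∈ Set.Ico (0 : ℝ) 1) : (r : ℂ) ∈ disk := by
  rw [mem_disk, Complex.norm_real, Real.norm_of_nonneg hr.1]
  exact hr.2

theorem IsC2Disk.hasDerivAt_ofReal {f : disk → ℂ} (hf : IsC2Disk f) {r : ℝ}
    (hr : r ∈ Set.Ico (0 : ℝ) 1) : HasDerivAt (fun r : ℝ => extendZero f r)
      (wirtZ (extendZero f) r + wirtZbar (extendZero f) r) r := by
  have h := HasFDerivAt.comp_hasDerivAt (f := fun r : ℝ => (r : ℂ)) r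
    (hf.differentiableAt (ofReal_mem_disk hr)).hasFDerivAt Complex.ofRealCLM.hasDerivAt
  refine h.congr_deriv ?_
  rw [fderiv_eq_wirt]
  simp

theorem HasWeight.eq_polar {k : ℤ} {f : disk → ℂ} (h : HasWeight k f) (z : disk) :
    ∃ ζ : ℂ, ‖ζ‖ = 1 ∧ (z : ℂ) = ζ * (‖(z : ℂ)‖ : ℂ) ∧
      f z = ζ ^ k * extendZero f (‖(z : ℂ)‖ : ℂ) := by
  refine ⟨Complex.exp ((z : ℂ).arg * Complex.I), Complex.norm_exp_ofReal_mul_I _, ?_, ?_⟩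
  · rw [mul_comm, Complex.norm_mul_exp_arg_mul_I]
  · rw [← h _ (Complex.norm_exp_ofReal_mul_I _), mul_comm (Complex.exp _),
      Complex.norm_mul_exp_arg_mul_I, extendZero_apply]

/-- Highest weight functions: a weight function annihilated by the raising operator is a multiple of
`(z / (1 - |z|²)) ^ n`, and has the weight `n ≥ 0`. -/
theorem eq_smul_of_raiseOp_eq_zero {k : ℤ} {f : disk → ℂ} (hf : IsC2Disk f) (hk : HasWeight k f)
    (h : raiseOp f = 0) (h0 : f ≠ 0) : ∃ n : ℕ, k = n ∧ ∃ c : ℂ, f = c • diskKernel n 0 1 := by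
  obtain ⟨n, c, hc, hu⟩ := radial_solution (u := fun r : ℝ => extendZero f r) (k := k)
    (hf.hasDerivAt_ofReal ⟨le_rfl, one_pos⟩).continuousAt fun r hr => by
      have hr' : r ∈ Set.Ico (0 : ℝ) 1 := ⟨hr.1.le, hr.2⟩
      refine ⟨hf.hasDerivAt_ofReal hr', ?_⟩
      have h1 := hk.rotOp_apply hf (ofReal_mem_disk hr')
      have h2 : wirtZbar (extendZero f) r - (r : ℂ) ^ 2 * wirtZ (extendZero f) r = 0 :=
        congrFun h ⟨r, ofReal_mem_disk hr'⟩
      rw [Complex.conj_ofReal] at h1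
      linear_combination (1 + (r : ℂ) ^ 2) * h1 + 2 * (r : ℂ) * h2
  have hf' (z : disk) : ∃ ζ : ℂ, (z : ℂ) = ζ * (‖(z : ℂ)‖ : ℂ) ∧ f z = ζ ^ k *
      (c * ((‖(z : ℂ)‖ : ℂ) / (1 - (‖(z : ℂ)‖ : ℂ) ^ 2)) ^ n) := by
    obtain ⟨ζ, -, h1, h2⟩ := hk.eq_polar z
    exact ⟨ζ, h1, h2.trans (congrArg _ (hu _ ⟨norm_nonneg _, mem_disk.1 z.2⟩))⟩
  have hc0 : c ≠ 0 := by
    rintro rfl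
    refine h0 (funext fun z => ?_)
    obtain ⟨ζ, -, h2⟩ := hf' z
    simpa using h2
  -- the sign comes from `poisson 0 1 (z, w) = -z / (1 - z w)`
  refine ⟨n, hc hc0, c * (-1) ^ n, funext fun z => ?_⟩
  obtain ⟨ζ, h1, h2⟩ := hf' z
  rw [h2, hc hc0, zpow_natCast, Pi.smul_apply, diskKernel_apply, smul_eq_mul, poisson, mul_assoc,
    ← mul_pow, mul_left_comm, ← mul_pow]
  congr 2
  simp only [← ofReal_norm_sq]
  rw [mul_div_assoc', ← h1]
  ring

/-- Lowest weight functions: a weight function annihilated by the lowering operator is a multiple of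
`(conj z / (1 - |z|²)) ^ n`, and has the weight `-n ≤ 0`. -/
theorem eq_smul_of_lowerOp_eq_zero {k : ℤ} {f : disk → ℂ} (hf : IsC2Disk f) (hk : HasWeight k f)
    (h : lowerOp f = 0) (h0 : f ≠ 0) : ∃ n : ℕ, k = -n ∧ ∃ c : ℂ, f = c • diskKernel n 1 0 := by
  obtain ⟨n, c, hc, hu⟩ := radial_solution (u := fun r : ℝ => extendZero f r) (k := -k)
    (hf.hasDerivAt_ofReal ⟨le_rfl, one_pos⟩).continuousAt fun r hr => by
      have hr' : r ∈ Set.Ico (0 : ℝ) 1 := ⟨hr.1.le, hr.2⟩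
      refine ⟨hf.hasDerivAt_ofReal hr', ?_⟩
      have h1 := hk.rotOp_apply hf (ofReal_mem_disk hr')
      have h2 : wirtZ (extendZero f) r - (starRingEnd ℂ) (r : ℂ) ^ 2 *
          wirtZbar (extendZero f) r = 0 := congrFun h ⟨r, ofReal_mem_disk hr'⟩
      rw [Complex.conj_ofReal] at h1 h2
      push_cast
      linear_combination -(1 + (r : ℂ) ^ 2) * h1 + 2 * (r : ℂ) * h2
  have hf' (z : disk) : ∃ ζ : ℂ, ‖ζ‖ = 1 ∧ (z : ℂ) = ζ * (‖(z : ℂ)‖ : ℂ) ∧ f z = ζ ^ k *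
      (c * ((‖(z : ℂ)‖ : ℂ) / (1 - (‖(z : ℂ)‖ : ℂ) ^ 2)) ^ n) := by
    obtain ⟨ζ, h0, h1, h2⟩ := hk.eq_polar z
    exact ⟨ζ, h0, h1, h2.trans (congrArg _ (hu _ ⟨norm_nonneg _, mem_disk.1 z.2⟩))⟩
  have hc0 : c ≠ 0 := by
    rintro rfl
    refine h0 (funext fun z => ?_)
    obtain ⟨ζ, -, -, h2⟩ := hf' z
    simpa using h2
  have hkn : k = -n := by rw [← hc hc0, neg_neg]
  -- the sign comes from `poisson 1 0 (z, w) = -w / (1 - z w)`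
  refine ⟨n, hkn, c * (-1) ^ n, funext fun z => ?_⟩
  obtain ⟨ζ, hζ, h1, h2⟩ := hf' z
  have h3 : (starRingEnd ℂ) (z : ℂ) = (starRingEnd ℂ) ζ * (‖(z : ℂ)‖ : ℂ) := by
    conv_lhs => rw [h1, map_mul, Complex.conj_ofReal]
  rw [h2, hkn, zpow_neg, ← inv_zpow, inv_eq_of_mul_eq_one_right (mul_conj_eq_one hζ),
    zpow_natCast, Pi.smul_apply, diskKernel_apply, smul_eq_mul, poisson, mul_assoc,
    ← mul_pow, mul_left_comm, ← mul_pow]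
  congr 2
  simp only [← ofReal_norm_sq]
  rw [mul_div_assoc', ← h3]
  ring

theorem eq_of_mem_diskEigenspace {f : disk → ℂ} {lam lam' : ℂ} (h : f ∈ diskEigenspace lam)
    (h' : f ∈ diskEigenspace lam') (h0 : f ≠ 0) : lam = lam' := by
  obtain ⟨z, hz, hfz⟩ := exists_ne_of_ne_zero h0
  exact mul_right_cancel₀ hfz ((h.2 z hz).symm.trans (h'.2 z hz))

/-! ### Uniqueness of the finite dimensional invariant subspace -/

theorem HasWeight.sub_smul {k : ℤ} {f g : disk → ℂ} (hf : HasWeight k f) (hg : HasWeight k g)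
    (c : ℂ) : HasWeight k (g - c • f) := by
  intro ζ hζ z
  rw [sub_eq_add_neg, ← neg_smul]
  simp only [extendZero_add, extendZero_smul, Pi.add_apply, Pi.smul_apply, smul_eq_mul, hf ζ hζ z,
    hg ζ hζ z]
  ring

theorem raiseOp_sub_smul {f g : disk → ℂ} (hf : IsC2Disk f) (hg : IsC2Disk g) (c : ℂ) :
    raiseOp (g - c • f) = raiseOp g - c • raiseOp f := by
  have hcf : IsC2Disk (-c • f) := fun z hz => by
    rw [extendZero_smul]
    exact (hf z hz).const_smul (-c)
  funext z
  rw [sub_eq_add_neg, ← neg_smul]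
  simp only [raiseOp, Pi.sub_apply, Pi.smul_apply, smul_eq_mul, wirtZ_add hg hcf z.2,
    wirtZbar_add hg hcf z.2, wirtZ_smul hf _ z.2, wirtZbar_smul hf _ z.2]
  ring

section Uniqueness

variable {m : ℕ} {Y : Submodule ℂ (disk → ℂ)}

theorem eq_highest_of_raiseOp_eq_zero (hle : Y ≤ diskEigenspace (4 * m * (m + 1))) {k : ℤ}
    {f : disk → ℂ} (hf : f ∈ Y) (hk : HasWeight k f) (h : raiseOp f = 0) (h0 : f ≠ 0) :
    k = m ∧ ∃ c : ℂ, f = c • diskKernel m 0 1 := by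
  obtain ⟨n, rfl, c, hc⟩ := eq_smul_of_raiseOp_eq_zero (hle hf).1 hk h h0
  have h1 : f ∈ diskEigenspace (4 * n * (n + 1)) := by
    rw [hc]
    exact Submodule.smul_mem _ _ (hypSpace_le _ (diskKernel_mem n 0 1))
  obtain rfl := eigenvalue_injective (eq_of_mem_diskEigenspace (hle hf) h1 h0)
  exact ⟨rfl, c, hc⟩

theorem eq_lowest_of_lowerOp_eq_zero (hle : Y ≤ diskEigenspace (4 * m * (m + 1))) {k : ℤ}
    {f : disk → ℂ} (hf : f ∈ Y) (hk : HasWeight k f) (h : lowerOp f = 0) (h0 : f ≠ 0) :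
    k = -m := by
  obtain ⟨n, rfl, c, hc⟩ := eq_smul_of_lowerOp_eq_zero (hle hf).1 hk h h0
  have h1 : f ∈ diskEigenspace (4 * n * (n + 1)) := by
    rw [hc]
    exact Submodule.smul_mem _ _ (hypSpace_le _ (diskKernel_mem n 1 0))
  rw [eigenvalue_injective (eq_of_mem_diskEigenspace (hle hf) h1 h0)]

/-- The Möbius images of the highest weight function span the restrictions of `X_lam(Ω)`. -/
theorem hypSpace_le_of_diskKernel_mem (hY : IsMoebiusInvariant Y) (h : diskKernel m 0 1 ∈ Y) :
    hypSpace (4 * m * (m + 1)) ≤ Y := by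
  have h1 {a : ℂ} (ha : ‖a‖ < 1) : diskKernel m a 1 ∈ Y := by
    have e : diskKernel m 0 1 ∘ diskMoebius norm_one ha =
        (1 / (1 - (starRingEnd ℂ) a * a)) ^ m • diskKernel m a 1 := by
      funext z
      have := diskKernel_comp_moebius m norm_one ha 0 1 z (w := diskMoebius norm_one ha z) rfl
      simpa using this
    have hne : (1 / (1 - (starRingEnd ℂ) a * a)) ^ m ≠ 0 :=
      pow_ne_zero _ (one_div_ne_zero (one_sub_conj_mul_ne_zero ha ha))
    refine (Y.smul_mem_iff hne).1 ?_
    rw [← e]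
    exact hY.2.2 _ h _ (isDiskAut_diskMoebius norm_one ha)
  -- the parameters are `i + 2`, so that their inverses lie in the disk
  rw [← span_diskKernel m (t := fun i => (((i : ℕ) + 2 : ℕ) : ℂ))
    (fun i j h => Fin.ext (by simpa using h)), Submodule.span_le]
  rintro _ ⟨i, rfl⟩
  have ht : (((i : ℕ) + 2 : ℕ) : ℂ) ≠ 0 := Nat.cast_ne_zero.2 (Nat.succ_ne_zero _)
  have e : diskKernel m 1 (-(((i : ℕ) + 2 : ℕ) : ℂ)) = (((((i : ℕ) + 2 : ℕ) : ℂ)) ^ 2) ^ m •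
      diskKernel m (-(((i : ℕ) + 2 : ℕ) : ℂ)⁻¹) 1 := by
    funext z
    rw [Pi.smul_apply, diskKernel_apply, diskKernel_apply, smul_eq_mul, ← mul_pow]
    congr 1
    simp only [poisson]
    field_simp
    ring
  change diskKernel m 1 (-(((i : ℕ) + 2 : ℕ) : ℂ)) ∈ Y
  rw [e]
  refine Y.smul_mem _ (h1 ?_)
  rw [norm_neg, norm_inv, Complex.norm_natCast]
  exact inv_lt_one_of_one_lt₀ (by push_cast; linarith [Nat.cast_nonneg (α := ℝ) (i : ℕ)])

variable [FiniteDimensional ℂ Y]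

theorem hasEigenvalue_rotEnd (hY : IsMoebiusInvariant Y) {k : ℤ} {f : disk → ℂ} (hf : f ∈ Y)
    (hk : HasWeight k f) (h0 : f ≠ 0) : (rotEnd Y hY).HasEigenvalue (k : ℂ) := by
  refine Module.End.hasEigenvalue_of_hasEigenvector (x := ⟨f, hf⟩)
    ⟨Module.End.mem_eigenspace_iff.2 (Subtype.ext ?_), fun h => h0 (congrArg Subtype.val h)⟩
  exact rotOp_of_hasWeight (hY.1 f hf) hk

theorem exists_hasWeight_of_eigen (hY : IsMoebiusInvariant Y) {μ : ℂ} {f : Y}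
    (hf : f ∈ (rotEnd Y hY).eigenspace μ) (h0 : f ≠ 0) :
    ∃ k : ℤ, HasWeight k (f : disk → ℂ) := by
  have h1 : rotOp f = μ • (f : disk → ℂ) :=
    congrArg Subtype.val (Module.End.mem_eigenspace_iff.1 hf)
  obtain ⟨k, rfl⟩ := exists_int_of_rotOp (hY.1 f f.2) h1 fun h => h0 (Subtype.ext h)
  exact ⟨k, hasWeight_of_rotOp (hY.1 f f.2) h1⟩

theorem finite_weights (hY : IsMoebiusInvariant Y) :
    {k : ℤ | ∃ f ∈ Y, HasWeight k f ∧ f ≠ 0}.Finite := by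
  refine Set.Finite.of_finite_image (f := fun k : ℤ => (k : ℂ))
    (Set.Finite.subset (Module.End.finite_hasEigenvalue (rotEnd Y hY)) ?_)
    Int.cast_injective.injOn
  rintro _ ⟨k, ⟨f, hf, hk, h0⟩, rfl⟩
  exact hasEigenvalue_rotEnd hY hf hk h0

/-- The weights are at most `m`: otherwise repeated raising would produce infinitely many
weights. -/
theorem weight_le (hY : IsMoebiusInvariant Y) (hle : Y ≤ diskEigenspace (4 * m * (m + 1))) {k : ℤ}
    {f : disk → ℂ} (hf : f ∈ Y) (hk : HasWeight k f) (h0 : f ≠ 0) : k ≤ m := by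
  by_contra! hlt
  have h (j : ℕ) : k + j ∈ {k : ℤ | ∃ f ∈ Y, HasWeight k f ∧ f ≠ 0} := by
    induction j with
    | zero => exact ⟨f, hf, by simpa using hk, h0⟩
    | succ j ih =>
      obtain ⟨g, hg, hgk, hg0⟩ := ih
      refine ⟨raiseOp g, raiseOp_mem hY hg, ?_, fun h => ?_⟩
      · simpa [add_assoc] using hgk.raiseOp (hY.1 g hg)
      · have := (eq_highest_of_raiseOp_eq_zero hle hg hgk h hg0).1
        omega
  exact Set.infinite_of_injective_forall_mem (f := fun j : ℕ => k + j)
    (fun i j hij => by simpa using hij) h (finite_weights hY)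

theorem le_weight (hY : IsMoebiusInvariant Y) (hle : Y ≤ diskEigenspace (4 * m * (m + 1))) {k : ℤ}
    {f : disk → ℂ} (hf : f ∈ Y) (hk : HasWeight k f) (h0 : f ≠ 0) : -m ≤ k := by
  by_contra! hlt
  have h (j : ℕ) : k - j ∈ {k : ℤ | ∃ f ∈ Y, HasWeight k f ∧ f ≠ 0} := by
    induction j with
    | zero => exact ⟨f, hf, by simpa using hk, h0⟩
    | succ j ih =>
      obtain ⟨g, hg, hgk, hg0⟩ := ih
      refine ⟨lowerOp g, lowerOp_mem hY hg, ?_, fun h => ?_⟩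
      · simpa [sub_sub] using hgk.lowerOp (hY.1 g hg)
      · have := eq_lowest_of_lowerOp_eq_zero hle hg hgk h hg0
        omega
  exact Set.infinite_of_injective_forall_mem (f := fun j : ℕ => k - j)
    (fun i j hij => by simpa using hij) h (finite_weights hY)

/-- Each weight occurs with multiplicity at most one. -/
theorem exists_eq_smul_of_hasWeight (hY : IsMoebiusInvariant Y)
    (hle : Y ≤ diskEigenspace (4 * m * (m + 1))) (j : ℕ) : ∀ {k : ℤ} {f g : disk → ℂ}, k + j = m →
      f ∈ Y → g ∈ Y → HasWeight k f → HasWeight k g → f ≠ 0 → ∃ c : ℂ, g = c • f := by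
  induction j with
  | zero =>
    intro k f g hkm hf hg hkf hkg h0
    have htop {h : disk → ℂ} (hh : h ∈ Y) (hkh : HasWeight k h) : raiseOp h = 0 := by
      by_contra hne
      have := weight_le hY hle (raiseOp_mem hY hh) (hkh.raiseOp (hY.1 h hh)) hne
      omega
    by_cases hg0 : g = 0
    · exact ⟨0, by rw [hg0, zero_smul]⟩
    obtain ⟨-, c, hc⟩ := eq_highest_of_raiseOp_eq_zero hle hf hkf (htop hf hkf) h0
    obtain ⟨-, d, hd⟩ := eq_highest_of_raiseOp_eq_zero hle hg hkg (htop hg hkg) hg0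
    have hc0 : c ≠ 0 := by
      rintro rfl
      exact h0 (by rw [hc, zero_smul])
    exact ⟨d / c, by rw [hc, hd, smul_smul, div_mul_cancel₀ _ hc0]⟩
  | succ j ih =>
    intro k f g hkm hf hg hkf hkg h0
    push_cast at hkm
    have hne {h : disk → ℂ} (hh : h ∈ Y) (hkh : HasWeight k h) (hz : raiseOp h = 0) : h = 0 := by
      by_contra hne
      have := (eq_highest_of_raiseOp_eq_zero hle hh hkh hz hne).1
      omega
    obtain ⟨c, hc⟩ := ih (by omega) (raiseOp_mem hY hf) (raiseOp_mem hY hg)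
      (hkf.raiseOp (hY.1 f hf)) (hkg.raiseOp (hY.1 g hg)) fun h => h0 (hne hf hkf h)
    refine ⟨c, sub_eq_zero.1 (hne (Y.sub_mem hg (Y.smul_mem c hf)) (hkf.sub_smul hkg c) ?_)⟩
    rw [raiseOp_sub_smul (hY.1 f hf) (hY.1 g hg), hc, sub_self]

/-- Raising a weight function `m - k` times reaches the highest weight function. -/
theorem diskKernel_mem_of_hasWeight (hY : IsMoebiusInvariant Y)
    (hle : Y ≤ diskEigenspace (4 * m * (m + 1))) (j : ℕ) : ∀ {k : ℤ} {f : disk → ℂ}, k + j = m →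
      f ∈ Y → HasWeight k f → f ≠ 0 → diskKernel m 0 1 ∈ Y := by
  induction j with
  | zero =>
    intro k f hkm hf hkf h0
    obtain ⟨-, c, rfl⟩ := eq_highest_of_raiseOp_eq_zero hle hf hkf (by
      by_contra hne
      have := weight_le hY hle (raiseOp_mem hY hf) (hkf.raiseOp (hY.1 f hf)) hne
      omega) h0
    exact (Y.smul_mem_iff (left_ne_zero_of_smul h0)).1 hf
  | succ j ih =>
    intro k f hkm hf hkf h0
    push_cast at hkm
    refine ih (by omega) (raiseOp_mem hY hf) (hkf.raiseOp (hY.1 f hf)) fun h => ?_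
    have := (eq_highest_of_raiseOp_eq_zero hle hf hkf h h0).1
    omega

/-- The generator of the rotations is diagonalizable on `Y`. -/
theorem iSup_eigenspace_rotEnd (hY : IsMoebiusInvariant Y) :
    ⨆ μ : ℂ, (rotEnd Y hY).eigenspace μ = ⊤ := by
  refine top_le_iff.1 ((Module.End.iSup_maxGenEigenspace_eq_top (rotEnd Y hY)).ge.trans
    (iSup_mono fun μ f hf => ?_))
  obtain ⟨n, hn⟩ := (Module.End.mem_maxGenEigenspace _ _ _).1 hf
  set S := rotEnd Y hY - μ • (1 : Module.End ℂ Y) with hS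
  have hSS (x : Y) (hx : S (S x) = 0) : S x = 0 := by
    have h1 : rotOp x = μ • (x : disk → ℂ) + (S x : Y) := by
      simp only [hS, LinearMap.sub_apply, LinearMap.smul_apply, Module.End.one_apply,
        Submodule.coe_sub, Submodule.coe_smul]
      exact (add_sub_cancel _ _).symm
    have h2 : rotOp (S x : Y) = μ • ((S x : Y) : disk → ℂ) := by
      have : (rotEnd Y hY) (S x) - μ • S x = 0 := hx
      exact congrArg Subtype.val (sub_eq_zero.1 this)
    exact Subtype.ext (eq_zero_of_rotOp (hY.1 x x.2) (hY.1 _ (S x).2) h1 h2)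
  have hpow (n : ℕ) : ∀ x : Y, (S ^ n) x = 0 → S x = 0 := by
    induction n with
    | zero => intro x hx; rw [show x = 0 from hx, map_zero]
    | succ n ih => intro x hx; rw [pow_succ, Module.End.mul_apply] at hx; exact hSS x (ih _ hx)
  exact Module.End.mem_eigenspace_iff.2 (sub_eq_zero.1 (hpow n f hn))

theorem finrank_le_of_isMoebiusInvariant (hY : IsMoebiusInvariant Y)
    (hle : Y ≤ diskEigenspace (4 * m * (m + 1))) : Module.finrank ℂ Y ≤ 2 * m + 1 := by
  classical
  -- choose a generator of each weight space
  have hw (k : ℤ) : ∃ w : Y, HasWeight k (w : disk → ℂ) ∧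
      ∀ f : Y, HasWeight k (f : disk → ℂ) → ∃ c : ℂ, f = c • w := by
    by_cases h : ∃ w : Y, HasWeight k (w : disk → ℂ) ∧ w ≠ 0
    · obtain ⟨w, hw, hw0⟩ := h
      have hw0' : (w : disk → ℂ) ≠ 0 := fun h => hw0 (Subtype.ext h)
      refine ⟨w, hw, fun f hf => ?_⟩
      have hkm := weight_le hY hle w.2 hw hw0'
      obtain ⟨c, hc⟩ := exists_eq_smul_of_hasWeight hY hle (m - k).toNat (by omega) w.2 f.2 hw hf
        hw0'
      exact ⟨c, Subtype.ext hc⟩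
    · push Not at h
      exact ⟨0, fun ζ _ z => by simp [extendZero_zero], fun f hf => ⟨0, by rw [h f hf, smul_zero]⟩⟩
  choose w hw hw' using hw
  have hspan : Submodule.span ℂ (((Finset.Icc (-m : ℤ) m).image w : Finset Y) : Set Y) = ⊤ := by
    refine top_le_iff.1 ((iSup_eigenspace_rotEnd hY).ge.trans (iSup_le fun μ f hf => ?_))
    by_cases h0 : f = 0
    · rw [h0]
      exact Submodule.zero_mem _
    · obtain ⟨k, hk⟩ := exists_hasWeight_of_eigen hY hf h0
      have h0' : (f : disk → ℂ) ≠ 0 := fun h => h0 (Subtype.ext h)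
      obtain ⟨c, rfl⟩ := hw' k f hk
      refine Submodule.smul_mem _ c (Submodule.subset_span ?_)
      exact Finset.mem_coe.2 (Finset.mem_image_of_mem w
        (Finset.mem_Icc.2 ⟨le_weight hY hle (c • w k).2 hk h0',
          weight_le hY hle (c • w k).2 hk h0'⟩))
  have h1 := finrank_span_finset_le_card (R := ℂ) ((Finset.Icc (-m : ℤ) m).image w)
  rw [Set.finrank, hspan, finrank_top] at h1
  refine h1.trans (Finset.card_image_le.trans ?_)
  rw [Int.card_Icc]
  omega

end Uniqueness

theorem eq_hypSpace_of_isFiniteMoebiusSubspace {m : ℕ} {Y : Submodule ℂ (disk → ℂ)}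
    (h : IsFiniteMoebiusSubspace (4 * m * (m + 1)) Y) : Y = hypSpace (4 * m * (m + 1)) := by
  obtain ⟨hle, hY, hne, -, hfin⟩ := h
  have : Nontrivial Y := Submodule.nontrivial_iff_ne_bot.2 hne
  obtain ⟨μ, hμ⟩ := Module.End.exists_eigenvalue (rotEnd Y hY)
  obtain ⟨f, hf, h0⟩ := hμ.exists_hasEigenvector
  obtain ⟨k, hk⟩ := exists_hasWeight_of_eigen hY hf h0
  have h0' : (f : disk → ℂ) ≠ 0 := fun h => h0 (Subtype.ext h)
  have hkm := weight_le hY hle f.2 hk h0'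
  have hK := diskKernel_mem_of_hasWeight hY hle (m - k).toNat (by omega) f.2 hk h0'
  refine (Submodule.eq_of_le_of_finrank_le (hypSpace_le_of_diskKernel_mem hY hK) ?_).symm
  rw [finrank_hypSpace]
  exact finrank_le_of_isMoebiusInvariant hY hle

end InvLaplace


open InvLaplace in
theorem mainTheorem3 (lam : ℂ) :
    List.TFAE [
      ∃ F ∈ eigenspace lam bidisk, F ≠ 0 ∧ IsMaximalDomainOfExistence F Omega,
      ∃ g ∈ sphereEigenspace lam, g ≠ 0,
      ∃ m : ℕ, lam = 4 * m * (m + 1)] ∧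
    ∀ m : ℕ, lam = 4 * m * (m + 1) →
      Module.finrank ℂ (eigenspace lam Omega) = 2 * m + 1 ∧
      (∀ Y : Submodule ℂ (disk → ℂ), IsFiniteMoebiusSubspace lam Y ↔
        Y = ((eigenspace lam Omega).map restrictBidisk).map restrictHyp) ∧
      (∀ Y : Submodule ℂ (disk → ℂ), IsFiniteMoebiusSubspace lam Y →
        ∀ F ∈ eigenspace lam bidisk, restrictHyp F ∈ Y →
          ∀ D : Set (Sphere × Sphere), IsMaximalDomainOfExistence F D ↔ D = Omega) ∧
      sphereEigenspace lam = (eigenspace lam Omega).map restrictSph := by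
  refine ⟨tfae_eigenvalue lam, ?_⟩
  rintro m rfl
  refine ⟨finrank_eigenspace m, fun Y => ⟨eq_hypSpace_of_isFiniteMoebiusSubspace, ?_⟩,
    fun Y hY F hF h D => ?_, sphereEigenspace_eq m⟩
  · rintro rfl
    exact isFiniteMoebiusSubspace_hypSpace m
  · rw [eq_hypSpace_of_isFiniteMoebiusSubspace hY] at h
    exact isMaximalDomain_iff (hasHoloExtension_of_restrictHyp_mem hF h) D
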